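/- Let $d \ge 1$ and let $\Omega = [0,1)^d$ be the flat unit torus. Let $W : \mathbb R \to [0,\infty)$ be a symmetric double-well potential: $W \in C^3(\mathbb R)$, $W(s) = W(-s)$, $W(s) = 0$ if and only if $s = \pm 1$, $W''(1) = W''(-1) > 0$, $W''(s)$ is nondecreasing for $s \ge 1$, $W''(s) \to +\infty$ as $|s| \to \infty$, $|W'(s)| \le C(1+|s|^q)$ for some $C > 0$ and $q > 1$, with $q < \frac{d+2}{d-2}$ if $d > 2$, and $\int_{-1}^1 \sqrt{2W(s)}\,ds = 1$. Set $\kappa = 1/\sqrt{W''(1)}$. Let $G$ and $G_0$ be the kernels on $\Omega$ (with periodic boundary conditions) that solve $$-\Delta G + \kappa^2 G = \delta_0, \qquad -\Delta G_0 = \delta_0 - 1, \quad \int_\Omega G_0 \, dx = 0,$$ where $\delta_0$ is the Dirac mass at the origin. For $\varepsilon > 0$ and $\bar u \in \mathbb R$ let $$\mathcal E[u] = \int_\Omega \Big( \frac{\varepsilon^2}{2} |\nabla u|^2 + W(u) \Big) dx + \frac12 \int_\Omega \int_\Omega (u(x) - \bar u)\, G_0(x-y)\, (u(y) - \bar u)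 \, dx \, dy$$ for $u \in H^1(\Omega)$ with $\int_\Omega u \, dx = \bar u$, and $$E[u_0] = \frac{\varepsilon}{2} \int_\Omega |\nabla u_0| \, dx + \frac12 \int_\Omega \int_\Omega (u_0(x) - \bar u)\, G(x-y)\, (u_0(y) - \bar u) \, dx \, dy$$ for $u_0 \in BV(\Omega; \{-1,1\})$, where $\int_\Omega |\nabla u_0|\,dx$ is the total variation. Then there is $\delta_0^* > 0$, depending only on $d$ and $W$, such that for every $\delta \in (0, \delta_0^*]$ and every $\alpha \in [0,1)$ there is $\varepsilon_0 > 0$ with the following property. Let $0 < \varepsilon \le \varepsilon_0$, $\bar u \in \mathbb R$, and let $u_0 \in BV(\Omega; \{-1,1\})$ be such that 1. the jump set of $u_0$ is a closed embedded hypersurface of class $C^2$ (possibly empty); 2. the principal curvatures of the jump set are bounded in absolute value by $\varepsilon^{-\alpha}$; 3. any two different connected components of the jump set are at distance at least $\varepsilon^{\alpha}$ from each other; 4. $\left| \int_\Omega G(x-y) (u_0(y) - \bar u)\, dy \right| \le \delta$ for all $x \in \Omega$; 5. $E[u_0] \le \delta^{\frac12 (d+3)}$. Then there exists $u \in H^1(\Omega)$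 with $W(u) \in L^1(\Omega)$ and $\int_\Omega u \, dx = \bar u$ such that $$\mathcal E[u] \le (1 + \delta^{1/2})\, E[u_0].$$ -/

import Mathlib

open Set Filter Topology MeasureTheory
open scoped ContDiff

noncomputable section

namespace OhtaKawasaki

/-- The universal cover `ℝ^d` of the flat torus `Ω = [0,1)^d`. Functions on `Ω` are represented
by `ℤ^d`-periodic functions on `ℝ^d`, and integrals over `Ω` by integrals over `unitCell d`. -/
abbrev Space (d : ℕ) : Type := EuclideanSpace ℝ (Fin d)

/-- The fundamental cell `[0,1)^d`. -/
def unitCell (d : ℕ) : Set (Space d) := {x | ∀ i, x i ∈ Ico (0 : ℝ) 1}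

/-- The point of `ℝ^d` with integer coordinates `n`. -/
def latticePoint {d : ℕ} (n : Fin d → ℤ) : Space d := WithLp.toLp 2 (fun i => (n i : ℝ))

/-- `f` is `ℤ^d`-periodic, that is, a function on the torus. -/
def IsPeriodic {d : ℕ} {β : Type} (f : Space d → β) : Prop :=
  ∀ (n : Fin d → ℤ) (x : Space d), f (x + latticePoint n) = f x

/-- The covering map from `ℝ^d` onto the torus `ℝ^d / ℤ^d`. -/
def toTorus {d : ℕ} (x : Space d) : UnitAddTorus (Fin d) := fun i => (x i : UnitAddCircle)

/-- The divergence of a differentiable vector field. -/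
def divergence {d : ℕ} (φ : Space d → Space d) (x : Space d) : ℝ :=
  ∑ i, (fderiv ℝ φ x (EuclideanSpace.single i 1)) i

/-! ### The double-well potential -/

/-- Symmetric double-well potentials with nondegenerate wells at `±1` (the conditions at `-1`
follow from those at `1` by symmetry), normalized to unit surface tension. -/
structure IsDoubleWell (d : ℕ) (W : ℝ → ℝ) : Prop where
  contDiff : ContDiff ℝ 3 W
  even : ∀ s, W (-s) = W s
  nonneg : ∀ s, 0 ≤ W s
  eq_zero_iff : ∀ s, W s = 0 ↔ s = 1 ∨ s = -1
  deriv2_pos : 0 < iteratedDeriv 2 W 1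
  deriv2_mono : MonotoneOn (iteratedDeriv 2 W) (Ici 1)
  deriv2_tendsto : Tendsto (iteratedDeriv 2 W) atTop atTop
  growth : ∃ C > 0, ∃ q : ℝ, 1 < q ∧ (2 < d → q < ((d : ℝ) + 2) / ((d : ℝ) - 2)) ∧
    ∀ s, |deriv W s| ≤ C * (1 + |s| ^ q)
  normalized : ∫ s in (-1 : ℝ)..1, Real.sqrt (2 * W s) = 1

/-- The inverse screening length `κ = W''(1)^{-1/2}`. -/
def screening (W : ℝ → ℝ) : ℝ := 1 / Real.sqrt (iteratedDeriv 2 W 1)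

/-! ### Green functions of the torus -/

/-- The heat kernel of the torus (periodization of the Gaussian heat kernel of `ℝ^d`). -/
def heatKernel {d : ℕ} (t : ℝ) (x : Space d) : ℝ :=
  ∑' n : Fin d → ℤ, (4 * Real.pi * t) ^ (-(d : ℝ) / 2) *
    Real.exp (-‖x - latticePoint n‖ ^ 2 / (4 * t))

/-- The screened Coulomb kernel, i.e. the periodic solution of `-Δ G + κ² G = δ₀`,
as the kernel of `(-Δ + κ²)⁻¹ = ∫₀^∞ e^{-κ² t} e^{t Δ} dt`. -/
def greenScreened {d : ℕ} (κ : ℝ) (x : Space d) : ℝ :=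
  ∫ t in Ioi (0 : ℝ), Real.exp (-κ ^ 2 * t) * heatKernel t x

/-- The Coulomb kernel, i.e. the periodic solution of `-Δ G₀ = δ₀ - 1` with zero mean (`|Ω| = 1`),
as the kernel of `∫₀^∞ (e^{t Δ} - P) dt`, where `P` is the projection onto constants. -/
def greenNeutral {d : ℕ} (x : Space d) : ℝ :=
  ∫ t in Ioi (0 : ℝ), (heatKernel t x - 1)

/-- The potential `x ↦ ∫_Ω G(x - y) f(y) dy`. -/
def potential {d : ℕ} (G : Space d → ℝ) (f : Space d → ℝ) (x : Space d) : ℝ :=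
  ∫ y in unitCell d, G (x - y) * f y

/-- The long-range energy `½ ∫_Ω ∫_Ω f(x) G(x - y) f(y) dx dy`. -/
def longRangeEnergy {d : ℕ} (G : Space d → ℝ) (f : Space d → ℝ) : ℝ :=
  (1 / 2) * ∫ x in unitCell d, ∫ y in unitCell d, f x * G (x - y) * f y

/-! ### The diffuse interface energy on `H¹` -/

/-- `u ∈ H¹(Ω)` with weak gradient `Du`. -/
structure IsH1 {d : ℕ} (u : Space d → ℝ) (Du : Space d → Space d) : Prop where
  periodic : IsPeriodic u
  periodic_grad : IsPeriodic Du
  memLp : MemLp u 2 (volume.restrict (unitCell d))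
  memLp_grad : MemLp Du 2 (volume.restrict (unitCell d))
  weak_grad : ∀ φ : Space d → ℝ, ContDiff ℝ ∞ φ → IsPeriodic φ → ∀ i,
    ∫ x in unitCell d, u x * fderiv ℝ φ x (EuclideanSpace.single i 1) =
      -∫ x in unitCell d, Du x i * φ x

/-- The diffuse interface (Ohta-Kawasaki) energy of `u` with weak gradient `Du`. -/
def diffuseEnergy {d : ℕ} (W : ℝ → ℝ) (ε ubar : ℝ) (u : Space d → ℝ)
    (Du : Space d → Space d) : ℝ :=
  (∫ x in unitCell d, (ε ^ 2 / 2 * ‖Du x‖ ^ 2 + W (u x))) +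
    longRangeEnergy greenNeutral (fun x => u x - ubar)

/-! ### The sharp interface energy on `BV(Ω; {±1})` -/

/-- The values `∫_Ω u div φ dx` over the `C¹` vector fields `φ` on the torus with `|φ| ≤ 1`. -/
def variationSet {d : ℕ} (u : Space d → ℝ) : Set ℝ :=
  {a | ∃ φ : Space d → Space d, ContDiff ℝ 1 φ ∧ IsPeriodic φ ∧ (∀ x, ‖φ x‖ ≤ 1) ∧
    a = ∫ x in unitCell d, u x * divergence φ x}

/-- The total variation `∫_Ω |∇u| dx`; used only when `variationSet u` is bounded above. -/
def totalVariation {d : ℕ} (u : Space d → ℝ) : ℝ := sSup (variationSet u)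

/-- `u ∈ BV(Ω; {-1, 1})`. -/
structure IsBVSign {d : ℕ} (u : Space d → ℝ) : Prop where
  periodic : IsPeriodic u
  aemeasurable : AEMeasurable u volume
  values : ∀ x, u x = 1 ∨ u x = -1
  bounded : BddAbove (variationSet u)

/-- The sharp interface energy. -/
def sharpEnergy {d : ℕ} (κ ε ubar : ℝ) (u : Space d → ℝ) : ℝ :=
  ε / 2 * totalVariation u + longRangeEnergy (greenScreened κ) (fun x => u x - ubar)

/-! ### The jump set and its geometry -/

/-- The jump set of a `±1`-valued function (lifted to `ℝ^d`): the points near which both values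
are taken on sets of positive measure, i.e. the support of the measure `∇u`. -/
def jumpSet {d : ℕ} (u : Space d → ℝ) : Set (Space d) :=
  {x | ∀ r > 0, 0 < volume (Metric.ball x r ∩ {y | u y = 1}) ∧
    0 < volume (Metric.ball x r ∩ {y | u y = -1})}

/-- `f` is a `C²` local defining function of the jump set of `u` at `x`: near `x`, up to null sets,
`{u = 1} = {f > 0}` and `{u = -1} = {f < 0}`, and `f` vanishes at `x` with nonzero gradient. -/
structure IsDefiningFunction {d : ℕ} (u : Space d → ℝ) (x : Space d) (f : Space d → ℝ) :
    Prop where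
  contDiffAt : ContDiffAt ℝ 2 f x
  eq_zero : f x = 0
  fderiv_ne_zero : fderiv ℝ f x ≠ 0
  sign : ∃ r > 0, ∀ᵐ y, y ∈ Metric.ball x r → (0 < f y → u y = 1) ∧ (f y < 0 → u y = -1)

/-- The jump set is a closed embedded hypersurface of class `C²`. -/
def HasC2JumpSet {d : ℕ} (u : Space d → ℝ) : Prop :=
  ∀ x ∈ jumpSet u, ∃ f, IsDefiningFunction u x f

/-- `k` is a principal curvature of the jump set at `x`: an eigenvalue, on the tangent space
`ker Df(x)`, of the second fundamental form `-D²f(x) / |∇f(x)|` (positive for convex `{u = 1}`). -/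
def IsPrincipalCurvature {d : ℕ} (u : Space d → ℝ) (x : Space d) (k : ℝ) : Prop :=
  ∃ f, IsDefiningFunction u x f ∧ ∃ v : Space d, v ≠ 0 ∧ fderiv ℝ f x v = 0 ∧
    ∀ w : Space d, fderiv ℝ f x w = 0 →
      -(fderiv ℝ (fderiv ℝ f) x v w) = k * ‖fderiv ℝ f x‖ * inner ℝ v w

/-- On the torus, different connected components of the jump set are at distance at least `s`. -/
def IsSeparated {d : ℕ} (u : Space d → ℝ) (s : ℝ) : Prop :=
  ∀ x ∈ jumpSet u, ∀ y ∈ jumpSet u,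
    toTorus y ∉ connectedComponentIn (toTorus '' jumpSet u) (toTorus x) → s ≤ dist x y

end OhtaKawasaki

end

open OhtaKawasaki

/-! The competitor is `u = v - κ² w`. Here `v` is a diffuse version of `u₀`: a one-dimensional
transition profile, evaluated at the signed distance to the jump set divided by `ε`. The function
`w` is the screened potential of `g = v - ubar`. Three facts make it work.

Screening. Formally `-Δ w = g - κ² w`, and the right side is `u - ubar`. So `u - ubar` has mean
zero, and `w` is its Coulomb potential up to a constant. Hence the Coulomb energy of `u - ubar` is
the screened energy of `g` minus `κ²/2 ∫ w²` (`longRangeEnergy_neutral_sub_potential`). Since `W''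
(±1) = κ⁻²`, displacing the wells by `κ² w` costs `κ²/2 w²` to leading order, and the two terms
cancel. The operator `1 - κ² (-Δ + κ²)⁻¹` commutes with derivatives and contracts `L²`, so the
Dirichlet energy does not grow. What remains is the local energy of `v`, the screened energy of `g`,
and an error of size `sup |w|` times `∫ w²` plus the volume of the transition layer
(`exists_competitor`). No elliptic theory enters: the kernels are time integrals of the heat kernel,
and every identity is checked on Fourier coefficients.

Geometry. The Modica-Mortola energy of `v` is an integral over the level layers of the distance.
Near the jump set the volume of these layers is controlled by the total variation, tested with a
mollified normal field (`exists_volume_jumpDist_le`). Layers further out are pulled back to the jump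
set along normals, which distorts volume by at most `(1 + 4 s K) ^ d` at distance `s` if the normal
is `K`-Lipschitz (`volume_jumpDist_Ioc_le`). With `K` of order `ε ^ (-α)` and `s` of order `ε` this
factor tends to one, because `α < 1` (`exists_recovery`).

Bookkeeping. Put `δ = s⁴` and regularize the profile with a parameter `τ` of order `δ`, so that the
layer has half-width of order `ε / s` and volume of order `E / s`, where `E` is the sharp energy.
The bound `E ≤ s ^ (2 (d + 3))` makes the potential of `v - u₀` of order `s⁴`
(`exists_abs_potential_le_of_recovery`). All long-range and screening errors are then of order `s³
E`, while the profile loses a small multiple of `s² E = δ^(1/2) E`. -/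

namespace OhtaKawasaki

/-! ### Analysis on the torus: fundamental domain, integration by parts, folding sets into the cell.
-/

section
open scoped Pointwise

variable {d : ℕ}

/-! ### The torus as a quotient by the integer lattice -/

/-- The lattice `ℤ^d`. -/
abbrev lattice (d : ℕ) : AddSubgroup (Space d) :=
  (Submodule.span ℤ (Set.range (EuclideanSpace.basisFun (Fin d) ℝ).toBasis)).toAddSubgroup

theorem latticePoint_apply (n : Fin d → ℤ) (i : Fin d) : latticePoint n i = n i := rfl

theorem unitCell_eq_fundamentalDomain :
    unitCell d = ZSpan.fundamentalDomain (EuclideanSpace.basisFun (Fin d) ℝ).toBasis := by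
  ext x
  simp [unitCell, ZSpan.mem_fundamentalDomain]

theorem isAddFundamentalDomain_unitCell (ν : Measure (Space d)) :
    IsAddFundamentalDomain (lattice d) (unitCell d) ν := by
  rw [unitCell_eq_fundamentalDomain]
  exact ZSpan.isAddFundamentalDomain' _ ν

instance : Countable (lattice d) :=
  inferInstanceAs (Countable (Submodule.span ℤ
    (Set.range (EuclideanSpace.basisFun (Fin d) ℝ).toBasis)))

theorem exists_latticePoint_of_mem_lattice {v : Space d} (hv : v ∈ lattice d) :
    ∃ n, v = latticePoint n := by
  have h : v ∈ Submodule.span ℤ (Set.range (EuclideanSpace.basisFun (Fin d) ℝ).toBasis) := hv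
  rw [Module.Basis.mem_span_iff_repr_mem] at h
  choose n hn using h
  refine ⟨n, ?_⟩
  ext i
  rw [latticePoint_apply]
  simpa using (hn i).symm

theorem measurableSet_unitCell : MeasurableSet (unitCell d) := by
  rw [unitCell_eq_fundamentalDomain]
  exact ZSpan.fundamentalDomain_measurableSet _

theorem exists_add_latticePoint_mem_unitCell (x : Space d) :
    ∃ n, x + latticePoint n ∈ unitCell d := by
  refine ⟨fun i => -⌊x i⌋, fun i => ?_⟩
  simp only [PiLp.add_apply, latticePoint_apply, Int.cast_neg]
  exact ⟨by linarith [Int.floor_le (x i)], by linarith [Int.lt_floor_add_one (x i)]⟩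

theorem volume_unitCell : volume (unitCell d) = 1 := by
  have h := (EuclideanSpace.volume_preserving_symm_measurableEquiv_toLp (Fin d)).symm
  have h2 : unitCell d = (MeasurableEquiv.toLp 2 (Fin d → ℝ)).symm ⁻¹'
      (Set.pi univ fun _ => Ico (0 : ℝ) 1) := by
    ext x; simp [unitCell]
  rw [h2, (EuclideanSpace.volume_preserving_symm_measurableEquiv_toLp (Fin d)).measure_preimage
    (MeasurableSet.univ_pi fun _ => measurableSet_Ico).nullMeasurableSet]
  simp [volume_pi_pi]

/-- The measure of the torus. -/
noncomputable abbrev cellMeasure (d : ℕ) : Measure (Space d) := volume.restrict (unitCell d)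

instance : IsProbabilityMeasure (cellMeasure d) := ⟨by simp [volume_unitCell]⟩

theorem IsPeriodic.vadd {β : Type} {f : Space d → β} (hf : IsPeriodic f) (g : lattice d)
    (x : Space d) : f (g +ᵥ x) = f x := by
  obtain ⟨n, hn⟩ := exists_latticePoint_of_mem_lattice g.2
  change f ((g : Space d) + x) = f x
  rw [hn, add_comm, hf n x]

theorem IsPeriodic.exists_mem_unitCell {β : Type} {f : Space d → β} (hf : IsPeriodic f)
    (x : Space d) : ∃ y ∈ unitCell d, f y = f x := by
  obtain ⟨n, hn⟩ := exists_add_latticePoint_mem_unitCell x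
  exact ⟨_, hn, hf n x⟩

theorem isAddFundamentalDomain_vadd_unitCell (a : Space d) (ν : Measure (Space d))
    [ν.IsAddLeftInvariant] :
    IsAddFundamentalDomain (lattice d) (a +ᵥ unitCell d) ν :=
  (isAddFundamentalDomain_unitCell ν).vadd_of_comm a

/-- The cell and its translate are both fundamental domains of the lattice, and a periodic function
has the same integral over any two of them. -/
theorem IsPeriodic.setIntegral_add {f : Space d → ℝ} (hf : IsPeriodic f) (a : Space d) :
    ∫ x in unitCell d, f (x + a) = ∫ x in unitCell d, f x := by
  have h1 := (isAddFundamentalDomain_unitCell (d := d) volume).setIntegral_eq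
    (isAddFundamentalDomain_vadd_unitCell a volume) hf.vadd
  rw [h1]
  have h2 := (measurePreserving_add_left (volume : Measure (Space d)) a).setIntegral_image_emb
    (MeasurableEquiv.addLeft a).measurableEmbedding f (unitCell d)
  have h3 : (a +ᵥ unitCell d) = (fun x => a + x) '' unitCell d := rfl
  rw [h3, h2]
  simp [add_comm]

theorem isCompact_closedCell (d : ℕ) : IsCompact {x : Space d | ∀ i, x i ∈ Icc (0 : ℝ) 1} := by
  have h : {x : Space d | ∀ i, x i ∈ Icc (0 : ℝ) 1} =
      (EuclideanSpace.equiv (Fin d) ℝ).symm '' (Set.pi univ fun _ => Icc (0 : ℝ) 1) := by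
    ext x
    constructor
    · intro hx
      exact ⟨fun i => x i, fun i _ => hx i, by ext i; simp⟩
    · rintro ⟨y, hy, rfl⟩ i
      simpa using hy i (mem_univ i)
  rw [h]
  exact (isCompact_univ_pi fun _ => isCompact_Icc).image (ContinuousLinearEquiv.continuous _)

theorem unitCell_subset_closedCell : unitCell d ⊆ {x : Space d | ∀ i, x i ∈ Icc (0 : ℝ) 1} :=
  fun _ hx i => Ico_subset_Icc_self (hx i)

theorem IsPeriodic.exists_bound {f : Space d → ℝ} (hf : IsPeriodic f) (hc : Continuous f) :
    ∃ C, 0 ≤ C ∧ ∀ x, |f x| ≤ C := by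
  obtain ⟨C, hC⟩ := (isCompact_closedCell d).exists_bound_of_continuousOn hc.continuousOn
  refine ⟨max C 0, le_max_right _ _, fun x => ?_⟩
  obtain ⟨y, hy, hxy⟩ := hf.exists_mem_unitCell x
  rw [← hxy]
  exact (hC y (unitCell_subset_closedCell hy)).trans (le_max_left _ _)

theorem IsPeriodic.comp {β γ : Type} {f : Space d → β} (hf : IsPeriodic f) (g : β → γ) :
    IsPeriodic (fun x => g (f x)) := fun n x => by simp [hf n x]

theorem IsPeriodic.periodic_fderiv {F : Type} [NormedAddCommGroup F] [NormedSpace ℝ F]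
    {f : Space d → F} (hf : IsPeriodic f) : IsPeriodic (fderiv ℝ f) := by
  intro n x
  have h : (fun y => f (y + latticePoint n)) = f := funext (hf n)
  rw [← fderiv_comp_add_right, h]

/-! ### Integration by parts on the torus -/

/-- Each difference quotient integrates to zero by translation invariance, and for Lipschitz
functions the quotients may be passed to the limit under the integral. Periodicity thus removes all
boundary terms. -/
theorem IsPeriodic.integral_lineDeriv_eq_zero {f : Space d → ℝ} (hf : IsPeriodic f) {C : NNReal}
    (hL : LipschitzWith C f) (v : Space d) : ∫ x in unitCell d, lineDeriv ℝ f x v = 0 := by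
  have hg : Integrable ((unitCell d).indicator fun _ => (1 : ℝ)) (volume : Measure (Space d)) := by
    rw [integrable_indicator_iff measurableSet_unitCell]
    exact integrable_const (μ := cellMeasure d) 1
  have h := hL.integral_inv_smul_sub_mul_tendsto_integral_lineDeriv_mul hg v
  have key : ∀ F : Space d → ℝ, ∫ x, F x * (unitCell d).indicator (fun _ => (1 : ℝ)) x =
      ∫ x in unitCell d, F x := by
    intro F
    rw [← integral_indicator measurableSet_unitCell]
    congr 1; ext x
    by_cases hx : x ∈ unitCell d <;> simp [hx]
  simp_rw [key] at h
  have h0 : ∀ t : ℝ, ∫ x in unitCell d, t⁻¹ • (f (x + t • v) - f x) = 0 := by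
    intro t
    obtain ⟨B, -, hB⟩ := hf.exists_bound hL.continuous
    have hi : ∀ a, Integrable (fun x => f (x + a)) (cellMeasure d) := fun a =>
      Integrable.of_bound (hL.continuous.comp (continuous_id.add continuous_const)).aestronglyMeasurable
        B (ae_of_all _ fun x => hB _)
    have hi0 : Integrable f (cellMeasure d) := by simpa using hi 0
    rw [integral_smul, integral_sub (hi _) hi0, hf.setIntegral_add, sub_self, smul_zero]
  simp_rw [h0] at h
  exact (tendsto_nhds_unique h tendsto_const_nhds)

theorem IsPeriodic.lipschitzWith {φ : Space d → ℝ} (hφ : IsPeriodic φ) (hs : ContDiff ℝ 1 φ) :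
    ∃ C, LipschitzWith C φ := by
  have h1 : Continuous (fun x => ‖fderiv ℝ φ x‖) := (hs.continuous_fderiv one_ne_zero).norm
  obtain ⟨C, hC0, hC⟩ := (hφ.periodic_fderiv.comp (fun L => ‖L‖)).exists_bound h1
  refine ⟨Real.toNNReal C, lipschitzWith_of_nnnorm_fderiv_le (hs.differentiable (by simp)) fun x => ?_⟩
  have := hC x
  simp only [abs_norm] at this
  rw [← norm_toNNReal]
  exact Real.toNNReal_le_toNNReal this

theorem IsPeriodic.lipschitzWith_mul {f φ : Space d → ℝ} (hf : IsPeriodic f) (hφ : IsPeriodic φ)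
    {C C' : NNReal} (hL : LipschitzWith C f) (hL' : LipschitzWith C' φ) :
    ∃ C'', LipschitzWith C'' (fun x => f x * φ x) := by
  obtain ⟨A, hA0, hA⟩ := hf.exists_bound hL.continuous
  obtain ⟨B, hB0, hB⟩ := hφ.exists_bound hL'.continuous
  refine ⟨Real.toNNReal (A * C' + B * C), LipschitzWith.of_dist_le_mul fun x y => ?_⟩
  have h1 := hL.dist_le_mul x y
  have h2 := hL'.dist_le_mul x y
  rw [Real.dist_eq] at h1 h2 ⊢
  rw [Real.coe_toNNReal _ (by positivity)]
  calc |f x * φ x - f y * φ y| = |f x * (φ x - φ y) + φ y * (f x - f y)| := by ring_nf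
    _ ≤ |f x| * |φ x - φ y| + |φ y| * |f x - f y| := by
        rw [← abs_mul, ← abs_mul]; exact abs_add_le _ _
    _ ≤ A * (C' * dist x y) + B * (C * dist x y) := by
        gcongr
        · exact hA x
        · exact hB y
    _ = (A * C' + B * C) * dist x y := by ring

/-- The product is again periodic and Lipschitz, so its derivative has mean zero; by Rademacher the
Leibniz rule holds almost everywhere. Only Lipschitz regularity is asked of `f`, since it will be a
function of the signed distance. -/
theorem IsPeriodic.integral_mul_fderiv {f φ : Space d → ℝ} (hf : IsPeriodic f) {C : NNReal}
    (hL : LipschitzWith C f) (hφ : IsPeriodic φ) (hs : ContDiff ℝ 1 φ) (v : Space d) :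
    ∫ x in unitCell d, f x * fderiv ℝ φ x v = -∫ x in unitCell d, fderiv ℝ f x v * φ x := by
  obtain ⟨C', hL'⟩ := hφ.lipschitzWith hs
  obtain ⟨C'', hL''⟩ := hf.lipschitzWith_mul hφ hL hL'
  have h0 : IsPeriodic (fun x => f x * φ x) := fun n x => by simp [hf n x, hφ n x]
  have h := h0.integral_lineDeriv_eq_zero hL'' v
  have hae : ∀ᵐ x ∂(cellMeasure d), lineDeriv ℝ (fun x => f x * φ x) x v =
      f x * fderiv ℝ φ x v + fderiv ℝ f x v * φ x := by
    filter_upwards [ae_restrict_of_ae hL.ae_differentiableAt] with x hx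
    have hd : DifferentiableAt ℝ φ x := hs.differentiable (by simp) x
    have h1 := (hx.hasFDerivAt.mul hd.hasFDerivAt).hasLineDerivAt v
    refine h1.lineDeriv.trans ?_
    simp; ring
  rw [integral_congr_ae hae] at h
  obtain ⟨A, hA0, hA⟩ := hf.exists_bound hL.continuous
  obtain ⟨B, hB0, hB⟩ := hφ.exists_bound hL'.continuous
  have i1 : Integrable (fun x => f x * fderiv ℝ φ x v) (cellMeasure d) := by
    refine Integrable.of_bound (C := A * (C' * ‖v‖)) ?_ (ae_of_all _ fun x => ?_)
    · exact (hL.continuous.mul ((hs.continuous_fderiv one_ne_zero).clm_apply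
        continuous_const)).aestronglyMeasurable
    · rw [norm_mul]
      gcongr
      · exact hA x
      · exact ((fderiv ℝ φ x).le_opNorm v).trans (by
          gcongr; exact norm_fderiv_le_of_lipschitz ℝ hL')
  have i2 : Integrable (fun x => fderiv ℝ f x v * φ x) (cellMeasure d) := by
    refine Integrable.of_bound (C := (C * ‖v‖) * B) ?_ (ae_of_all _ fun x => ?_)
    · exact ((measurable_fderiv_apply_const ℝ f v).mul
        hL'.continuous.measurable).aestronglyMeasurable
    · rw [norm_mul]
      gcongr
      · exact ((fderiv ℝ f x).le_opNorm v).trans (by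
          gcongr; exact norm_fderiv_le_of_lipschitz ℝ hL)
      · exact hB x
  rw [integral_add i1 i2] at h
  linarith

/-! ### Sets with disjoint translates -/

/-- Cutting `B` along the lattice cells and moving the pieces into the unit cell keeps them
disjoint. This is needed because shifting along normals can carry points out of the cell. -/
theorem measure_le_of_disjoint_translates {B Z : Set (Space d)} (hB : MeasurableSet B)
    (hBZ : B ⊆ Z) (hper : ∀ n x, x + latticePoint n ∈ Z ↔ x ∈ Z)
    (hdisj : ∀ n, latticePoint n ≠ (0 : Space d) → ∀ x ∈ B, x + latticePoint n ∉ B) :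
    volume B ≤ volume (Z ∩ unitCell d) := by
  have hs := isAddFundamentalDomain_unitCell (d := d) volume
  have hd : Pairwise (Function.onFun (AEDisjoint volume)
      (fun g : lattice d => (g +ᵥ B) ∩ unitCell d)) := by
    intro g g' hgg'
    refine Disjoint.aedisjoint (Set.disjoint_left.mpr ?_)
    rintro x ⟨⟨y, hy, hyx⟩, -⟩ ⟨⟨y', hy', hyx'⟩, -⟩
    change (g : Space d) + y = x at hyx
    change (g' : Space d) + y' = x at hyx'
    obtain ⟨n, hn⟩ := exists_latticePoint_of_mem_lattice (g - g').2
    have hne : latticePoint n ≠ (0 : Space d) := by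
      rw [← hn]
      simpa [sub_eq_zero] using hgg'
    apply hdisj n hne y hy
    rw [← hn]
    have : y + ((g - g' : lattice d) : Space d) = y' := by
      rw [AddSubgroup.coe_sub]
      have h := hyx.trans hyx'.symm
      rw [← sub_eq_zero] at h ⊢
      rw [← h]; abel
    rwa [this]
  calc volume B = ∑' g : lattice d, volume ((g +ᵥ B) ∩ unitCell d) := hs.measure_eq_tsum B
    _ = volume (⋃ g : lattice d, (g +ᵥ B) ∩ unitCell d) := by
        refine (measure_iUnion₀ hd fun g => ?_).symm
        exact ((hB.const_vadd g).inter measurableSet_unitCell).nullMeasurableSet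
    _ ≤ volume (Z ∩ unitCell d) := by
        refine measure_mono (iUnion_subset fun g => ?_)
        rintro x ⟨⟨y, hy, hyx⟩, hx⟩
        refine ⟨?_, hx⟩
        obtain ⟨n, hn⟩ := exists_latticePoint_of_mem_lattice g.2
        change (g : Space d) + y = x at hyx
        rw [← hyx, hn, add_comm]
        exact (hper n y).2 (hBZ hy)

end

/-! ### The heat kernel of the torus: Poisson summation, positivity, small- and large-time bounds.
-/

section
variable {d : ℕ}

/-! ### Fourier series of the heat kernel -/

/-- Induction on `d`, splitting off the first coordinate and multiplying absolutely convergent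
series. It reduces the theta function of `ℤ^d` to the one-dimensional one. -/
theorem summable_norm_and_tsum_pi_prod {d : ℕ} (f : Fin d → ℤ → ℂ)
    (hf : ∀ i, Summable fun n => ‖f i n‖) :
    Summable (fun k : Fin d → ℤ => ‖∏ i, f i (k i)‖) ∧
      ∑' k : Fin d → ℤ, ∏ i, f i (k i) = ∏ i, ∑' n, f i n := by
  induction d with
  | zero => exact ⟨(hasSum_fintype _).summable, by simp⟩
  | succ d ih =>
    obtain ⟨h1, h2⟩ := ih (fun i => f i.succ) fun i => hf _
    let e := Fin.consEquiv fun _ : Fin (d + 1) => ℤ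
    have he : ∀ p : ℤ × (Fin d → ℤ), ∏ i, f i (e p i) = f 0 p.1 * ∏ i, f (Fin.succ i) (p.2 i) := by
      intro p
      rw [Fin.prod_univ_succ]
      simp [e]
    constructor
    · rw [← e.summable_iff]
      refine ((hf 0).mul_norm h1).congr fun p => ?_
      simp only [Function.comp_apply, he]
    · rw [← e.tsum_eq]
      simp_rw [he]
      rw [Fin.prod_univ_succ, ← h2, tsum_mul_tsum_of_summable_norm (hf 0) h1]

/-- This is Jacobi's identity for the theta function, read off from the functional equation between
`HurwitzZeta.evenKernel` and `HurwitzZeta.cosKernel` at the parameter `1 / (4πt)`. -/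
theorem hasSum_gaussian_poisson (a : ℝ) {t : ℝ} (ht : 0 < t) :
    Summable (fun n : ℤ => (4 * Real.pi * t) ^ (-(1 : ℝ) / 2) *
      Real.exp (-(a - n) ^ 2 / (4 * t))) ∧
    Summable (fun n : ℤ => Real.exp (-(4 * Real.pi ^ 2 * n ^ 2) * t)) ∧
    (∑' n : ℤ, (((4 * Real.pi * t) ^ (-(1 : ℝ) / 2) *
      Real.exp (-(a - n) ^ 2 / (4 * t)) : ℝ) : ℂ)) =
    ∑' n : ℤ, (Real.exp (-(4 * Real.pi ^ 2 * n ^ 2) * t) : ℂ) *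
      Complex.exp (2 * Real.pi * Complex.I * a * n) := by
  have hpi := Real.pi_pos
  have hT : 0 < 1 / (4 * Real.pi * t) := by positivity
  have h1 := HurwitzZeta.hasSum_int_evenKernel (-a) hT
  have h2 := HurwitzZeta.hasSum_int_cosKernel a (t := 4 * Real.pi * t) (by positivity)
  have h3 := HurwitzZeta.hasSum_int_cosKernel 0 (t := 4 * Real.pi * t) (by positivity)
  have hfe := HurwitzZeta.evenKernel_functional_equation ((-a : ℝ) : UnitAddCircle)
    (1 / (4 * Real.pi * t))
  have e1 : ∀ n : ℤ, Real.exp (-Real.pi * (n + -a) ^ 2 * (1 / (4 * Real.pi * t))) =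
      Real.exp (-(a - n) ^ 2 / (4 * t)) := by
    intro n
    congr 1
    field_simp
    ring
  have e2 : ∀ n : ℤ, Real.exp (-Real.pi * n ^ 2 * (4 * Real.pi * t)) =
      Real.exp (-(4 * Real.pi ^ 2 * n ^ 2) * t) := by
    intro n; congr 1; ring
  simp_rw [e1] at h1
  simp_rw [e2] at h2 h3
  have hs2 : Summable (fun n : ℤ => Real.exp (-(4 * Real.pi ^ 2 * n ^ 2) * t)) := by
    have := h3.summable
    simp only [Complex.ofReal_zero, mul_zero, zero_mul, Complex.exp_zero, one_mul] at this
    exact_mod_cast this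
  refine ⟨h1.summable.mul_left _, hs2, ?_⟩
  have hL : HasSum (fun n : ℤ => (((4 * Real.pi * t) ^ (-(1 : ℝ) / 2) *
      Real.exp (-(a - n) ^ 2 / (4 * t)) : ℝ) : ℂ)) _ :=
    Complex.hasSum_ofReal.mpr (h1.mul_left ((4 * Real.pi * t) ^ (-(1 : ℝ) / 2)))
  rw [hL.tsum_eq, hfe]
  have h4 : (fun n : ℤ => (Real.exp (-(4 * Real.pi ^ 2 * n ^ 2) * t) : ℂ) *
      Complex.exp (2 * Real.pi * Complex.I * a * n)) = fun n : ℤ =>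
      Complex.exp (2 * Real.pi * Complex.I * a * n) *
        (Real.exp (-(4 * Real.pi ^ 2 * n ^ 2) * t) : ℂ) := funext fun n => mul_comm _ _
  rw [h4, h2.tsum_eq]
  have h5 : HurwitzZeta.cosKernel ((-a : ℝ) : UnitAddCircle) (1 / (1 / (4 * Real.pi * t))) =
      HurwitzZeta.cosKernel (a : UnitAddCircle) (4 * Real.pi * t) := by
    rw [one_div_one_div, AddCircle.coe_neg, HurwitzZeta.cosKernel_neg]
  rw [h5]
  have h6 : (4 * Real.pi * t) ^ (-(1 : ℝ) / 2) *
      (1 / (1 / (4 * Real.pi * t)) ^ ((1 : ℝ) / 2)) = 1 := by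
    rw [one_div (4 * Real.pi * t), Real.inv_rpow (by positivity), one_div, inv_inv,
      ← Real.rpow_add (by positivity)]
    norm_num
  rw [← mul_assoc, h6, one_mul]

/-- The phase `2π k·x`. -/
noncomputable def phase (k : Fin d → ℤ) (x : Space d) : ℝ := 2 * Real.pi * ∑ i, (k i : ℝ) * x i

/-- The eigenvalues `4π²|k|²` of the Laplacian of the torus. -/
noncomputable def eigenvalue (k : Fin d → ℤ) : ℝ := 4 * Real.pi ^ 2 * ∑ i, (k i : ℝ) ^ 2

theorem eigenvalue_nonneg (k : Fin d → ℤ) : 0 ≤ eigenvalue k := by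
  unfold eigenvalue; positivity

theorem eigenvalue_zero : eigenvalue (0 : Fin d → ℤ) = 0 := by simp [eigenvalue]

theorem eigenvalue_neg (k : Fin d → ℤ) : eigenvalue (-k) = eigenvalue k := by simp [eigenvalue]

theorem one_le_eigenvalue {k : Fin d → ℤ} (hk : k ≠ 0) : 1 ≤ eigenvalue k := by
  obtain ⟨i, hi⟩ := Function.ne_iff.mp hk
  have h1 : (1 : ℝ) ≤ (k i : ℝ) ^ 2 := by
    have : (1 : ℤ) ≤ (k i) ^ 2 := by
      have : 0 < (k i) ^ 2 := sq_pos_of_ne_zero hi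
      omega
    exact_mod_cast this
  have h2 : (k i : ℝ) ^ 2 ≤ ∑ i, (k i : ℝ) ^ 2 :=
    Finset.single_le_sum (f := fun i => (k i : ℝ) ^ 2) (fun i _ => sq_nonneg _) (Finset.mem_univ i)
  unfold eigenvalue
  nlinarith [Real.pi_gt_three]

theorem phase_sub (k : Fin d → ℤ) (x y : Space d) : phase k (x - y) = phase k x - phase k y := by
  simp only [phase, PiLp.sub_apply, mul_sub, Finset.sum_sub_distrib]

theorem phase_add (k : Fin d → ℤ) (x y : Space d) : phase k (x + y) = phase k x + phase k y := by
  simp only [phase, PiLp.add_apply, mul_add, Finset.sum_add_distrib]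

theorem phase_neg_left (k : Fin d → ℤ) (x : Space d) : phase (-k) x = -phase k x := by
  simp [phase]

theorem phase_add_left (k l : Fin d → ℤ) (x : Space d) :
    phase (k + l) x = phase k x + phase l x := by
  simp only [phase, Pi.add_apply, Int.cast_add, add_mul, Finset.sum_add_distrib, mul_add]

theorem phase_sub_left (k l : Fin d → ℤ) (x : Space d) :
    phase (k - l) x = phase k x - phase l x := by
  rw [sub_eq_add_neg, phase_add_left, phase_neg_left, sub_eq_add_neg]

theorem phase_latticePoint (k n : Fin d → ℤ) :
    phase k (latticePoint n) = ((∑ i, k i * n i : ℤ) : ℝ) * (2 * Real.pi) := by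
  simp only [phase, latticePoint_apply]
  push_cast
  ring

theorem contDiff_phase (k : Fin d → ℤ) : ContDiff ℝ ∞ (phase k) := by
  unfold phase
  fun_prop

theorem continuous_phase (k : Fin d → ℤ) : Continuous (phase k) := (contDiff_phase k).continuous

theorem isPeriodic_cos_phase (k : Fin d → ℤ) (θ : ℝ) :
    IsPeriodic fun x => Real.cos (phase k x + θ) := by
  intro n x
  change Real.cos (phase k (x + latticePoint n) + θ) = Real.cos (phase k x + θ)
  rw [phase_add, phase_latticePoint, add_right_comm, Real.cos_add_int_mul_two_pi]

/-- Gaussians and plane waves both factor over the coordinates, so Poisson summation can be applied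
in each. The Gaussian form yields positivity and the small-time bound; the Fourier form carries the
spectral calculus. -/
theorem hasSum_heatKernel_aux (x : Space d) {t : ℝ} (ht : 0 < t) :
    HasSum (fun n : Fin d → ℤ => (4 * Real.pi * t) ^ (-(d : ℝ) / 2) *
      Real.exp (-‖x - latticePoint n‖ ^ 2 / (4 * t))) (heatKernel t x) ∧
    Summable (fun k : Fin d → ℤ => Real.exp (-eigenvalue k * t)) ∧
    HasSum (fun k : Fin d → ℤ => Real.exp (-eigenvalue k * t) * Real.cos (phase k x))
      (heatKernel t x) := by
  have hpi := Real.pi_pos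
  have h1 := summable_norm_and_tsum_pi_prod (fun (i : Fin d) (n : ℤ) =>
    (((4 * Real.pi * t) ^ (-(1 : ℝ) / 2) * Real.exp (-(x i - n) ^ 2 / (4 * t)) : ℝ) : ℂ))
    fun i => by
      simpa only [Complex.norm_real] using ((hasSum_gaussian_poisson (x i) ht).1).norm
  have h2 := summable_norm_and_tsum_pi_prod (fun (i : Fin d) (n : ℤ) =>
    (Real.exp (-(4 * Real.pi ^ 2 * n ^ 2) * t) : ℂ) *
      Complex.exp (2 * Real.pi * Complex.I * x i * n)) fun i => by
      refine ((hasSum_gaussian_poisson (x i) ht).2.1).congr fun n => ?_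
      have h : Complex.exp (2 * Real.pi * Complex.I * x i * n) =
          Complex.exp ((2 * Real.pi * x i * n : ℝ) * Complex.I) := by
        congr 1; push_cast; ring
      rw [norm_mul, h, Complex.norm_exp_ofReal_mul_I, mul_one, Complex.norm_real, Real.norm_eq_abs,
        Real.abs_exp]
  have e1 : ∀ n : Fin d → ℤ, ∏ i, (((4 * Real.pi * t) ^ (-(1 : ℝ) / 2) *
      Real.exp (-(x i - n i) ^ 2 / (4 * t)) : ℝ) : ℂ) =
      (((4 * Real.pi * t) ^ (-(d : ℝ) / 2) *
        Real.exp (-‖x - latticePoint n‖ ^ 2 / (4 * t)) : ℝ) : ℂ) := by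
    intro n
    rw [← Complex.ofReal_prod, Finset.prod_mul_distrib, ← Real.exp_sum, Finset.prod_const,
      ← Real.rpow_natCast, ← Real.rpow_mul (by positivity), EuclideanSpace.norm_sq_eq]
    simp only [Finset.card_univ, Fintype.card_fin, PiLp.sub_apply, latticePoint_apply,
      Real.norm_eq_abs, sq_abs]
    congr 3
    · ring
    · rw [← Finset.sum_neg_distrib, Finset.sum_div]
  have e2 : ∀ k : Fin d → ℤ, ∏ i, ((Real.exp (-(4 * Real.pi ^ 2 * k i ^ 2) * t) : ℂ) *
      Complex.exp (2 * Real.pi * Complex.I * x i * k i)) =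
      (Real.exp (-eigenvalue k * t) : ℂ) * Complex.exp (phase k x * Complex.I) := by
    intro k
    rw [Finset.prod_mul_distrib, ← Complex.exp_sum, ← Complex.ofReal_prod, ← Real.exp_sum]
    congr 3
    · simp only [eigenvalue, Finset.mul_sum, Finset.sum_mul, ← Finset.sum_neg_distrib]
    · simp only [phase, Finset.mul_sum, Finset.sum_mul, Complex.ofReal_sum]
      refine Finset.sum_congr rfl fun i _ => ?_
      push_cast; ring
  simp_rw [e1] at h1
  simp_rw [e2] at h2
  have e3 : (∏ i, ∑' n : ℤ, (((4 * Real.pi * t) ^ (-(1 : ℝ) / 2) *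
      Real.exp (-(x i - n) ^ 2 / (4 * t)) : ℝ) : ℂ)) =
      ∏ i, ∑' n : ℤ, (Real.exp (-(4 * Real.pi ^ 2 * n ^ 2) * t) : ℂ) *
      Complex.exp (2 * Real.pi * Complex.I * x i * n) :=
    Finset.prod_congr rfl fun i _ => (hasSum_gaussian_poisson (x i) ht).2.2
  have s1 : Summable (fun n : Fin d → ℤ => (4 * Real.pi * t) ^ (-(d : ℝ) / 2) *
      Real.exp (-‖x - latticePoint n‖ ^ 2 / (4 * t))) := by
    have := h1.1.of_norm
    exact_mod_cast this
  have s2 := h2.1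
  simp only [norm_mul, Complex.norm_exp_ofReal_mul_I, mul_one, Complex.norm_real,
    Real.norm_eq_abs, Real.abs_exp] at s2
  refine ⟨s1.hasSum, s2, ?_⟩
  have h3 : HasSum (fun k : Fin d → ℤ =>
      (Real.exp (-eigenvalue k * t) : ℂ) * Complex.exp (phase k x * Complex.I))
      (heatKernel t x : ℂ) := by
    have := h2.1.of_norm.hasSum
    rw [h2.2, ← e3, ← h1.2, ← Complex.ofReal_tsum] at this
    exact this
  have h4 := Complex.hasSum_re h3
  simpa only [Complex.re_ofReal_mul, Complex.exp_ofReal_mul_I_re, Complex.ofReal_re] using h4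

theorem hasSum_heatKernel (x : Space d) {t : ℝ} (ht : 0 < t) :
    HasSum (fun k : Fin d → ℤ => Real.exp (-eigenvalue k * t) * Real.cos (phase k x))
      (heatKernel t x) := (hasSum_heatKernel_aux x ht).2.2

theorem summable_exp_eigenvalue (d : ℕ) {t : ℝ} (ht : 0 < t) :
    Summable (fun k : Fin d → ℤ => Real.exp (-eigenvalue k * t)) :=
  (hasSum_heatKernel_aux 0 ht).2.1

theorem heatKernel_nonneg (x : Space d) {t : ℝ} (ht : 0 < t) : 0 ≤ heatKernel t x :=
  (hasSum_heatKernel_aux x ht).1.nonneg fun n => by have := Real.pi_pos; positivity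

theorem heatKernel_zero (t : ℝ) (ht : 0 < t) :
    heatKernel t (0 : Space d) = ∑' k : Fin d → ℤ, Real.exp (-eigenvalue k * t) := by
  rw [← (hasSum_heatKernel 0 ht).tsum_eq]
  simp [phase]

/-- The Fourier coefficients are positive and decrease in time, so the kernel is largest at the
origin and its maximum decreases. -/
theorem heatKernel_le_heatKernel_zero (x : Space d) {s t : ℝ} (hs : 0 < s) (hst : s ≤ t) :
    heatKernel t x ≤ heatKernel s (0 : Space d) := by
  rw [heatKernel_zero s hs]
  refine (hasSum_heatKernel x (hs.trans_le hst)).tsum_eq ▸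
    (hasSum_heatKernel x (hs.trans_le hst)).summable.tsum_le_tsum (fun k => ?_)
      (summable_exp_eigenvalue d hs)
  calc Real.exp (-eigenvalue k * t) * Real.cos (phase k x) ≤ Real.exp (-eigenvalue k * t) * 1 := by
        gcongr; exact Real.cos_le_one _
    _ ≤ Real.exp (-eigenvalue k * s) := by
        rw [mul_one]
        gcongr Real.exp ?_
        nlinarith [eigenvalue_nonneg k]

theorem exists_heatKernel_le_rpow (d : ℕ) : ∃ C, 0 < C ∧ ∀ s t : ℝ, 0 < s → s ≤ 1 → s ≤ t →
    ∀ x : Space d, heatKernel t x ≤ C * s ^ (-(d : ℝ) / 2) := by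
  have hpi := Real.pi_pos
  refine ⟨heatKernel 1 (0 : Space d) + 1,
    by linarith [heatKernel_nonneg (0 : Space d) one_pos], fun s t hs hs1 hst x => ?_⟩
  refine (heatKernel_le_heatKernel_zero x hs hst).trans ?_
  have h1 := (hasSum_heatKernel_aux (0 : Space d) one_pos).1
  have hs' := (hasSum_heatKernel_aux (0 : Space d) hs).1
  -- For `s ≤ 1` each Gaussian of variance `s` lies below the one of variance one, apart from the
  -- prefactor `s ^ (-d/2)`.
  have h2 : heatKernel s (0 : Space d) ≤ s ^ (-(d : ℝ) / 2) * heatKernel 1 (0 : Space d) := by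
    refine hasSum_le (fun n => ?_) hs' (h1.mul_left _)
    rw [mul_one, Real.mul_rpow (by positivity) hs.le]
    calc (4 * Real.pi) ^ (-(d : ℝ) / 2) * s ^ (-(d : ℝ) / 2) *
          Real.exp (-‖(0 : Space d) - latticePoint n‖ ^ 2 / (4 * s))
        ≤ (4 * Real.pi) ^ (-(d : ℝ) / 2) * s ^ (-(d : ℝ) / 2) *
          Real.exp (-‖(0 : Space d) - latticePoint n‖ ^ 2 / (4 * 1)) := by
          gcongr _ * Real.exp ?_
          rw [neg_div, neg_div]
          gcongr
      _ = _ := by ring_nf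
  refine h2.trans ?_
  rw [mul_comm]
  gcongr
  linarith

/-- Spectral gap: the constant mode cancels, and the other eigenvalues are at least one, so `exp (-λ
t) ≤ exp (-λ) exp (1 - t)` for `t ≥ 1`. -/
theorem abs_heatKernel_sub_one_le (x : Space d) {t : ℝ} (ht : 1 ≤ t) :
    |heatKernel t x - 1| ≤ heatKernel 1 (0 : Space d) * Real.exp (1 - t) := by
  have ht0 : 0 < t := by linarith
  have h := hasSum_heatKernel x ht0
  have h1 : HasSum (fun k : Fin d → ℤ => if k = 0 then (1 : ℝ) else 0) 1 := hasSum_ite_eq _ _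
  have h2 := h.sub h1
  have h3 : HasSum (fun k : Fin d → ℤ => Real.exp (-eigenvalue k * 1) * Real.exp (1 - t))
      (heatKernel 1 (0 : Space d) * Real.exp (1 - t)) := by
    rw [heatKernel_zero 1 one_pos]
    exact (summable_exp_eigenvalue d one_pos).hasSum.mul_right _
  have key : ∀ k : Fin d → ℤ, |Real.exp (-eigenvalue k * t) * Real.cos (phase k x) -
      (if k = 0 then (1 : ℝ) else 0)| ≤ Real.exp (-eigenvalue k * 1) * Real.exp (1 - t) := by
    intro k
    by_cases hk : k = 0
    · subst hk
      simp only [eigenvalue_zero, phase, Pi.zero_apply, Int.cast_zero, zero_mul,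
        Finset.sum_const_zero, mul_zero, Real.cos_zero, neg_zero, Real.exp_zero, if_true, sub_self,
        abs_zero, mul_one, one_mul]
      positivity
    · rw [if_neg hk, sub_zero, abs_mul, Real.abs_exp, ← Real.exp_add]
      calc _ ≤ Real.exp (-eigenvalue k * t) * 1 := by gcongr; exact Real.abs_cos_le_one _
        _ ≤ _ := by
          rw [mul_one]
          gcongr
          nlinarith [one_le_eigenvalue hk]
  rw [abs_le]
  constructor
  · exact neg_le_of_neg_le (hasSum_le (fun k => (neg_le_abs _).trans (key k)) h2.neg h3)
  · exact hasSum_le (fun k => (le_abs_self _).trans (key k)) h2 h3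

theorem isPeriodic_heatKernel (t : ℝ) : IsPeriodic (heatKernel t : Space d → ℝ) := by
  intro m x
  unfold heatKernel
  rw [← (Equiv.addRight m).tsum_eq]
  refine tsum_congr fun n => ?_
  have : x + latticePoint m - latticePoint (n + m) = x - latticePoint n := by
    ext i
    simp only [PiLp.sub_apply, PiLp.add_apply, latticePoint_apply, Pi.add_apply, Int.cast_add]
    ring
  simp [this]

/-- The heat kernel, extended by zero to nonpositive times. -/
noncomputable def heatKernelPos (p : ℝ × Space d) : ℝ := if 0 < p.1 then heatKernel p.1 p.2 else 0

/-- A pointwise limit of finite Fourier sums. Joint measurability in time and space is what Fubini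
for the Green functions requires. -/
theorem measurable_heatKernelPos : Measurable (heatKernelPos : ℝ × Space d → ℝ) := by
  let F : (Fin d → ℤ) → ℝ × Space d → ℝ := fun k p =>
    if 0 < p.1 then Real.exp (-eigenvalue k * p.1) * Real.cos (phase k p.2) else 0
  have hF : ∀ k, Measurable (F k) := fun k => by
    refine Measurable.ite (measurableSet_lt measurable_const measurable_fst) ?_ measurable_const
    refine Measurable.mul (by fun_prop) (Real.measurable_cos.comp ?_)
    exact (continuous_phase k).measurable.comp measurable_snd
  refine measurable_of_tendsto_metrizable' (atTop : Filter (Finset (Fin d → ℤ)))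
    (f := fun s p => ∑ k ∈ s, F k p) (fun s => Finset.measurable_sum _ fun k _ => hF k) ?_
  rw [tendsto_pi_nhds]
  intro p
  by_cases hp : 0 < p.1
  · simp only [F, heatKernelPos, hp, if_true]
    exact hasSum_heatKernel p.2 hp
  · simp only [F, heatKernelPos, hp, if_false]
    simp

end

/-! ### Fourier coefficients of bounded functions, the heat flow, and kernels given as time
integrals. -/

section
variable {d : ℕ}

/-! ### Bounded functions on the torus and their Fourier coefficients -/

/-- Measurable functions on the torus bounded by `C`. -/
structure IsBoundedBy (f : Space d → ℝ) (C : ℝ) : Prop where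
  meas : AEStronglyMeasurable f (cellMeasure d)
  bound : ∀ x, |f x| ≤ C

theorem IsBoundedBy.nonneg {f : Space d → ℝ} {C : ℝ} (hf : IsBoundedBy f C) : 0 ≤ C :=
  (abs_nonneg _).trans (hf.bound 0)

theorem IsBoundedBy.integrable {f : Space d → ℝ} {C : ℝ} (hf : IsBoundedBy f C) :
    Integrable f (cellMeasure d) :=
  Integrable.of_bound hf.meas C (ae_of_all _ hf.bound)

theorem IsBoundedBy.mul {f h : Space d → ℝ} {C C' : ℝ} (hf : IsBoundedBy f C)
    (hh : IsBoundedBy h C') : IsBoundedBy (fun x => f x * h x) (C * C') :=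
  ⟨hf.meas.mul hh.meas, fun x => by
    rw [abs_mul]; exact mul_le_mul (hf.bound x) (hh.bound x) (abs_nonneg _) hf.nonneg⟩

theorem IsBoundedBy.add {f h : Space d → ℝ} {C C' : ℝ} (hf : IsBoundedBy f C)
    (hh : IsBoundedBy h C') : IsBoundedBy (fun x => f x + h x) (C + C') :=
  ⟨hf.meas.add hh.meas, fun x => (abs_add_le _ _).trans (add_le_add (hf.bound x) (hh.bound x))⟩

theorem IsBoundedBy.const_mul {f : Space d → ℝ} {C : ℝ} (hf : IsBoundedBy f C) (c : ℝ) :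
    IsBoundedBy (fun x => c * f x) (|c| * C) :=
  ⟨hf.meas.const_mul c, fun x => by
    rw [abs_mul]; exact mul_le_mul_of_nonneg_left (hf.bound x) (abs_nonneg c)⟩

theorem IsBoundedBy.sub {f h : Space d → ℝ} {C C' : ℝ} (hf : IsBoundedBy f C)
    (hh : IsBoundedBy h C') : IsBoundedBy (fun x => f x - h x) (C + C') :=
  ⟨hf.meas.sub hh.meas, fun x => (abs_sub _ _).trans (add_le_add (hf.bound x) (hh.bound x))⟩

theorem isBoundedBy_const (c : ℝ) : IsBoundedBy (fun _ : Space d => c) |c| :=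
  ⟨aestronglyMeasurable_const, fun _ => le_rfl⟩

theorem IsBoundedBy.abs_integral_le {f : Space d → ℝ} {C : ℝ} (hf : IsBoundedBy f C) :
    |∫ x in unitCell d, f x| ≤ C := by
  have := norm_integral_le_of_norm_le_const (μ := cellMeasure d) (f := f) (C := C)
    (ae_of_all _ hf.bound)
  simpa using this

theorem isBoundedBy_cos (k : Fin d → ℤ) : IsBoundedBy (fun x => Real.cos (phase k x)) 1 :=
  ⟨(Real.continuous_cos.comp (continuous_phase k)).aestronglyMeasurable,
    fun _ => Real.abs_cos_le_one _⟩

theorem isBoundedBy_sin (k : Fin d → ℤ) : IsBoundedBy (fun x => Real.sin (phase k x)) 1 :=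
  ⟨(Real.continuous_sin.comp (continuous_phase k)).aestronglyMeasurable,
    fun _ => Real.abs_sin_le_one _⟩

/-- The cosine coefficients of a function on the torus. -/
noncomputable def cosCoeff (k : Fin d → ℤ) (f : Space d → ℝ) : ℝ :=
  ∫ x in unitCell d, f x * Real.cos (phase k x)

/-- The sine coefficients of a function on the torus. -/
noncomputable def sinCoeff (k : Fin d → ℤ) (f : Space d → ℝ) : ℝ :=
  ∫ x in unitCell d, f x * Real.sin (phase k x)

/-- The contribution of the frequency `k` to the inner product of `f` and `h`. -/
noncomputable def coeffPair (k : Fin d → ℤ) (f h : Space d → ℝ) : ℝ :=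
  cosCoeff k f * cosCoeff k h + sinCoeff k f * sinCoeff k h

theorem coeffPair_self_nonneg (k : Fin d → ℤ) (f : Space d → ℝ) : 0 ≤ coeffPair k f f :=
  add_nonneg (mul_self_nonneg _) (mul_self_nonneg _)

theorem coeffPair_comm (k : Fin d → ℤ) (f h : Space d → ℝ) :
    coeffPair k f h = coeffPair k h f := by simp only [coeffPair, mul_comm]

theorem abs_coeffPair_le (k : Fin d → ℤ) (f h : Space d → ℝ) :
    |coeffPair k f h| ≤ coeffPair k f f + coeffPair k h h := by
  unfold coeffPair
  rw [abs_le]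
  constructor <;> nlinarith [sq_nonneg (cosCoeff k f + cosCoeff k h),
    sq_nonneg (cosCoeff k f - cosCoeff k h), sq_nonneg (sinCoeff k f + sinCoeff k h),
    sq_nonneg (sinCoeff k f - sinCoeff k h), sq_nonneg (cosCoeff k f), sq_nonneg (sinCoeff k f),
    sq_nonneg (cosCoeff k h), sq_nonneg (sinCoeff k h)]

theorem IsBoundedBy.abs_cosCoeff_le {f : Space d → ℝ} {C : ℝ} (hf : IsBoundedBy f C)
    (k : Fin d → ℤ) : |cosCoeff k f| ≤ C := by
  simpa [cosCoeff] using (hf.mul (isBoundedBy_cos k)).abs_integral_le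

theorem IsBoundedBy.abs_sinCoeff_le {f : Space d → ℝ} {C : ℝ} (hf : IsBoundedBy f C)
    (k : Fin d → ℤ) : |sinCoeff k f| ≤ C := by
  simpa [sinCoeff] using (hf.mul (isBoundedBy_sin k)).abs_integral_le

/-- Translation by half a wavelength in a coordinate with nonzero frequency reverses the sign but
preserves the integral. -/
theorem integral_cos_phase_add {m : Fin d → ℤ} (hm : m ≠ 0) (θ : ℝ) :
    ∫ x in unitCell d, Real.cos (phase m x + θ) = 0 := by
  obtain ⟨i, hi⟩ := Function.ne_iff.mp hm
  have hi' : (m i : ℝ) ≠ 0 := by exact_mod_cast hi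
  let a : Space d := EuclideanSpace.single i (1 / (2 * (m i : ℝ)))
  have ha : phase m a = Real.pi := by
    simp only [phase, a, PiLp.single_apply]
    rw [Finset.sum_eq_single i (by intro j _ hj; simp [hj]) (by simp)]
    simp only [if_true]
    field_simp
  have h := (isPeriodic_cos_phase m θ).setIntegral_add a
  have h2 : ∀ x, Real.cos (phase m (x + a) + θ) = -Real.cos (phase m x + θ) := by
    intro x
    rw [phase_add, ha, add_right_comm, Real.cos_add_pi]
  simp_rw [h2] at h
  rw [integral_neg] at h
  linarith

theorem integral_cos_phase (m : Fin d → ℤ) :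
    ∫ x in unitCell d, Real.cos (phase m x) = if m = 0 then 1 else 0 := by
  split_ifs with hm
  · subst hm
    simp [phase, measureReal_def]
  · simpa using integral_cos_phase_add hm 0

theorem integral_sin_phase (m : Fin d → ℤ) :
    ∫ x in unitCell d, Real.sin (phase m x) = 0 := by
  by_cases hm : m = 0
  · subst hm; simp [phase]
  · rw [← integral_cos_phase_add hm (-(Real.pi / 2))]
    refine integral_congr_ae (ae_of_all _ fun x => ?_)
    simp only
    rw [← sub_eq_add_neg, Real.cos_sub_pi_div_two]

theorem cosCoeff_cos (j k : Fin d → ℤ) : cosCoeff j (fun x => Real.cos (phase k x)) =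
    (if j = k then 1 / 2 else 0) + (if j = -k then 1 / 2 else 0) := by
  have h : ∀ x : Space d, Real.cos (phase k x) * Real.cos (phase j x) =
      (1 / 2) * Real.cos (phase (j - k) x) + (1 / 2) * Real.cos (phase (j + k) x) := by
    intro x
    rw [phase_sub_left, phase_add_left, Real.cos_sub, Real.cos_add]; ring
  unfold cosCoeff
  simp_rw [h]
  rw [integral_add ((isBoundedBy_cos _).const_mul _).integrable
    ((isBoundedBy_cos _).const_mul _).integrable, integral_const_mul, integral_const_mul,
    integral_cos_phase, integral_cos_phase]
  simp only [sub_eq_zero, add_eq_zero_iff_eq_neg, mul_ite, mul_one, mul_zero]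

theorem sinCoeff_sin (j k : Fin d → ℤ) : sinCoeff j (fun x => Real.sin (phase k x)) =
    (if j = k then 1 / 2 else 0) - (if j = -k then 1 / 2 else 0) := by
  have h : ∀ x : Space d, Real.sin (phase k x) * Real.sin (phase j x) =
      (1 / 2) * Real.cos (phase (j - k) x) - (1 / 2) * Real.cos (phase (j + k) x) := by
    intro x
    rw [phase_sub_left, phase_add_left, Real.cos_sub, Real.cos_add]; ring
  unfold sinCoeff
  simp_rw [h]
  rw [integral_sub ((isBoundedBy_cos _).const_mul _).integrable
    ((isBoundedBy_cos _).const_mul _).integrable, integral_const_mul, integral_const_mul,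
    integral_cos_phase, integral_cos_phase]
  simp only [sub_eq_zero, add_eq_zero_iff_eq_neg, mul_ite, mul_one, mul_zero]

theorem integral_sin_mul_cos (j k : Fin d → ℤ) :
    ∫ x in unitCell d, Real.sin (phase k x) * Real.cos (phase j x) = 0 := by
  have h : ∀ x : Space d, Real.sin (phase k x) * Real.cos (phase j x) =
      (1 / 2) * Real.sin (phase (k - j) x) + (1 / 2) * Real.sin (phase (k + j) x) := by
    intro x
    rw [phase_sub_left, phase_add_left, Real.sin_sub, Real.sin_add]; ring
  simp_rw [h]
  rw [integral_add ((isBoundedBy_sin _).const_mul _).integrable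
    ((isBoundedBy_sin _).const_mul _).integrable, integral_const_mul, integral_const_mul,
    integral_sin_phase, integral_sin_phase]
  simp

theorem cosCoeff_sin (j k : Fin d → ℤ) : cosCoeff j (fun x => Real.sin (phase k x)) = 0 :=
  integral_sin_mul_cos j k

theorem sinCoeff_cos (j k : Fin d → ℤ) : sinCoeff j (fun x => Real.cos (phase k x)) = 0 := by
  unfold sinCoeff
  simp_rw [mul_comm (Real.cos _)]
  exact integral_sin_mul_cos k j

theorem cosCoeff_neg_left (k : Fin d → ℤ) (f : Space d → ℝ) :
    cosCoeff (-k) f = cosCoeff k f := by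
  simp [cosCoeff, phase_neg_left]

theorem sinCoeff_neg_left (k : Fin d → ℤ) (f : Space d → ℝ) :
    sinCoeff (-k) f = -sinCoeff k f := by
  simp [sinCoeff, phase_neg_left, integral_neg]

/-! ### The heat flow -/

/-- The heat flow on the torus. -/
noncomputable def heatFlow (t : ℝ) (h : Space d → ℝ) (x : Space d) : ℝ :=
  ∫ y in unitCell d, heatKernel t (x - y) * h y

theorem hasSum_heatFlow {h : Space d → ℝ} {C : ℝ} (hh : IsBoundedBy h C) {t : ℝ} (ht : 0 < t)
    (x : Space d) :
    HasSum (fun k => Real.exp (-eigenvalue k * t) * (Real.cos (phase k x) * cosCoeff k h +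
      Real.sin (phase k x) * sinCoeff k h)) (heatFlow t h x) := by
  have hb : ∀ k, IsBoundedBy (fun y => Real.cos (phase k (x - y))) 1 := fun k =>
    ⟨(Real.continuous_cos.comp ((continuous_phase k).comp
      (continuous_const.sub continuous_id))).aestronglyMeasurable,
      fun _ => Real.abs_cos_le_one _⟩
  have hF := fun k => ((hb k).const_mul (Real.exp (-eigenvalue k * t))).mul hh
  have key := hasSum_integral_of_summable_integral_norm (μ := cellMeasure d)
    (F := fun k y => Real.exp (-eigenvalue k * t) * Real.cos (phase k (x - y)) * h y)
    (fun k => (hF k).integrable) ?_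
  · convert! key using 1
    · ext k
      unfold cosCoeff sinCoeff
      rw [← integral_const_mul, ← integral_const_mul, ← integral_add
        ((hh.mul (isBoundedBy_cos k)).const_mul _).integrable
        ((hh.mul (isBoundedBy_sin k)).const_mul _).integrable, ← integral_const_mul]
      refine integral_congr_ae (ae_of_all _ fun y => ?_)
      simp only [phase_sub, Real.cos_sub]
      ring
    · refine integral_congr_ae (ae_of_all _ fun y => ?_)
      exact ((hasSum_heatKernel (x - y) ht).mul_right (h y)).tsum_eq.symm
  · refine Summable.of_nonneg_of_le (fun k => integral_nonneg fun _ => norm_nonneg _) (fun k => ?_)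
      ((summable_exp_eigenvalue d ht).mul_right C)
    have h2 := norm_integral_le_of_norm_le_const (μ := cellMeasure d)
      (f := fun y => ‖Real.exp (-eigenvalue k * t) * Real.cos (phase k (x - y)) * h y‖)
      (C := Real.exp (-eigenvalue k * t) * C) (ae_of_all _ fun y => by
        have := (hF k).bound y
        rw [Real.abs_exp, mul_one] at this
        rw [norm_norm]; exact this)
    simp only [probReal_univ, mul_one] at h2
    exact (le_abs_self _).trans h2

theorem measurable_heatKernel_sub {t : ℝ} (ht : 0 < t) (x : Space d) :
    Measurable fun y : Space d => heatKernel t (x - y) := by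
  have h := (measurable_heatKernelPos (d := d)).comp
    (g := heatKernelPos) (f := fun y : Space d => (t, x - y)) (by fun_prop)
  have e : (heatKernelPos ∘ fun y : Space d => (t, x - y)) = fun y => heatKernel t (x - y) := by
    ext y; simp [heatKernelPos, ht]
  rwa [e] at h

theorem abs_heatKernel_le (x : Space d) {t : ℝ} (ht : 0 < t) :
    |heatKernel t x| ≤ heatKernel t (0 : Space d) := by
  rw [abs_of_nonneg (heatKernel_nonneg x ht)]
  exact heatKernel_le_heatKernel_zero x ht le_rfl

theorem isBoundedBy_heatKernel_sub {t : ℝ} (ht : 0 < t) (x : Space d) :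
    IsBoundedBy (fun y : Space d => heatKernel t (x - y)) (heatKernel t (0 : Space d)) :=
  ⟨(measurable_heatKernel_sub ht x).aestronglyMeasurable, fun _ => abs_heatKernel_le _ ht⟩

theorem integral_heatKernel_sub {t : ℝ} (ht : 0 < t) (x : Space d) :
    ∫ y in unitCell d, heatKernel t (x - y) = 1 := by
  have h := hasSum_heatFlow (isBoundedBy_const (1 : ℝ)) ht x
  have e1 : ∀ k : Fin d → ℤ, Real.exp (-eigenvalue k * t) *
      (Real.cos (phase k x) * cosCoeff k (fun _ => 1) +
      Real.sin (phase k x) * sinCoeff k (fun _ => 1)) = if k = 0 then 1 else 0 := by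
    intro k
    simp only [cosCoeff, sinCoeff, one_mul, integral_cos_phase, integral_sin_phase]
    split_ifs with hk
    · subst hk; simp [eigenvalue, phase]
    · simp
  simp_rw [e1] at h
  have h2 := h.unique (hasSum_ite_eq (0 : Fin d → ℤ) (1 : ℝ))
  simpa [heatFlow] using h2

theorem abs_heatFlow_le {h : Space d → ℝ} {C : ℝ} (hh : IsBoundedBy h C) {t : ℝ} (ht : 0 < t)
    (x : Space d) : |heatFlow t h x| ≤ C := by
  have hk := isBoundedBy_heatKernel_sub ht x
  calc |heatFlow t h x| ≤ ∫ y in unitCell d, |heatKernel t (x - y) * h y| :=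
        abs_integral_le_integral_abs
    _ ≤ ∫ y in unitCell d, C * heatKernel t (x - y) := by
        refine integral_mono (hk.mul hh).integrable.abs (hk.const_mul C).integrable fun y => ?_
        simp only [abs_mul, abs_of_nonneg (heatKernel_nonneg (x - y) ht)]
        rw [mul_comm]
        exact mul_le_mul_of_nonneg_right (hh.bound y) (heatKernel_nonneg _ ht)
    _ = C := by rw [integral_const_mul, integral_heatKernel_sub ht, mul_one]

theorem abs_heatFlow_le_of_kernel_le {h : Space d → ℝ} {C : ℝ} (hh : IsBoundedBy h C) {t S : ℝ}
    (ht : 0 < t) (hS : ∀ z : Space d, heatKernel t z ≤ S) (x : Space d) :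
    |heatFlow t h x| ≤ S * ∫ y in unitCell d, |h y| := by
  have hk := isBoundedBy_heatKernel_sub ht x
  calc |heatFlow t h x| ≤ ∫ y in unitCell d, |heatKernel t (x - y) * h y| :=
        abs_integral_le_integral_abs
    _ ≤ ∫ y in unitCell d, S * |h y| := by
        refine integral_mono (hk.mul hh).integrable.abs (hh.integrable.abs.const_mul S) fun y => ?_
        simp only [abs_mul, abs_of_nonneg (heatKernel_nonneg (x - y) ht)]
        exact mul_le_mul_of_nonneg_right (hS _) (abs_nonneg _)
    _ = _ := integral_const_mul _ _

theorem measurable_heatFlow_aux {h : Space d → ℝ} {C : ℝ} (hh : IsBoundedBy h C) {t : ℝ}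
    (ht : 0 < t) : AEStronglyMeasurable (heatFlow t h) (cellMeasure d) := by
  have h1 : AEStronglyMeasurable (fun p : Space d × Space d => heatKernel t (p.1 - p.2) * h p.2)
      ((cellMeasure d).prod (cellMeasure d)) := by
    refine AEStronglyMeasurable.mul ?_ hh.meas.comp_snd
    have h := (measurable_heatKernelPos (d := d)).comp
      (g := heatKernelPos) (f := fun p : Space d × Space d => (t, p.1 - p.2)) (by fun_prop)
    have e : (heatKernelPos ∘ fun p : Space d × Space d => (t, p.1 - p.2)) =
        fun p => heatKernel t (p.1 - p.2) := by
      ext y; simp [heatKernelPos, ht]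
    rw [e] at h
    exact h.aestronglyMeasurable
  exact h1.integral_prod_right'

theorem isBoundedBy_heatFlow {h : Space d → ℝ} {C : ℝ} (hh : IsBoundedBy h C) {t : ℝ}
    (ht : 0 < t) : IsBoundedBy (heatFlow t h) C :=
  ⟨measurable_heatFlow_aux hh ht, abs_heatFlow_le hh ht⟩

theorem hasSum_integral_mul_heatFlow {f h : Space d → ℝ} {C C' : ℝ} (hf : IsBoundedBy f C')
    (hh : IsBoundedBy h C) {t : ℝ} (ht : 0 < t) :
    HasSum (fun k => Real.exp (-eigenvalue k * t) * coeffPair k f h)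
      (∫ x in unitCell d, f x * heatFlow t h x) := by
  have hF := fun k : Fin d → ℤ => (hf.mul ((((isBoundedBy_cos k).const_mul (cosCoeff k h)).add
    ((isBoundedBy_sin k).const_mul (sinCoeff k h))).const_mul (Real.exp (-eigenvalue k * t))))
  have key := hasSum_integral_of_summable_integral_norm (μ := cellMeasure d)
    (F := fun (k : Fin d → ℤ) x => f x * (Real.exp (-eigenvalue k * t) *
      (cosCoeff k h * Real.cos (phase k x) + sinCoeff k h * Real.sin (phase k x))))
    (fun k => (hF k).integrable) ?_
  · convert! key using 1
    · ext k
      have e : ∀ x, f x * (Real.exp (-eigenvalue k * t) *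
          (cosCoeff k h * Real.cos (phase k x) + sinCoeff k h * Real.sin (phase k x))) =
          Real.exp (-eigenvalue k * t) * (cosCoeff k h * (f x * Real.cos (phase k x)) +
            sinCoeff k h * (f x * Real.sin (phase k x))) := fun x => by ring
      simp_rw [e]
      rw [integral_const_mul, integral_add
        ((hf.mul (isBoundedBy_cos k)).const_mul _).integrable
        ((hf.mul (isBoundedBy_sin k)).const_mul _).integrable, integral_const_mul,
        integral_const_mul]
      simp only [coeffPair, cosCoeff, sinCoeff]
      ring
    · refine integral_congr_ae (ae_of_all _ fun x => ?_)
      have := ((hasSum_heatFlow hh ht x).mul_left (f x)).tsum_eq.symm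
      simp only [mul_comm (Real.cos _), mul_comm (Real.sin _)] at this
      exact this
  · refine Summable.of_nonneg_of_le (fun k => integral_nonneg fun _ => norm_nonneg _) (fun k => ?_)
      (((summable_exp_eigenvalue d ht).mul_right (C + C)).mul_left C')
    have h2 := norm_integral_le_of_norm_le_const (μ := cellMeasure d)
      (f := fun x => ‖f x * (Real.exp (-eigenvalue k * t) *
        (cosCoeff k h * Real.cos (phase k x) + sinCoeff k h * Real.sin (phase k x)))‖)
      (C := C' * (Real.exp (-eigenvalue k * t) * (C + C))) (ae_of_all _ fun y => by
        have := (hF k).bound y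
        rw [norm_norm]
        refine this.trans ?_
        have hC' := hf.nonneg
        rw [Real.abs_exp, mul_one, mul_one]
        gcongr
        · exact hh.abs_cosCoeff_le k
        · exact hh.abs_sinCoeff_le k)
    simp only [probReal_univ, mul_one] at h2
    exact (le_abs_self _).trans h2

/-- A form of Bessel's inequality. At positive time the damped sum is bounded because the heat flow
does not increase the supremum; letting `t` tend to zero removes the damping. -/
theorem sum_coeffPair_self_le {f : Space d → ℝ} {C : ℝ} (hf : IsBoundedBy f C)
    (s : Finset (Fin d → ℤ)) : ∑ k ∈ s, coeffPair k f f ≤ C * C := by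
  have h1 : ∀ t : ℝ, 0 < t → ∑ k ∈ s, Real.exp (-eigenvalue k * t) * coeffPair k f f ≤ C * C := by
    intro t ht
    refine (sum_le_hasSum s (fun k _ => ?_) (hasSum_integral_mul_heatFlow hf hf ht)).trans ?_
    · exact mul_nonneg (Real.exp_pos _).le (coeffPair_self_nonneg k f)
    · exact (le_abs_self _).trans (hf.mul (isBoundedBy_heatFlow hf ht)).abs_integral_le
  have h2 : Tendsto (fun t : ℝ => ∑ k ∈ s, Real.exp (-eigenvalue k * t) * coeffPair k f f)
      (𝓝[>] 0) (𝓝 (∑ k ∈ s, Real.exp (-eigenvalue k * 0) * coeffPair k f f)) := by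
    refine Tendsto.mono_left (Continuous.tendsto ?_ 0) nhdsWithin_le_nhds
    fun_prop
  simp only [mul_zero, Real.exp_zero, one_mul] at h2
  exact le_of_tendsto h2 (eventually_mem_nhdsWithin.mono fun t ht => h1 t ht)

theorem summable_coeffPair_self {f : Space d → ℝ} {C : ℝ} (hf : IsBoundedBy f C) :
    Summable fun k => coeffPair k f f :=
  summable_of_sum_le (fun k => coeffPair_self_nonneg k f) (sum_coeffPair_self_le hf)

theorem summable_abs_coeffPair {f h : Space d → ℝ} {C C' : ℝ} (hf : IsBoundedBy f C)
    (hh : IsBoundedBy h C') : Summable fun k => |coeffPair k f h| :=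
  Summable.of_nonneg_of_le (fun _ => abs_nonneg _) (fun k => abs_coeffPair_le k f h)
    ((summable_coeffPair_self hf).add (summable_coeffPair_self hh))

/-! ### Kernels that are superpositions in time -/

section Superposition

variable {q : ℝ × Space d → ℝ} {w : ℝ → ℝ} {h : Space d → ℝ} {C : ℝ}

/-- An integrable-in-time bound `w` on the spatial mass of the kernel justifies every exchange of
time and space integrals. Both Green functions are instances: `w` is `exp (-κ² t)` for the screened
one and `neutralWeight` for the neutral one. The Green functions themselves may be singular at the
origin. -/
theorem integrable_uncurry_kernel_mul (hq : Measurable q) (hw : IntegrableOn w (Ioi 0))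
    (hqi : ∀ t, 0 < t → ∀ x, IntegrableOn (fun y => q (t, x - y)) (unitCell d))
    (hqw : ∀ t, 0 < t → ∀ x, ∫ y in unitCell d, |q (t, x - y)| ≤ w t)
    (hh : IsBoundedBy h C) (x : Space d) :
    Integrable (Function.uncurry fun t y => q (t, x - y) * h y)
      ((volume.restrict (Ioi (0 : ℝ))).prod (cellMeasure d)) := by
  have hm : AEStronglyMeasurable (Function.uncurry fun t y => q (t, x - y) * h y)
      ((volume.restrict (Ioi (0 : ℝ))).prod (cellMeasure d)) := by
    refine AEStronglyMeasurable.mul ?_ hh.meas.comp_snd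
    exact (hq.comp (g := q) (f := fun p : ℝ × Space d => (p.1, x - p.2))
      (by fun_prop)).aestronglyMeasurable
  rw [integrable_prod_iff hm]
  have hi : ∀ t, 0 < t → Integrable (fun y => q (t, x - y) * h y) (cellMeasure d) := fun t ht =>
    (hqi t ht x).mul_bdd hh.meas (ae_of_all _ hh.bound)
  constructor
  · filter_upwards [ae_restrict_mem measurableSet_Ioi] with t ht using hi t ht
  · refine (hw.mul_const C).mono' hm.norm.integral_prod_right' ?_
    filter_upwards [ae_restrict_mem measurableSet_Ioi] with t ht
    rw [Real.norm_of_nonneg (integral_nonneg fun _ => norm_nonneg _)]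
    calc ∫ y in unitCell d, ‖q (t, x - y) * h y‖ ≤ ∫ y in unitCell d, |q (t, x - y)| * C := by
          refine integral_mono (hi t ht).norm ((hqi t ht x).abs.mul_const C) fun y => ?_
          simp only [norm_mul, Real.norm_eq_abs]
          exact mul_le_mul_of_nonneg_left (hh.bound y) (abs_nonneg _)
      _ ≤ w t * C := by
          rw [integral_mul_const]
          exact mul_le_mul_of_nonneg_right (hqw t ht x) hh.nonneg

theorem potential_integral_eq (hq : Measurable q) (hw : IntegrableOn w (Ioi 0))
    (hqi : ∀ t, 0 < t → ∀ x, IntegrableOn (fun y => q (t, x - y)) (unitCell d))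
    (hqw : ∀ t, 0 < t → ∀ x, ∫ y in unitCell d, |q (t, x - y)| ≤ w t)
    (hh : IsBoundedBy h C) (x : Space d) :
    potential (fun z => ∫ t in Ioi (0 : ℝ), q (t, z)) h x =
      ∫ t in Ioi (0 : ℝ), ∫ y in unitCell d, q (t, x - y) * h y := by
  unfold potential
  simp_rw [← integral_mul_const]
  exact (integral_integral_swap (μ := volume.restrict (Ioi (0 : ℝ))) (ν := cellMeasure d)
    (f := fun t y => q (t, x - y) * h y)
    (integrable_uncurry_kernel_mul hq hw hqi hqw hh x)).symm

theorem integrableOn_integral_kernel_mul (hq : Measurable q) (hw : IntegrableOn w (Ioi 0))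
    (hqi : ∀ t, 0 < t → ∀ x, IntegrableOn (fun y => q (t, x - y)) (unitCell d))
    (hqw : ∀ t, 0 < t → ∀ x, ∫ y in unitCell d, |q (t, x - y)| ≤ w t)
    (hh : IsBoundedBy h C) (x : Space d) :
    IntegrableOn (fun y => (∫ t in Ioi (0 : ℝ), q (t, x - y)) * h y) (unitCell d) := by
  simp_rw [← integral_mul_const]
  exact (integrable_uncurry_kernel_mul hq hw hqi hqw hh x).integral_prod_right

theorem abs_integral_kernel_mul_le
    (hqi : ∀ t, 0 < t → ∀ x, IntegrableOn (fun y => q (t, x - y)) (unitCell d))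
    (hqw : ∀ t, 0 < t → ∀ x, ∫ y in unitCell d, |q (t, x - y)| ≤ w t)
    (hh : IsBoundedBy h C) {t : ℝ} (ht : 0 < t) (x : Space d) :
    |∫ y in unitCell d, q (t, x - y) * h y| ≤ w t * C := by
  calc _ ≤ ∫ y in unitCell d, |q (t, x - y) * h y| := abs_integral_le_integral_abs
    _ ≤ ∫ y in unitCell d, |q (t, x - y)| * C := by
        refine integral_mono ((hqi t ht x).mul_bdd hh.meas (ae_of_all _ hh.bound)).abs
          ((hqi t ht x).abs.mul_const C) fun y => ?_
        simp only [abs_mul]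
        exact mul_le_mul_of_nonneg_left (hh.bound y) (abs_nonneg _)
    _ ≤ w t * C := by
        rw [integral_mul_const]
        exact mul_le_mul_of_nonneg_right (hqw t ht x) hh.nonneg

theorem aestronglyMeasurable_kernel_integral (hq : Measurable q) (hh : IsBoundedBy h C) :
    AEStronglyMeasurable (fun p : ℝ × Space d => ∫ y in unitCell d, q (p.1, p.2 - y) * h y)
      ((volume.restrict (Ioi (0 : ℝ))).prod (cellMeasure d)) := by
  have h1 : AEStronglyMeasurable
      (fun p : (ℝ × Space d) × Space d => q (p.1.1, p.1.2 - p.2) * h p.2)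
      (((volume.restrict (Ioi (0 : ℝ))).prod (cellMeasure d)).prod (cellMeasure d)) := by
    refine AEStronglyMeasurable.mul ?_ hh.meas.comp_snd
    exact (hq.comp (g := q) (f := fun p : (ℝ × Space d) × Space d => (p.1.1, p.1.2 - p.2))
      (by fun_prop)).aestronglyMeasurable
  exact h1.integral_prod_right'

theorem isBoundedBy_potential_integral (hq : Measurable q) (hw : IntegrableOn w (Ioi 0))
    (hqi : ∀ t, 0 < t → ∀ x, IntegrableOn (fun y => q (t, x - y)) (unitCell d))
    (hqw : ∀ t, 0 < t → ∀ x, ∫ y in unitCell d, |q (t, x - y)| ≤ w t)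
    (hh : IsBoundedBy h C) :
    IsBoundedBy (potential (fun z => ∫ t in Ioi (0 : ℝ), q (t, z)) h)
      ((∫ t in Ioi (0 : ℝ), w t) * C) := by
  constructor
  · have h1 : potential (fun z => ∫ t in Ioi (0 : ℝ), q (t, z)) h = fun x =>
        ∫ t in Ioi (0 : ℝ), ∫ y in unitCell d, q (t, x - y) * h y :=
      funext (potential_integral_eq hq hw hqi hqw hh)
    rw [h1]
    exact (aestronglyMeasurable_kernel_integral hq hh).prod_swap.integral_prod_right'
  · intro x
    have e : (∫ t in Ioi (0 : ℝ), w t) * C = ∫ t in Ioi (0 : ℝ), w t * C :=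
      (integral_mul_const _ _).symm
    rw [potential_integral_eq hq hw hqi hqw hh, e, ← Real.norm_eq_abs]
    refine norm_integral_le_of_norm_le (hw.mul_const C) ?_
    filter_upwards [ae_restrict_mem measurableSet_Ioi] with t ht
    exact abs_integral_kernel_mul_le hqi hqw hh ht x

theorem integral_mul_potential_integral_eq (hq : Measurable q) (hw : IntegrableOn w (Ioi 0))
    (hqi : ∀ t, 0 < t → ∀ x, IntegrableOn (fun y => q (t, x - y)) (unitCell d))
    (hqw : ∀ t, 0 < t → ∀ x, ∫ y in unitCell d, |q (t, x - y)| ≤ w t)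
    (hh : IsBoundedBy h C) {f : Space d → ℝ} {C' : ℝ} (hf : IsBoundedBy f C') :
    ∫ x in unitCell d, f x * potential (fun z => ∫ t in Ioi (0 : ℝ), q (t, z)) h x =
      ∫ t in Ioi (0 : ℝ), ∫ x in unitCell d, f x * ∫ y in unitCell d, q (t, x - y) * h y := by
  have e : ∀ x, f x * potential (fun z => ∫ t in Ioi (0 : ℝ), q (t, z)) h x =
      ∫ t in Ioi (0 : ℝ), f x * ∫ y in unitCell d, q (t, x - y) * h y := fun x => by
    rw [potential_integral_eq hq hw hqi hqw hh, integral_const_mul]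
  simp_rw [e]
  refine (integral_integral_swap (μ := volume.restrict (Ioi (0 : ℝ))) (ν := cellMeasure d)
    (f := fun t x => f x * ∫ y in unitCell d, q (t, x - y) * h y) ?_).symm
  have hm : AEStronglyMeasurable
      (Function.uncurry fun t x => f x * ∫ y in unitCell d, q (t, x - y) * h y)
      ((volume.restrict (Ioi (0 : ℝ))).prod (cellMeasure d)) :=
    AEStronglyMeasurable.mul hf.meas.comp_snd (aestronglyMeasurable_kernel_integral hq hh)
  refine ((hw.mul_const (C * C')).comp_fst (cellMeasure d)).mono' hm ?_
  have h1 : ∀ᵐ p ∂((volume.restrict (Ioi (0 : ℝ))).prod (cellMeasure d)), p.1 ∈ Ioi (0 : ℝ) :=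
    Measure.quasiMeasurePreserving_fst.ae (ae_restrict_mem measurableSet_Ioi)
  filter_upwards [h1] with p hp
  have h2 := abs_integral_kernel_mul_le hqi hqw hh hp p.2
  simp only [Function.uncurry]
  rw [norm_mul, mul_comm, ← mul_assoc]
  exact mul_le_mul h2 (hf.bound _) (abs_nonneg _) ((abs_nonneg _).trans h2)

end Superposition

end

/-! ### Spectral calculus of the screened and the neutral Green function. -/

section
variable {d : ℕ}

/-! ### The screened Green function -/

theorem integrableOn_exp_neg_mul {a : ℝ} (ha : 0 < a) :
    IntegrableOn (fun t => Real.exp (-a * t)) (Ioi 0) := exp_neg_integrableOn_Ioi 0 ha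

theorem integral_exp_neg_mul {a : ℝ} (ha : 0 < a) :
    ∫ t in Ioi (0 : ℝ), Real.exp (-a * t) = 1 / a := by
  have h := integral_exp_mul_Ioi (a := -a) (by linarith) 0
  rw [h]
  simp

section Screened

variable {κ : ℝ}

/-- The integrand of the screened Green function, extended by zero to negative times. -/
noncomputable def screenedIntegrand (κ : ℝ) (p : ℝ × Space d) : ℝ :=
  Real.exp (-κ ^ 2 * p.1) * heatKernelPos p

theorem measurable_screenedIntegrand (κ : ℝ) :
    Measurable (screenedIntegrand κ : ℝ × Space d → ℝ) :=
  Measurable.mul (by fun_prop) measurable_heatKernelPos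

theorem screenedIntegrand_of_pos {t : ℝ} (ht : 0 < t) (x : Space d) :
    screenedIntegrand κ (t, x) = Real.exp (-κ ^ 2 * t) * heatKernel t x := by
  simp [screenedIntegrand, heatKernelPos, ht]

theorem greenScreened_eq (κ : ℝ) : (greenScreened κ : Space d → ℝ) =
    fun z => ∫ t in Ioi (0 : ℝ), screenedIntegrand κ (t, z) := by
  ext z
  unfold greenScreened
  exact setIntegral_congr_fun measurableSet_Ioi fun t ht => (screenedIntegrand_of_pos ht z).symm

theorem integrableOn_screenedIntegrand {t : ℝ} (ht : 0 < t) (x : Space d) :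
    IntegrableOn (fun y => screenedIntegrand κ (t, x - y)) (unitCell d) := by
  simp_rw [screenedIntegrand_of_pos ht]
  exact ((isBoundedBy_heatKernel_sub ht x).const_mul _).integrable

theorem integral_abs_screenedIntegrand {t : ℝ} (ht : 0 < t) (x : Space d) :
    ∫ y in unitCell d, |screenedIntegrand κ (t, x - y)| = Real.exp (-κ ^ 2 * t) := by
  simp_rw [screenedIntegrand_of_pos ht, abs_mul, Real.abs_exp,
    abs_of_nonneg (heatKernel_nonneg _ ht)]
  rw [integral_const_mul, integral_heatKernel_sub ht, mul_one]

theorem integral_screenedIntegrand_mul {t : ℝ} (ht : 0 < t) (h : Space d → ℝ) (x : Space d) :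
    ∫ y in unitCell d, screenedIntegrand κ (t, x - y) * h y =
      Real.exp (-κ ^ 2 * t) * heatFlow t h x := by
  simp_rw [screenedIntegrand_of_pos ht, mul_assoc]
  exact integral_const_mul _ _

theorem integrableOn_exp_screening (hκ : 0 < κ) :
    IntegrableOn (fun t => Real.exp (-κ ^ 2 * t)) (Ioi 0) :=
  integrableOn_exp_neg_mul (by positivity)

theorem isBoundedBy_potential (hκ : 0 < κ) {h : Space d → ℝ} {C : ℝ} (hh : IsBoundedBy h C) :
    IsBoundedBy (potential (greenScreened κ) h) (1 / κ ^ 2 * C) := by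
  rw [greenScreened_eq, ← integral_exp_neg_mul (a := κ ^ 2) (by positivity)]
  exact isBoundedBy_potential_integral (measurable_screenedIntegrand κ)
    (integrableOn_exp_screening hκ) (fun t ht x => integrableOn_screenedIntegrand ht x)
    (fun t ht x => (integral_abs_screenedIntegrand ht x).le) hh

theorem potential_screened_eq (hκ : 0 < κ) {h : Space d → ℝ} {C : ℝ} (hh : IsBoundedBy h C)
    (x : Space d) : potential (greenScreened κ) h x =
      ∫ t in Ioi (0 : ℝ), Real.exp (-κ ^ 2 * t) * heatFlow t h x := by
  rw [greenScreened_eq, potential_integral_eq (measurable_screenedIntegrand κ)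
    (integrableOn_exp_screening hκ) (fun t ht x => integrableOn_screenedIntegrand ht x)
    (fun t ht x => (integral_abs_screenedIntegrand ht x).le) hh]
  exact setIntegral_congr_fun measurableSet_Ioi fun t ht => integral_screenedIntegrand_mul ht h x

theorem potential_screened_add (hκ : 0 < κ) {f h : Space d → ℝ} {C C' : ℝ}
    (hf : IsBoundedBy f C') (hh : IsBoundedBy h C) (x : Space d) :
    potential (greenScreened κ) (fun y => f y + h y) x =
      potential (greenScreened κ) f x + potential (greenScreened κ) h x := by
  have hi : ∀ {f : Space d → ℝ} {C : ℝ}, IsBoundedBy f C →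
      Integrable (fun y => greenScreened κ (x - y) * f y) (cellMeasure d) := fun hf => by
    rw [greenScreened_eq]
    exact integrableOn_integral_kernel_mul (measurable_screenedIntegrand κ)
      (integrableOn_exp_screening hκ) (fun t ht x => integrableOn_screenedIntegrand ht x)
      (fun t ht x => (integral_abs_screenedIntegrand ht x).le) hf x
  unfold potential
  rw [← integral_add (hi hf) (hi hh)]
  simp_rw [mul_add]

/-- In each mode the time integral of `exp (-(λ + κ²) t)` equals `1 / (λ + κ²)`. This formula stands
in for the equation `-Δ w + κ² w = h`. -/
theorem hasSum_integral_mul_potential (hκ : 0 < κ) {f h : Space d → ℝ} {C C' : ℝ}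
    (hf : IsBoundedBy f C') (hh : IsBoundedBy h C) :
    HasSum (fun k => coeffPair k f h / (eigenvalue k + κ ^ 2))
      (∫ x in unitCell d, f x * potential (greenScreened κ) h x) := by
  have hκ2 : 0 < κ ^ 2 := by positivity
  have hpos : ∀ k : Fin d → ℤ, 0 < eigenvalue k + κ ^ 2 := fun k => by
    linarith [eigenvalue_nonneg k]
  rw [greenScreened_eq, integral_mul_potential_integral_eq (measurable_screenedIntegrand κ)
    (integrableOn_exp_screening hκ) (fun t ht x => integrableOn_screenedIntegrand ht x)
    (fun t ht x => (integral_abs_screenedIntegrand ht x).le) hh hf]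
  have key := hasSum_integral_of_summable_integral_norm (μ := volume.restrict (Ioi (0 : ℝ)))
    (F := fun (k : Fin d → ℤ) t => Real.exp (-(eigenvalue k + κ ^ 2) * t) * coeffPair k f h)
    (fun k => (integrableOn_exp_neg_mul (hpos k)).mul_const _) ?_
  · convert! key using 1
    · ext k
      have e : ∫ t in Ioi (0 : ℝ), Real.exp (-(eigenvalue k + κ ^ 2) * t) * coeffPair k f h =
        (∫ t in Ioi (0 : ℝ), Real.exp (-(eigenvalue k + κ ^ 2) * t)) * coeffPair k f h :=
        integral_mul_const _ _
      rw [e, integral_exp_neg_mul (hpos k)]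
      ring
    · refine setIntegral_congr_fun measurableSet_Ioi fun t ht => ?_
      have h1 := ((hasSum_integral_mul_heatFlow hf hh ht).mul_left (Real.exp (-κ ^ 2 * t))).tsum_eq
      have e2 : ∀ k : Fin d → ℤ, Real.exp (-(eigenvalue k + κ ^ 2) * t) * coeffPair k f h =
          Real.exp (-κ ^ 2 * t) * (Real.exp (-eigenvalue k * t) * coeffPair k f h) := fun k => by
        rw [← mul_assoc, ← Real.exp_add]; ring_nf
      simp_rw [e2]
      rw [h1, ← integral_const_mul]
      refine integral_congr_ae (ae_of_all _ fun x => ?_)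
      simp only
      rw [integral_screenedIntegrand_mul ht]
      ring
  · have e : ∀ k : Fin d → ℤ, ∫ t in Ioi (0 : ℝ),
        ‖Real.exp (-(eigenvalue k + κ ^ 2) * t) * coeffPair k f h‖ =
        1 / (eigenvalue k + κ ^ 2) * |coeffPair k f h| := by
      intro k
      simp_rw [norm_mul, Real.norm_eq_abs, Real.abs_exp]
      rw [← integral_exp_neg_mul (hpos k)]
      exact integral_mul_const _ _
    simp_rw [e]
    refine Summable.of_nonneg_of_le (fun k => ?_) (fun k => ?_)
      ((summable_abs_coeffPair hf hh).mul_left (1 / κ ^ 2))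
    · have := hpos k
      positivity
    · gcongr
      linarith [eigenvalue_nonneg k]

/-- In the real trigonometric system the frequencies `k` and `-k` give the same functions up to
sign, so pairing with one mode collects half a term from each. For `k = 0` the two halves add up,
and no separate case is needed. -/
theorem hasSum_coeff_pair {k : Fin d → ℤ} (A B : (Fin d → ℤ) → ℝ) :
    HasSum (fun j => ((if j = k then 1 / 2 else 0) * A j + (if j = -k then 1 / 2 else 0) * B j))
      (1 / 2 * A k + 1 / 2 * B (-k)) := by
  have h1 := hasSum_ite_eq k (1 / 2 * A k)
  have h2 := hasSum_ite_eq (-k) (1 / 2 * B (-k))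
  convert! h1.add h2 using 1
  ext j
  congr 1 <;> split_ifs with hj <;> simp [hj]

theorem cosCoeff_potential (hκ : 0 < κ) {h : Space d → ℝ} {C : ℝ} (hh : IsBoundedBy h C)
    (k : Fin d → ℤ) :
    cosCoeff k (potential (greenScreened κ) h) = cosCoeff k h / (eigenvalue k + κ ^ 2) := by
  have h1 := hasSum_integral_mul_potential hκ (isBoundedBy_cos k) hh
  have h2 := (hasSum_coeff_pair (k := k) (fun j => cosCoeff j h / (eigenvalue j + κ ^ 2))
    (fun j => cosCoeff j h / (eigenvalue j + κ ^ 2)))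
  have e : ∀ j, coeffPair j (fun x => Real.cos (phase k x)) h / (eigenvalue j + κ ^ 2) =
      ((if j = k then 1 / 2 else 0) * (cosCoeff j h / (eigenvalue j + κ ^ 2)) +
      (if j = -k then 1 / 2 else 0) * (cosCoeff j h / (eigenvalue j + κ ^ 2))) := by
    intro j
    rw [coeffPair, cosCoeff_cos, sinCoeff_cos]
    ring
  simp_rw [e] at h1
  have h3 := h1.unique h2
  rw [cosCoeff_neg_left, eigenvalue_neg] at h3
  unfold cosCoeff at h3 ⊢
  simp_rw [mul_comm (potential _ _ _)]
  rw [h3]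
  ring

theorem sinCoeff_potential (hκ : 0 < κ) {h : Space d → ℝ} {C : ℝ} (hh : IsBoundedBy h C)
    (k : Fin d → ℤ) :
    sinCoeff k (potential (greenScreened κ) h) = sinCoeff k h / (eigenvalue k + κ ^ 2) := by
  have h1 := hasSum_integral_mul_potential hκ (isBoundedBy_sin k) hh
  have h2 := (hasSum_coeff_pair (k := k) (fun j => sinCoeff j h / (eigenvalue j + κ ^ 2))
    (fun j => -sinCoeff j h / (eigenvalue j + κ ^ 2)))
  have e : ∀ j, coeffPair j (fun x => Real.sin (phase k x)) h / (eigenvalue j + κ ^ 2) =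
      ((if j = k then 1 / 2 else 0) * (sinCoeff j h / (eigenvalue j + κ ^ 2)) +
      (if j = -k then 1 / 2 else 0) * (-sinCoeff j h / (eigenvalue j + κ ^ 2))) := by
    intro j
    rw [coeffPair, sinCoeff_sin, cosCoeff_sin]
    ring
  simp_rw [e] at h1
  have h3 := h1.unique h2
  rw [sinCoeff_neg_left, eigenvalue_neg] at h3
  unfold sinCoeff at h3 ⊢
  simp_rw [mul_comm (potential _ _ _)]
  rw [h3]
  ring

theorem integral_mul_potential_comm (hκ : 0 < κ) {f h : Space d → ℝ} {C C' : ℝ}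
    (hf : IsBoundedBy f C') (hh : IsBoundedBy h C) :
    ∫ x in unitCell d, f x * potential (greenScreened κ) h x =
      ∫ x in unitCell d, h x * potential (greenScreened κ) f x := by
  have h1 := hasSum_integral_mul_potential hκ hf hh
  simp_rw [coeffPair_comm _ f h] at h1
  exact h1.unique (hasSum_integral_mul_potential hκ hh hf)

theorem integral_mul_potential_self_nonneg (hκ : 0 < κ) {f : Space d → ℝ} {C : ℝ}
    (hf : IsBoundedBy f C) :
    0 ≤ ∫ x in unitCell d, f x * potential (greenScreened κ) f x :=
  (hasSum_integral_mul_potential hκ hf hf).nonneg fun k =>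
    div_nonneg (coeffPair_self_nonneg k f) (by have := eigenvalue_nonneg k; positivity)

/-- The multiplier is `1 - κ² / (λ + κ²)`. It vanishes on constants, which is why the screened
correction restores neutrality, and it lies between zero and one. -/
theorem coeffPair_sub_potential (hκ : 0 < κ) {f g : Space d → ℝ} {C : ℝ}
    (hg : IsBoundedBy g C) (k : Fin d → ℤ) :
    coeffPair k (fun x => g x - κ ^ 2 * potential (greenScreened κ) g x) f =
      eigenvalue k / (eigenvalue k + κ ^ 2) * coeffPair k g f := by
  have hv := isBoundedBy_potential hκ hg
  have hpos : 0 < eigenvalue k + κ ^ 2 := by have := eigenvalue_nonneg k; positivity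
  have h1 : cosCoeff k (fun x => g x - κ ^ 2 * potential (greenScreened κ) g x) =
      eigenvalue k / (eigenvalue k + κ ^ 2) * cosCoeff k g := by
    have e := cosCoeff_potential hκ hg k
    unfold cosCoeff at e ⊢
    simp_rw [sub_mul, mul_assoc]
    rw [integral_sub (hg.mul (isBoundedBy_cos k)).integrable
      ((hv.mul (isBoundedBy_cos k)).const_mul _).integrable, integral_const_mul, e]
    field_simp
    ring
  have h2 : sinCoeff k (fun x => g x - κ ^ 2 * potential (greenScreened κ) g x) =
      eigenvalue k / (eigenvalue k + κ ^ 2) * sinCoeff k g := by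
    have e := sinCoeff_potential hκ hg k
    unfold sinCoeff at e ⊢
    simp_rw [sub_mul, mul_assoc]
    rw [integral_sub (hg.mul (isBoundedBy_sin k)).integrable
      ((hv.mul (isBoundedBy_sin k)).const_mul _).integrable, integral_const_mul, e]
    field_simp
    ring
  rw [coeffPair, h1, h2, coeffPair]
  ring

/-- With `w` the potential of `g`, the difference of the two sides is the pairing of `g - κ² w` with
`w`, whose multiplier `λ / (λ + κ²)²` is nonnegative. -/
theorem integral_potential_sq_le (hκ : 0 < κ) {g : Space d → ℝ} {C : ℝ} (hg : IsBoundedBy g C) :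
    κ ^ 2 * ∫ x in unitCell d, potential (greenScreened κ) g x ^ 2 ≤
      ∫ x in unitCell d, g x * potential (greenScreened κ) g x := by
  have hv := isBoundedBy_potential hκ hg
  have hf := hg.sub (hv.const_mul (κ ^ 2))
  have h1 := hasSum_integral_mul_potential hκ hf hg
  have h2 : 0 ≤ ∫ x in unitCell d, (g x - κ ^ 2 * potential (greenScreened κ) g x) *
      potential (greenScreened κ) g x := by
    refine h1.nonneg fun k => ?_
    rw [coeffPair_sub_potential hκ hg]
    have := eigenvalue_nonneg k
    have := coeffPair_self_nonneg k g
    positivity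
  have e : ∀ x, (g x - κ ^ 2 * potential (greenScreened κ) g x) * potential (greenScreened κ) g x =
      g x * potential (greenScreened κ) g x - κ ^ 2 * (potential (greenScreened κ) g x *
        potential (greenScreened κ) g x) := fun x => by ring
  simp_rw [e] at h2
  rw [integral_sub (hg.mul hv).integrable ((hv.mul hv).const_mul _).integrable,
    integral_const_mul] at h2
  simp_rw [sq]
  simp_rw [sq] at h2
  linarith

/-- Expanding the square, the cross term outweighs the last one by `integral_potential_sq_le`.
Applied to the partial derivatives, it shows that the screening correction does not raise the
Dirichlet energy. -/
theorem integral_sub_potential_sq_le (hκ : 0 < κ) {g : Space d → ℝ} {C : ℝ}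
    (hg : IsBoundedBy g C) :
    ∫ x in unitCell d, (g x - κ ^ 2 * potential (greenScreened κ) g x) ^ 2 ≤
      ∫ x in unitCell d, g x ^ 2 := by
  have hv := isBoundedBy_potential hκ hg
  have h1 := integral_potential_sq_le hκ hg
  have h2 := integral_mul_potential_self_nonneg hκ hg
  have e : ∀ x, (g x - κ ^ 2 * potential (greenScreened κ) g x) ^ 2 =
      g x * g x - 2 * κ ^ 2 * (g x * potential (greenScreened κ) g x) + κ ^ 4 *
        (potential (greenScreened κ) g x * potential (greenScreened κ) g x) := fun x => by ring
  simp_rw [e]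
  rw [integral_add (((hg.mul hg).sub ((hg.mul hv).const_mul _)).integrable)
    ((hv.mul hv).const_mul _).integrable, integral_sub (hg.mul hg).integrable
    ((hg.mul hv).const_mul _).integrable, integral_const_mul, integral_const_mul]
  simp_rw [sq (g _)]
  simp_rw [sq (potential _ _ _)] at h1
  have hκ2 : 0 < κ ^ 2 := by positivity
  nlinarith

theorem integral_potential_screened (hκ : 0 < κ) {g : Space d → ℝ} {C : ℝ}
    (hg : IsBoundedBy g C) :
    κ ^ 2 * ∫ x in unitCell d, potential (greenScreened κ) g x = ∫ x in unitCell d, g x := by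
  have h := cosCoeff_potential hκ hg 0
  simp only [cosCoeff, phase, Pi.zero_apply, Int.cast_zero, zero_mul, Finset.sum_const_zero,
    mul_zero, Real.cos_zero, mul_one, eigenvalue_zero, zero_add] at h
  rw [h]
  field_simp

/-- The time integral is split at `T`: before `T` the flow is bounded by the supremum of `h`; after
`T` the kernel is bounded by `T ^ (-d/2)` and only the `L¹` norm of `h` matters. -/
theorem abs_potential_le (d : ℕ) : ∃ A, 0 < A ∧ ∀ κ : ℝ, 0 < κ → ∀ (h : Space d → ℝ) (C : ℝ),
    IsBoundedBy h C → ∀ T : ℝ, 0 < T → T ≤ 1 → ∀ x,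
      |potential (greenScreened κ) h x| ≤
        T * C + A / κ ^ 2 * T ^ (-(d : ℝ) / 2) * ∫ y in unitCell d, |h y| := by
  obtain ⟨A, hA, hAb⟩ := exists_heatKernel_le_rpow d
  refine ⟨A, hA, fun κ hκ h C hh T hT hT1 x => ?_⟩
  have hκ2 : 0 < κ ^ 2 := by positivity
  set I := ∫ y in unitCell d, |h y|
  have hI : 0 ≤ I := integral_nonneg fun _ => abs_nonneg _
  have hb : ∀ t ∈ Ioi (0 : ℝ), |Real.exp (-κ ^ 2 * t) * heatFlow t h x| ≤
      (Ioc 0 T).indicator (fun _ => C) t +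
        Real.exp (-κ ^ 2 * t) * (A * T ^ (-(d : ℝ) / 2) * I) := by
    intro t ht
    have ht0 : 0 < t := ht
    rw [abs_mul, Real.abs_exp]
    by_cases htT : t ≤ T
    · rw [indicator_of_mem (show t ∈ Ioc 0 T from ⟨ht, htT⟩)]
      have h1 : Real.exp (-κ ^ 2 * t) ≤ 1 := by
        rw [Real.exp_le_one_iff]; nlinarith
      have h2 := abs_heatFlow_le hh ht0 x
      have h3 : 0 ≤ Real.exp (-κ ^ 2 * t) * (A * T ^ (-(d : ℝ) / 2) * I) := by positivity
      nlinarith [abs_nonneg (heatFlow t h x), Real.exp_pos (-κ ^ 2 * t)]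
    · rw [indicator_of_notMem (fun h' => htT h'.2), zero_add]
      gcongr
      exact abs_heatFlow_le_of_kernel_le hh ht0 (fun z => hAb T t hT hT1 (not_le.mp htT).le z) x
  have hi1 : Integrable ((Ioc 0 T).indicator fun _ => C) (volume.restrict (Ioi (0 : ℝ))) := by
    refine Integrable.restrict ?_
    rw [integrable_indicator_iff measurableSet_Ioc]
    exact integrableOn_const (by simp)
  have hi2 : Integrable (fun t => Real.exp (-κ ^ 2 * t) * (A * T ^ (-(d : ℝ) / 2) * I))
      (volume.restrict (Ioi (0 : ℝ))) := (integrableOn_exp_screening hκ).mul_const _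
  rw [potential_screened_eq hκ hh, ← Real.norm_eq_abs]
  refine (norm_integral_le_of_norm_le (hi1.add hi2) ((ae_restrict_iff' measurableSet_Ioi).2
    (ae_of_all _ hb))).trans (le_of_eq ?_)
  have e1 : ∫ t in Ioi (0 : ℝ), (Ioc 0 T).indicator (fun _ => C) t = T * C := by
    rw [setIntegral_indicator measurableSet_Ioc, inter_eq_right.2 Ioc_subset_Ioi_self]
    simp [hT.le]
  have e2 : ∫ t in Ioi (0 : ℝ), Real.exp (-κ ^ 2 * t) * (A * T ^ (-(d : ℝ) / 2) * I) =
      (∫ t in Ioi (0 : ℝ), Real.exp (-κ ^ 2 * t)) * (A * T ^ (-(d : ℝ) / 2) * I) :=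
    integral_mul_const _ _
  simp only [Pi.add_apply]
  rw [integral_add hi1 hi2, e1, e2, integral_exp_neg_mul hκ2]
  ring

theorem isPeriodic_potential_screened (κ : ℝ) (h : Space d → ℝ) :
    IsPeriodic (potential (greenScreened κ) h) := by
  intro n x
  unfold potential greenScreened
  have e : ∀ t : ℝ, ∀ y, heatKernel t (x + latticePoint n - y) = heatKernel t (x - y) := by
    intro t y
    rw [add_sub_right_comm, isPeriodic_heatKernel]
  simp_rw [e]

/-! ### The weak gradient of a screened potential -/

theorem fderiv_phase (k : Fin d → ℤ) (x : Space d) (i : Fin d) :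
    fderiv ℝ (phase k) x (EuclideanSpace.single i 1) = 2 * Real.pi * k i := by
  have h : phase k = (2 * Real.pi) • fun x : Space d =>
      ∑ i, (k i : ℝ) * (EuclideanSpace.proj i : Space d →L[ℝ] ℝ) x := by
    ext x; simp [phase]
  have h2 : HasFDerivAt (phase k) ((2 * Real.pi) • ∑ i, (k i : ℝ) •
      (EuclideanSpace.proj i : Space d →L[ℝ] ℝ)) x := by
    rw [h]
    refine HasFDerivAt.const_smul (HasFDerivAt.fun_sum fun i _ => ?_) _
    exact (ContinuousLinearMap.hasFDerivAt _).const_mul _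
  rw [h2.fderiv]
  simp [PiLp.single_apply]

/-- `g'` is the weak partial derivative of `g` in the direction `i`. -/
def IsWeakPartial (i : Fin d) (g g' : Space d → ℝ) : Prop :=
  ∀ φ : Space d → ℝ, ContDiff ℝ ∞ φ → IsPeriodic φ →
    ∫ x in unitCell d, g x * fderiv ℝ φ x (EuclideanSpace.single i 1) =
      -∫ x in unitCell d, g' x * φ x

theorem IsPeriodic.isWeakPartial {g : Space d → ℝ} (hg : IsPeriodic g) {C : NNReal}
    (hL : LipschitzWith C g) (i : Fin d) :
    IsWeakPartial i g fun x => fderiv ℝ g x (EuclideanSpace.single i 1) :=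
  fun _ hφ hp => hg.integral_mul_fderiv hL hp (hφ.of_le (by exact_mod_cast le_top)) _

theorem IsWeakPartial.cosCoeff_eq {i : Fin d} {g g' : Space d → ℝ} (hw : IsWeakPartial i g g')
    (k : Fin d → ℤ) : cosCoeff k g' = 2 * Real.pi * k i * sinCoeff k g := by
  have hper : IsPeriodic fun x => Real.cos (phase k x) := by
    simpa using isPeriodic_cos_phase k 0
  have h := hw (fun x => Real.cos (phase k x)) (Real.contDiff_cos.comp (contDiff_phase k)) hper
  have hd : ∀ x, fderiv ℝ (fun x => Real.cos (phase k x)) x (EuclideanSpace.single i 1) =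
      -(2 * Real.pi * k i) * Real.sin (phase k x) := by
    intro x
    rw [fderiv_cos ((contDiff_phase k).differentiable (by simp) x)]
    simp only [_root_.smul_apply, fderiv_phase, smul_eq_mul]
    ring
  simp_rw [hd] at h
  have e : ∀ x, g x * (-(2 * Real.pi * k i) * Real.sin (phase k x)) =
      -(2 * Real.pi * k i) * (g x * Real.sin (phase k x)) := fun x => by ring
  simp_rw [e] at h
  rw [integral_const_mul] at h
  unfold cosCoeff sinCoeff
  linarith

theorem IsWeakPartial.sinCoeff_eq {i : Fin d} {g g' : Space d → ℝ} (hw : IsWeakPartial i g g')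
    (k : Fin d → ℤ) : sinCoeff k g' = -(2 * Real.pi * k i * cosCoeff k g) := by
  have hper : IsPeriodic fun x => Real.sin (phase k x) := by
    have := isPeriodic_cos_phase k (-(Real.pi / 2))
    simpa only [← sub_eq_add_neg, Real.cos_sub_pi_div_two] using this
  have h := hw (fun x => Real.sin (phase k x)) (Real.contDiff_sin.comp (contDiff_phase k)) hper
  have hd : ∀ x, fderiv ℝ (fun x => Real.sin (phase k x)) x (EuclideanSpace.single i 1) =
      (2 * Real.pi * k i) * Real.cos (phase k x) := by
    intro x
    rw [fderiv_sin ((contDiff_phase k).differentiable (by simp) x)]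
    simp only [_root_.smul_apply, fderiv_phase, smul_eq_mul]
    ring
  simp_rw [hd] at h
  have e : ∀ x, g x * ((2 * Real.pi * k i) * Real.cos (phase k x)) =
      (2 * Real.pi * k i) * (g x * Real.cos (phase k x)) := fun x => by ring
  simp_rw [e] at h
  rw [integral_const_mul] at h
  unfold cosCoeff sinCoeff
  linarith

/-- Differentiation and the potential are both Fourier multipliers, hence commute. Testing with `φ`,
the two spectral series agree term by term. -/
theorem IsWeakPartial.potential (hκ : 0 < κ) {i : Fin d} {g g' : Space d → ℝ} {C C' : ℝ}
    (hg : IsBoundedBy g C) (hg' : IsBoundedBy g' C') (hw : IsWeakPartial i g g') :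
    IsWeakPartial i (potential (greenScreened κ) g) (potential (greenScreened κ) g') := by
  intro φ hφ hp
  obtain ⟨L, hL⟩ := hp.lipschitzWith (hφ.of_le (by exact_mod_cast le_top))
  obtain ⟨B, -, hB⟩ := hp.exists_bound hφ.continuous
  have hφw := hp.isWeakPartial hL i
  have bφ : IsBoundedBy φ B := ⟨hφ.continuous.aestronglyMeasurable, hB⟩
  have bφ' : IsBoundedBy (fun x => fderiv ℝ φ x (EuclideanSpace.single i 1)) L :=
    ⟨(measurable_fderiv_apply_const ℝ φ _).aestronglyMeasurable, fun x => by
      refine ((fderiv ℝ φ x).le_opNorm _).trans ?_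
      simpa using norm_fderiv_le_of_lipschitz ℝ hL⟩
  have h1 := hasSum_integral_mul_potential hκ bφ' hg
  have h2 := (hasSum_integral_mul_potential hκ bφ hg').neg
  have e : ∀ k, coeffPair k (fun x => fderiv ℝ φ x (EuclideanSpace.single i 1)) g /
      (eigenvalue k + κ ^ 2) = -(coeffPair k φ g' / (eigenvalue k + κ ^ 2)) := by
    intro k
    simp only [coeffPair, hφw.cosCoeff_eq, hφw.sinCoeff_eq, hw.cosCoeff_eq, hw.sinCoeff_eq]
    ring
  simp_rw [e] at h1
  have h3 := h1.unique h2
  simp_rw [mul_comm (OhtaKawasaki.potential _ _ _)]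
  exact h3

end Screened

/-! ### The neutral Green function -/

/-- The integrand of the neutral Green function, extended by zero to negative times. -/
noncomputable def neutralIntegrand (p : ℝ × Space d) : ℝ :=
  if 0 < p.1 then heatKernel p.1 p.2 - 1 else 0

theorem neutralIntegrand_of_pos {t : ℝ} (ht : 0 < t) (x : Space d) :
    neutralIntegrand (t, x) = heatKernel t x - 1 := by simp [neutralIntegrand, ht]

theorem measurable_neutralIntegrand : Measurable (neutralIntegrand : ℝ × Space d → ℝ) := by
  have e : (neutralIntegrand : ℝ × Space d → ℝ) =
      fun p => if 0 < p.1 then heatKernelPos p - 1 else 0 := by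
    ext p
    by_cases hp : 0 < p.1 <;> simp [neutralIntegrand, heatKernelPos, hp]
  rw [e]
  exact Measurable.ite (measurableSet_lt measurable_const measurable_fst)
    (measurable_heatKernelPos.sub_const 1) measurable_const

theorem greenNeutral_eq : (greenNeutral : Space d → ℝ) =
    fun z => ∫ t in Ioi (0 : ℝ), neutralIntegrand (t, z) := by
  ext z
  unfold greenNeutral
  exact setIntegral_congr_fun measurableSet_Ioi fun t ht => (neutralIntegrand_of_pos ht z).symm

theorem isBoundedBy_neutralIntegrand {t : ℝ} (ht : 0 < t) (x : Space d) :
    IsBoundedBy (fun y => neutralIntegrand (t, x - y)) (heatKernel t (0 : Space d) + |1|) := by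
  simp_rw [neutralIntegrand_of_pos ht]
  exact (isBoundedBy_heatKernel_sub ht x).sub (isBoundedBy_const 1)

/-- A bound for the total mass of `p_t - 1`, integrable in time. -/
noncomputable def neutralWeight (d : ℕ) (t : ℝ) : ℝ :=
  (Ioc 0 1).indicator (fun _ => 2) t + heatKernel 1 (0 : Space d) * Real.exp 1 * Real.exp (-1 * t)

theorem integrableOn_neutralWeight (d : ℕ) : IntegrableOn (neutralWeight d) (Ioi 0) := by
  refine Integrable.add ?_ ((integrableOn_exp_neg_mul one_pos).const_mul _)
  refine Integrable.restrict ?_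
  rw [integrable_indicator_iff measurableSet_Ioc]
  exact integrableOn_const (by simp)

theorem integral_abs_neutralIntegrand_le {t : ℝ} (ht : 0 < t) (x : Space d) :
    ∫ y in unitCell d, |neutralIntegrand (t, x - y)| ≤ neutralWeight d t := by
  have hk := isBoundedBy_heatKernel_sub ht x
  have h0 := heatKernel_nonneg (0 : Space d) one_pos
  simp_rw [neutralIntegrand_of_pos ht]
  unfold neutralWeight
  by_cases ht1 : t ≤ 1
  · rw [indicator_of_mem (show t ∈ Ioc 0 1 from ⟨ht, ht1⟩)]
    have h1 : ∫ y in unitCell d, |heatKernel t (x - y) - 1| ≤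
        ∫ y in unitCell d, (heatKernel t (x - y) + 1) := by
      refine integral_mono (hk.sub (isBoundedBy_const 1)).integrable.abs
        (hk.add (isBoundedBy_const 1)).integrable fun y => ?_
      simp only
      have := heatKernel_nonneg (x - y) ht
      rw [abs_le]; constructor <;> linarith
    rw [integral_add hk.integrable (integrable_const _), integral_heatKernel_sub ht] at h1
    simp only [integral_const, probReal_univ, smul_eq_mul, mul_one] at h1
    have : 0 ≤ heatKernel 1 (0 : Space d) * Real.exp 1 * Real.exp (-1 * t) := by positivity
    linarith
  · rw [indicator_of_notMem (fun h' => ht1 h'.2), zero_add]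
    have h1 : ∫ y in unitCell d, |heatKernel t (x - y) - 1| ≤
        ∫ y in unitCell d, heatKernel 1 (0 : Space d) * Real.exp (1 - t) := by
      refine integral_mono (hk.sub (isBoundedBy_const 1)).integrable.abs
        (integrable_const _) fun y => ?_
      exact abs_heatKernel_sub_one_le _ (not_le.mp ht1).le
    simp only [integral_const, probReal_univ, smul_eq_mul, one_mul] at h1
    refine h1.trans (le_of_eq ?_)
    rw [mul_assoc, ← Real.exp_add]
    ring_nf

/-- The kernel is the heat kernel minus its mean, integrated in time; the subtracted constant does
not act on functions of mean zero. The term at `k = 0` is `0 / 0`, which has the intended value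
zero. -/
theorem hasSum_integral_mul_potential_neutral {f : Space d → ℝ} {C : ℝ} (hf : IsBoundedBy f C)
    (hmean : ∫ x in unitCell d, f x = 0) :
    HasSum (fun k => coeffPair k f f / eigenvalue k)
      (∫ x in unitCell d, f x * potential greenNeutral f x) := by
  rw [greenNeutral_eq, integral_mul_potential_integral_eq measurable_neutralIntegrand
    (integrableOn_neutralWeight d) (fun t ht x => (isBoundedBy_neutralIntegrand ht x).integrable)
    (fun t ht x => integral_abs_neutralIntegrand_le ht x) hf hf]
  have h0 : coeffPair 0 f f = 0 := by
    simp only [coeffPair, cosCoeff, sinCoeff, phase, Pi.zero_apply, Int.cast_zero, zero_mul,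
      Finset.sum_const_zero, mul_zero, Real.cos_zero, Real.sin_zero, mul_one, hmean, add_zero,
      integral_zero]
  have hint : ∀ k : Fin d → ℤ, IntegrableOn
      (fun t => Real.exp (-eigenvalue k * t) * coeffPair k f f) (Ioi 0) := by
    intro k
    by_cases hk : k = 0
    · subst hk; simp [h0]
    · exact (integrableOn_exp_neg_mul (by linarith [one_le_eigenvalue hk])).mul_const _
  have hval : ∀ k : Fin d → ℤ, ∫ t in Ioi (0 : ℝ), Real.exp (-eigenvalue k * t) *
      coeffPair k f f = coeffPair k f f / eigenvalue k := by
    intro k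
    by_cases hk : k = 0
    · subst hk; simp [h0]
    · have e : ∫ t in Ioi (0 : ℝ), Real.exp (-eigenvalue k * t) * coeffPair k f f =
        (∫ t in Ioi (0 : ℝ), Real.exp (-eigenvalue k * t)) * coeffPair k f f :=
        integral_mul_const _ _
      rw [e, integral_exp_neg_mul (by linarith [one_le_eigenvalue hk])]
      ring
  have key := hasSum_integral_of_summable_integral_norm (μ := volume.restrict (Ioi (0 : ℝ)))
    (F := fun (k : Fin d → ℤ) t => Real.exp (-eigenvalue k * t) * coeffPair k f f) hint ?_
  · convert! key using 1
    · ext k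
      exact (hval k).symm
    · refine setIntegral_congr_fun measurableSet_Ioi fun t ht => ?_
      rw [(hasSum_integral_mul_heatFlow hf hf ht).tsum_eq]
      refine integral_congr_ae (ae_of_all _ fun x => ?_)
      simp only [neutralIntegrand_of_pos ht, sub_mul, one_mul]
      rw [integral_sub ((isBoundedBy_heatKernel_sub ht x).mul hf).integrable hf.integrable, hmean,
        sub_zero]
      rfl
  · have e : ∀ k : Fin d → ℤ, ∫ t in Ioi (0 : ℝ),
        ‖Real.exp (-eigenvalue k * t) * coeffPair k f f‖ = coeffPair k f f / eigenvalue k := by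
      intro k
      rw [← hval k]
      refine integral_congr_ae (ae_of_all _ fun t => ?_)
      exact Real.norm_of_nonneg (mul_nonneg (Real.exp_pos _).le (coeffPair_self_nonneg k f))
    simp_rw [e]
    refine Summable.of_nonneg_of_le (fun k => ?_) (fun k => ?_) (summable_coeffPair_self hf)
    · exact div_nonneg (coeffPair_self_nonneg k f) (eigenvalue_nonneg k)
    · by_cases hk : k = 0
      · subst hk; simp [h0]
      · exact div_le_self (coeffPair_self_nonneg k f) (one_le_eigenvalue hk)

theorem longRangeEnergy_eq (G f : Space d → ℝ) :
    longRangeEnergy G f = 1 / 2 * ∫ x in unitCell d, f x * potential G f x := by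
  unfold longRangeEnergy potential
  simp_rw [mul_assoc, integral_const_mul]

/-- Let `f = g - κ² w` with `w` the screened potential of `g`. Mode by mode `(λ / (λ + κ²))² / λ = λ
/ (λ + κ²)²`, so the Coulomb form of `f` is the pairing of `f` with `w`, that is `∫ g w - κ² ∫ w²`.
The negative term later pays for displacing the wells. -/
theorem longRangeEnergy_neutral_sub_potential {κ : ℝ} (hκ : 0 < κ) {g : Space d → ℝ} {C : ℝ}
    (hg : IsBoundedBy g C) :
    longRangeEnergy greenNeutral (fun x => g x - κ ^ 2 * potential (greenScreened κ) g x) =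
      longRangeEnergy (greenScreened κ) g -
        κ ^ 2 / 2 * ∫ x in unitCell d, potential (greenScreened κ) g x ^ 2 := by
  have hv := isBoundedBy_potential hκ hg
  have hf := hg.sub (hv.const_mul (κ ^ 2))
  have hmean : ∫ x in unitCell d, (g x - κ ^ 2 * potential (greenScreened κ) g x) = 0 := by
    rw [integral_sub hg.integrable (hv.const_mul _).integrable, integral_const_mul,
      integral_potential_screened hκ hg, sub_self]
  have h1 := hasSum_integral_mul_potential_neutral hf hmean
  have h2 := hasSum_integral_mul_potential hκ hf hg
  have e : ∀ k, coeffPair k (fun x => g x - κ ^ 2 * potential (greenScreened κ) g x)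
      (fun x => g x - κ ^ 2 * potential (greenScreened κ) g x) / eigenvalue k =
      coeffPair k (fun x => g x - κ ^ 2 * potential (greenScreened κ) g x) g /
        (eigenvalue k + κ ^ 2) := by
    intro k
    have hpos : 0 < eigenvalue k + κ ^ 2 := by have := eigenvalue_nonneg k; positivity
    rw [coeffPair_sub_potential hκ hg, coeffPair_comm k g]
    rw [coeffPair_sub_potential hκ hg]
    by_cases hk : eigenvalue k = 0
    · simp [hk]
    · field_simp
  simp_rw [e] at h1
  have h3 := h1.unique h2
  rw [longRangeEnergy_eq, longRangeEnergy_eq, h3]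
  have e2 : ∀ x, (g x - κ ^ 2 * potential (greenScreened κ) g x) * potential (greenScreened κ) g x =
      g x * potential (greenScreened κ) g x - κ ^ 2 * (potential (greenScreened κ) g x *
        potential (greenScreened κ) g x) := fun x => by ring
  simp_rw [e2]
  rw [integral_sub (hg.mul hv).integrable ((hv.mul hv).const_mul _).integrable,
    integral_const_mul]
  simp_rw [sq (potential _ _ _)]
  ring

end

/-! ### The double well near its minima and the regularized one-dimensional profile. -/

section
/-! ### The double-well potential near its wells -/

/-- Mean value inequality on the segment from zero. The constant is not divided by `n + 1`; three
applications give a Taylor remainder with an unspecified constant. -/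
theorem abs_le_mul_pow_succ_of_deriv {f f' : ℝ → ℝ} (hf : ∀ s, HasDerivAt f (f' s) s)
    (h0 : f 0 = 0) {A r : ℝ} (n : ℕ) (hA : 0 ≤ A) (h : ∀ s, |s| ≤ r → |f' s| ≤ A * |s| ^ n) :
    ∀ s, |s| ≤ r → |f s| ≤ A * |s| ^ (n + 1) := by
  intro s hs
  have hseg : ∀ x ∈ segment ℝ (0 : ℝ) s, ‖f' x‖ ≤ A * |s| ^ n := by
    intro x hx
    have hx' : |x| ≤ |s| := by
      obtain ⟨a, b, ha, hb, hab, rfl⟩ := hx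
      rw [smul_zero, zero_add, smul_eq_mul, abs_mul, abs_of_nonneg hb]
      exact mul_le_of_le_one_left (abs_nonneg s) (by linarith)
    refine (h x (hx'.trans hs)).trans ?_
    gcongr
  have := (convex_segment (𝕜 := ℝ) 0 s).norm_image_sub_le_of_norm_hasDerivWithin_le
    (fun x _ => (hf x).hasDerivWithinAt) hseg (left_mem_segment ℝ 0 s) (right_mem_segment ℝ 0 s)
  rw [h0, sub_zero, sub_zero, Real.norm_eq_abs, Real.norm_eq_abs] at this
  rw [pow_succ, ← mul_assoc]
  exact this

namespace IsDoubleWell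

variable {d : ℕ} {W : ℝ → ℝ}

theorem continuous (hW : IsDoubleWell d W) : Continuous W := hW.contDiff.continuous

theorem screening_pos (hW : IsDoubleWell d W) : 0 < screening W :=
  one_div_pos.2 (Real.sqrt_pos.2 hW.deriv2_pos)

theorem iteratedDeriv_two_one (hW : IsDoubleWell d W) :
    iteratedDeriv 2 W 1 = 1 / screening W ^ 2 := by
  have h := hW.deriv2_pos
  rw [screening, div_pow, Real.sq_sqrt h.le]
  field_simp

theorem apply_one (hW : IsDoubleWell d W) : W 1 = 0 := (hW.eq_zero_iff 1).2 (Or.inl rfl)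

/-- The third derivative is bounded on a compact interval and is integrated three times; `W 1 = 0`,
`deriv W 1 = 0` because the well is a minimum, and `W'' 1 = κ⁻²`. -/
theorem exists_taylor (hW : IsDoubleWell d W) : ∃ A, 0 < A ∧ ∀ s, |s| ≤ 1 →
    |W (1 + s) - s ^ 2 / (2 * screening W ^ 2)| ≤ A * |s| ^ 3 := by
  have hd : ∀ n : ℕ, n < 3 → ∀ s, HasDerivAt (fun s => iteratedDeriv n W (1 + s))
      (iteratedDeriv (n + 1) W (1 + s)) s := by
    intro n hn s
    have h1 : DifferentiableAt ℝ (iteratedDeriv n W) (1 + s) :=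
      (hW.contDiff.differentiable_iteratedDeriv n (by exact_mod_cast hn)) _
    have h2 := h1.hasDerivAt
    rw [← iteratedDeriv_succ] at h2
    simpa using h2.comp_const_add 1 s
  have hc : Continuous fun s => iteratedDeriv 3 W (1 + s) :=
    (hW.contDiff.continuous_iteratedDeriv 3 le_rfl).comp (continuous_const.add continuous_id)
  obtain ⟨A, hA⟩ := (isCompact_Icc (a := (-1 : ℝ)) (b := 1)).exists_bound_of_continuousOn
    hc.continuousOn
  have hA' : ∀ s, |s| ≤ 1 → |iteratedDeriv 3 W (1 + s)| ≤ (|A| + 1) * |s| ^ 0 := fun s hs => by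
    have := hA s (abs_le.mp hs)
    rw [pow_zero, mul_one]
    exact this.trans ((le_abs_self A).trans (by linarith))
  have hA0 : 0 ≤ |A| + 1 := by positivity
  have hW1 : deriv W 1 = 0 := by
    refine IsLocalMin.deriv_eq_zero (Filter.Eventually.of_forall fun s => ?_)
    rw [hW.apply_one]
    exact hW.nonneg s
  set c := iteratedDeriv 2 W 1 with hcdef
  have s2 := abs_le_mul_pow_succ_of_deriv (f := fun s => iteratedDeriv 2 W (1 + s) - c)
    (f' := fun s => iteratedDeriv 3 W (1 + s)) (fun s => (hd 2 (by norm_num) s).sub_const c)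
    (by simp [hcdef]) 0 hA0 hA'
  have s1 := abs_le_mul_pow_succ_of_deriv (f := fun s => iteratedDeriv 1 W (1 + s) - c * s)
    (f' := fun s => iteratedDeriv 2 W (1 + s) - c)
    (fun s => by
      have h2 := (hasDerivAt_id s).const_mul c
      rw [mul_one] at h2
      exact (hd 1 (by norm_num) s).sub h2)
    (by simp [iteratedDeriv_one, hW1]) 1 hA0 s2
  have s0 := abs_le_mul_pow_succ_of_deriv (f := fun s => W (1 + s) - c * s ^ 2 / 2)
    (f' := fun s => iteratedDeriv 1 W (1 + s) - c * s)
    (fun s => by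
      have h1 := hd 0 (by norm_num) s
      simp only [iteratedDeriv_zero] at h1
      have h2 := (((hasDerivAt_pow 2 s).const_mul c).div_const 2)
      convert! h1.sub h2 using 1
      simp; ring)
    (by simp [hW.apply_one]) 2 hA0 s1
  refine ⟨|A| + 1, by positivity, fun s hs => ?_⟩
  have := s0 s hs
  rw [hcdef, hW.iteratedDeriv_two_one] at this
  convert! this using 3
  ring

theorem exists_lipschitz (hW : IsDoubleWell d W) : ∃ B, 0 < B ∧ ∀ s h, |s| ≤ 1 → |h| ≤ 1 →
    W (s + h) ≤ W s + B * |h| := by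
  have hc : Continuous (deriv W) := hW.contDiff.continuous_deriv (by norm_num)
  obtain ⟨B, hB⟩ := (isCompact_Icc (a := (-2 : ℝ)) (b := 2)).exists_bound_of_continuousOn
    hc.continuousOn
  refine ⟨|B| + 1, by positivity, fun s h hs hh => ?_⟩
  rw [abs_le] at hs hh
  have := (convex_Icc (-2 : ℝ) 2).norm_image_sub_le_of_norm_deriv_le
    (fun x _ => hW.contDiff.differentiable (by norm_num) x) hB
    (x := s) (y := s + h) ⟨by linarith, by linarith⟩ ⟨by linarith, by linarith⟩
  rw [add_sub_cancel_left, Real.norm_eq_abs, Real.norm_eq_abs] at this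
  have h2 := (abs_le.mp this).2
  nlinarith [abs_nonneg h, le_abs_self B]

/-- Close to the well the quadratic Taylor term beats the cubic remainder; elsewhere on `[0, 1]` the
potential has a positive minimum by compactness. It controls the width of the profile. -/
theorem exists_quadratic_lower (hW : IsDoubleWell d W) : ∃ c, 0 < c ∧ ∀ s, 0 ≤ s → s ≤ 1 →
    c * (1 - s) ^ 2 ≤ W s := by
  obtain ⟨A, hA, hT⟩ := hW.exists_taylor
  have hκ := hW.screening_pos
  set a := 1 / (2 * screening W ^ 2) with ha
  have ha0 : 0 < a := by positivity
  -- Within distance `r` of the well the cubic remainder takes at most half of the quadratic term.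
  set r := min 1 (a / (2 * A)) with hr
  have hr0 : 0 < r := lt_min one_pos (by positivity)
  have hr1 : r ≤ 1 := min_le_left _ _
  obtain ⟨m, hm0, hm⟩ : ∃ m, 0 < m ∧ ∀ s ∈ Icc (0 : ℝ) (1 - r), m ≤ W s := by
    obtain ⟨x, hx, hmin⟩ := (isCompact_Icc (a := (0 : ℝ)) (b := 1 - r)).exists_isMinOn
      ⟨0, by constructor <;> linarith⟩ hW.continuous.continuousOn
    refine ⟨W x, lt_of_le_of_ne (hW.nonneg x) fun h0 => ?_, fun s hs => hmin hs⟩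
    rcases (hW.eq_zero_iff x).1 h0.symm with h | h <;> rw [h] at hx <;>
      linarith [hx.1, hx.2]
  refine ⟨min m (a / 2), lt_min hm0 (by positivity), fun s hs0 hs1 => ?_⟩
  by_cases hs : s ≤ 1 - r
  · calc min m (a / 2) * (1 - s) ^ 2 ≤ m * 1 := by
          gcongr
          · exact min_le_left _ _
          · nlinarith
      _ ≤ W s := by rw [mul_one]; exact hm s ⟨hs0, hs⟩
  · have h1 := hT (s - 1) (by rw [abs_le]; constructor <;> linarith)
    rw [add_sub_cancel, abs_sub_comm (s : ℝ) 1, abs_of_nonneg (by linarith : 0 ≤ 1 - s)] at h1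
    have h2 := (abs_le.mp h1).1
    have h3 : (s - 1) ^ 2 / (2 * screening W ^ 2) = a * (1 - s) ^ 2 := by rw [ha]; ring
    rw [h3] at h2
    have h4 : A * (1 - s) ≤ a / 2 := by
      have : 1 - s ≤ a / (2 * A) := by
        have := min_le_right 1 (a / (2 * A))
        linarith [not_le.mp hs]
      calc A * (1 - s) ≤ A * (a / (2 * A)) := by gcongr
        _ = a / 2 := by field_simp
    have h5 : A * (1 - s) ^ 3 ≤ a / 2 * (1 - s) ^ 2 := by
      calc A * (1 - s) ^ 3 = A * (1 - s) * (1 - s) ^ 2 := by ring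
        _ ≤ _ := by gcongr
    calc min m (a / 2) * (1 - s) ^ 2 ≤ a / 2 * (1 - s) ^ 2 := by
          gcongr; exact min_le_right _ _
      _ ≤ W s := by linarith

theorem integral_zero_one (hW : IsDoubleWell d W) :
    ∫ s in (0 : ℝ)..1, Real.sqrt (2 * W s) = 1 / 2 := by
  have hc : Continuous fun s => Real.sqrt (2 * W s) :=
    Real.continuous_sqrt.comp (continuous_const.mul hW.continuous)
  have h1 := intervalIntegral.integral_add_adjacent_intervals
    (hc.intervalIntegrable (μ := volume) (-1) 0) (hc.intervalIntegrable 0 1)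
  have h2 : ∫ s in (-1 : ℝ)..0, Real.sqrt (2 * W s) = ∫ s in (0 : ℝ)..1, Real.sqrt (2 * W s) := by
    have := intervalIntegral.integral_comp_neg (a := 0) (b := 1) fun s => Real.sqrt (2 * W s)
    simp only [hW.even, neg_zero] at this
    exact this.symm
  rw [hW.normalized, h2] at h1
  linarith

end IsDoubleWell

/-! ### The regularized optimal profile -/

/-- Truncation to `[-1, 1]`. -/
noncomputable def clamp (s : ℝ) : ℝ := max (-1) (min s 1)

theorem continuous_clamp : Continuous clamp := by unfold clamp; fun_prop

theorem abs_clamp_le (s : ℝ) : |clamp s| ≤ 1 :=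
  abs_le.2 ⟨le_max_left _ _, max_le (by norm_num) (min_le_right _ _)⟩

theorem clamp_of_abs_le {s : ℝ} (hs : |s| ≤ 1) : clamp s = s := by
  rw [abs_le] at hs
  rw [clamp, min_eq_left hs.2, max_eq_right hs.1]

theorem clamp_of_one_le {s : ℝ} (hs : 1 ≤ s) : clamp s = 1 := by
  rw [clamp, min_eq_right hs, max_eq_right (by norm_num)]

theorem clamp_neg (s : ℝ) : clamp (-s) = -clamp s := by
  unfold clamp
  rcases le_total s 1 with h | h <;> rcases le_total (-1) s with h' | h' <;>
    simp [min_def, max_def] <;> split_ifs <;> linarith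

theorem lipschitzWith_clamp : LipschitzWith 1 clamp :=
  (LipschitzWith.id.min_const 1).const_max (-1)

/-- A transition profile between the wells of `W`, of half-width `M`, with `deriv U = √(2(W(U)+τ))`
in the transition layer. -/
structure IsProfile (W U : ℝ → ℝ) (τ M : ℝ) : Prop where
  pos : 0 < M
  odd : ∀ y, U (-y) = -U y
  abs_le_one : ∀ y, |U y| ≤ 1
  eq_one : ∀ y, M ≤ y → U y = 1
  hasDerivAt : ∀ y, |y| < M → HasDerivAt U (Real.sqrt (2 * (W (U y) + τ))) y

/-- The equation `U' = √(2 (W U + τ))` is solved by inverting `Θ s = ∫₀ˢ 1 / √(2 (W + τ))`. Adding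
`τ` makes the profile reach the wells at the finite time `M = Θ 1`, at the price of a surplus
`√(2τ)` in the surface tension. The power bound on `M` is not sharp but suffices. -/
theorem exists_profile {d : ℕ} {W : ℝ → ℝ} (hW : IsDoubleWell d W) :
    ∃ C : ℝ, 0 < C ∧ ∀ τ : ℝ, 0 < τ → τ ≤ 1 → ∃ (U : ℝ → ℝ) (M : ℝ),
      IsProfile W U τ M ∧ (∃ L, LipschitzWith L U) ∧ M ≤ C * τ ^ (-(1 : ℝ) / 4) ∧
      ∫ y in (0 : ℝ)..M, 2 * (W (U y) + τ) ≤ 1 / 2 + Real.sqrt (2 * τ) := by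
  obtain ⟨c, hc0, hc⟩ := hW.exists_quadratic_lower
  obtain ⟨B, hB⟩ := (isCompact_Icc (a := (-1 : ℝ)) (b := 1)).exists_bound_of_continuousOn
    hW.continuous.continuousOn
  refine ⟨1 / Real.sqrt (2 * c) + 1, by positivity, fun τ hτ hτ1 => ?_⟩
  have hpos : ∀ s, 0 < 2 * (W (clamp s) + τ) := fun s => by linarith [hW.nonneg (clamp s)]
  -- Truncating the argument keeps `S` bounded and bounded away from zero on the whole line, so `Θ`
  -- is an increasing bijection of `ℝ` with a Lipschitz inverse.
  let S : ℝ → ℝ := fun s => Real.sqrt (2 * (W (clamp s) + τ))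
  have hS : ∀ s, 0 < S s := fun s => Real.sqrt_pos.2 (hpos s)
  have hSc : Continuous S := Real.continuous_sqrt.comp
    (continuous_const.mul ((hW.continuous.comp continuous_clamp).add continuous_const))
  have hSB : ∀ s, S s ≤ Real.sqrt (2 * (B + τ)) := fun s => by
    refine Real.sqrt_le_sqrt ?_
    have := hB (clamp s) (abs_le.1 (abs_clamp_le s))
    linarith [le_abs_self (W (clamp s)), Real.norm_eq_abs (W (clamp s))]
  let g : ℝ → ℝ := fun s => 1 / S s
  have hg : Continuous g := continuous_const.div hSc fun s => (hS s).ne'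
  have hg0 : ∀ s, 0 < g s := fun s => one_div_pos.2 (hS s)
  have hSneg : ∀ s, S (-s) = S s := fun s => by simp only [S, clamp_neg, hW.even]
  let Θ : ℝ → ℝ := fun s => ∫ r in (0 : ℝ)..s, g r
  have hΘ : ∀ s, HasDerivAt Θ (g s) s := fun s =>
    intervalIntegral.integral_hasDerivAt_right (hg.intervalIntegrable _ _)
      hg.aestronglyMeasurable.stronglyMeasurableAtFilter hg.continuousAt
  have hΘmono : StrictMono Θ := strictMono_of_hasDerivAt_pos hΘ hg0
  have hΘneg : ∀ s, Θ (-s) = -Θ s := by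
    intro s
    have := intervalIntegral.integral_comp_neg (a := 0) (b := s) g
    simp only [g, hSneg, neg_zero] at this
    change ∫ r in (0 : ℝ)..(-s), g r = -∫ r in (0 : ℝ)..s, g r
    rw [intervalIntegral.integral_symm, ← this]
  have hΘ0 : Θ 0 = 0 := intervalIntegral.integral_same
  set m := 1 / Real.sqrt (2 * (B + τ)) with hm
  have hBpos : 0 < Real.sqrt (2 * (B + τ)) := (hS 0).trans_le (hSB 0)
  have hm0 : 0 < m := one_div_pos.2 hBpos
  have hΘlow : ∀ s, 0 ≤ s → m * s ≤ Θ s := by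
    intro s hs
    have := intervalIntegral.integral_mono_on hs (by simp : IntervalIntegrable (fun _ => m) volume 0 s)
      (hg.intervalIntegrable 0 s) fun x _ => one_div_le_one_div_of_le (hS x) (hSB x)
    simpa [mul_comm] using this
  have htop : Tendsto Θ atTop atTop :=
    tendsto_atTop_mono' _ ((eventually_ge_atTop 0).mono hΘlow)
      (tendsto_id.const_mul_atTop hm0)
  have hbot : Tendsto Θ atBot atBot := by
    have h1 : Θ = fun s => -Θ (-s) := by ext s; rw [hΘneg, neg_neg]
    rw [h1]
    exact tendsto_neg_atTop_atBot.comp (htop.comp tendsto_neg_atBot_atTop)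
  have hΘcont : Continuous Θ := continuous_iff_continuousAt.2 fun s => (hΘ s).continuousAt
  have hsurj : Function.Surjective Θ := hΘcont.surjective htop hbot
  let e : ℝ ≃o ℝ := StrictMono.orderIsoOfSurjective Θ hΘmono hsurj
  have heΘ : ∀ s, e s = Θ s := fun s => rfl
  let V : ℝ → ℝ := e.symm
  have hVΘ : ∀ s, V (Θ s) = s := fun s => e.symm_apply_apply s
  have hΘV : ∀ y, Θ (V y) = y := fun y => e.apply_symm_apply y
  have hVc : Continuous V := e.symm.continuous
  have hVd : ∀ y, HasDerivAt V (S (V y)) y := by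
    intro y
    have := HasDerivAt.of_local_left_inverse (f := Θ) (g := V) (a := y) hVc.continuousAt
      (hΘ (V y)) (hg0 _).ne' (Eventually.of_forall hΘV)
    simpa [g] using this
  have hVneg : ∀ y, V (-y) = -V y := fun y => by
    apply hΘmono.injective
    rw [hΘV, hΘneg, hΘV]
  have hVmono : StrictMono V := e.symm.strictMono
  have hV0 : V 0 = 0 := by simpa [hΘ0] using hVΘ 0
  let M := Θ 1
  have hM0 : 0 < M := by rw [← hΘ0]; exact hΘmono one_pos
  have hVM : V M = 1 := hVΘ 1
  have hVlt : ∀ y, |y| < M → |V y| < 1 := by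
    intro y hy
    rw [abs_lt] at hy ⊢
    rw [← hVM, ← hVneg]
    exact ⟨hVmono hy.1, hVmono hy.2⟩
  have hUV : ∀ y, |y| ≤ M → clamp (V y) = V y := by
    intro y hy
    refine clamp_of_abs_le ?_
    rw [abs_le] at hy ⊢
    rw [← hVM, ← hVneg]
    exact ⟨hVmono.monotone hy.1, hVmono.monotone hy.2⟩
  refine ⟨fun y => clamp (V y), M, ⟨hM0, fun y => ?_, fun y => abs_clamp_le _, fun y hy => ?_,
    fun y hy => ?_⟩, ?_, ?_, ?_⟩
  · rw [hVneg, clamp_neg]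
  · exact clamp_of_one_le (hVM ▸ hVmono.monotone hy)
  · refine (hVd y).congr_of_eventuallyEq ?_
    filter_upwards [(continuous_abs.tendsto y).eventually (Iio_mem_nhds hy)] with z hz
    exact hUV z (le_of_lt hz)
  · refine ⟨_, lipschitzWith_clamp.comp
      (lipschitzWith_of_nnnorm_deriv_le (C := (Real.sqrt (2 * (B + τ))).toNNReal)
        (fun y => (hVd y).differentiableAt) fun y => ?_)⟩
    rw [(hVd y).deriv, ← norm_toNNReal]
    refine Real.toNNReal_le_toNNReal ?_
    rw [Real.norm_of_nonneg (hS _).le]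
    exact hSB _
  · change ∫ r in (0 : ℝ)..1, g r ≤ _
    -- Splitting at distance `θ` from the well: further away `S` is at least `√(2c) θ` by the
    -- quadratic bound, closer in it is at least `√τ = θ²` on an interval of length `θ`. Each part
    -- contributes a multiple of `1 / θ`.
    set θ := τ ^ ((1 : ℝ) / 4) with hθ
    have hθ0 : 0 < θ := Real.rpow_pos_of_pos hτ _
    have hθ1 : θ ≤ 1 := Real.rpow_le_one hτ.le hτ1 (by norm_num)
    have hθinv : τ ^ (-(1 : ℝ) / 4) = 1 / θ := by
      rw [hθ, neg_div, Real.rpow_neg hτ.le, one_div (τ ^ _)]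
    have hθτ : θ ^ 4 = τ := by
      rw [hθ, ← Real.rpow_natCast, ← Real.rpow_mul hτ.le]; norm_num
    rw [← intervalIntegral.integral_add_adjacent_intervals
      (hg.intervalIntegrable 0 (1 - θ)) (hg.intervalIntegrable (1 - θ) 1)]
    have hcl : ∀ x, 0 ≤ x → x ≤ 1 → clamp x = x := fun x h0 h1 =>
      clamp_of_abs_le (abs_le.2 ⟨by linarith, h1⟩)
    have h1 : ∫ r in (0 : ℝ)..(1 - θ), g r ≤ 1 / Real.sqrt (2 * c) * (1 / θ) := by
      have h2 := intervalIntegral.integral_mono_on (a := 0) (b := 1 - θ) (by linarith)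
        (hg.intervalIntegrable 0 (1 - θ))
        (by simp : IntervalIntegrable (fun _ => 1 / Real.sqrt (2 * c) * (1 / θ)) volume 0 (1 - θ))
        fun x hx => ?_
      · refine h2.trans ?_
        rw [intervalIntegral.integral_const, smul_eq_mul]
        have : 0 < 1 / Real.sqrt (2 * c) * (1 / θ) := by positivity
        nlinarith
      · have : Real.sqrt (2 * c) * θ ≤ S x := by
          simp only [S]
          rw [hcl x hx.1 (by linarith [hx.2]), ← Real.sqrt_sq hθ0.le,
            ← Real.sqrt_mul (by positivity)]
          refine Real.sqrt_le_sqrt ?_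
          have h3 := hc x hx.1 (by linarith [hx.2])
          have h4 : c * θ ^ 2 ≤ c * (1 - x) ^ 2 := by
            gcongr; linarith [hx.2]
          linarith
        calc g x ≤ 1 / (Real.sqrt (2 * c) * θ) := one_div_le_one_div_of_le (by positivity) this
          _ = _ := by rw [one_div_mul_one_div]
    have h5 : ∫ r in (1 - θ)..1, g r ≤ 1 / θ := by
      have h2 := intervalIntegral.integral_mono_on (a := 1 - θ) (b := 1) (by linarith)
        (hg.intervalIntegrable (1 - θ) 1)
        (by simp : IntervalIntegrable (fun _ => 1 / θ ^ 2) volume (1 - θ) 1)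
        fun x hx => ?_
      · refine h2.trans (le_of_eq ?_)
        rw [intervalIntegral.integral_const, smul_eq_mul]
        field_simp
        ring
      · have : θ ^ 2 ≤ S x := by
          simp only [S]
          rw [← Real.sqrt_sq (by positivity : 0 ≤ θ ^ 2)]
          refine Real.sqrt_le_sqrt ?_
          rw [← pow_mul, hθτ]
          linarith [hW.nonneg (clamp x)]
        exact one_div_le_one_div_of_le (by positivity) this
    rw [hθinv]
    linarith
  -- The integrand is the square of the derivative of `V`; the substitution `s = V y` leaves `∫₀¹
  -- S`, compared with `√(2W)` by subadditivity of the square root.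
  · have h1 : ∫ y in (0 : ℝ)..M, 2 * (W (clamp (V y)) + τ) =
        ∫ y in (0 : ℝ)..M, (S ∘ V) y * S (V y) := by
      refine intervalIntegral.integral_congr fun y _ => ?_
      exact (Real.mul_self_sqrt (hpos _).le).symm
    rw [h1, intervalIntegral.integral_comp_mul_deriv (fun y _ => hVd y)
      (hSc.comp hVc).continuousOn hSc, hV0, hVM, ← hW.integral_zero_one]
    have hc1 : Continuous fun s => Real.sqrt (2 * W s) :=
      Real.continuous_sqrt.comp (continuous_const.mul hW.continuous)
    have h2 := intervalIntegral.integral_mono_on (a := 0) (b := 1) zero_le_one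
      (hSc.intervalIntegrable 0 1)
      (show IntervalIntegrable (fun s => Real.sqrt (2 * W s) + Real.sqrt (2 * τ)) volume 0 1 from
        (hc1.add continuous_const).intervalIntegrable (μ := volume) 0 1)
      fun x hx => ?_
    · rw [intervalIntegral.integral_add (hc1.intervalIntegrable 0 1) (by simp)] at h2
      simpa using h2
    · simp only [S]
      rw [clamp_of_abs_le (abs_le.2 ⟨by linarith [hx.1], hx.2⟩), mul_add]
      have hWx : 0 ≤ 2 * W x := by linarith [hW.nonneg x]
      refine Real.sqrt_le_iff.2 ⟨by positivity, ?_⟩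
      nlinarith [Real.sq_sqrt hWx, Real.sq_sqrt (by positivity : 0 ≤ 2 * τ),
        mul_nonneg (Real.sqrt_nonneg (2 * W x)) (Real.sqrt_nonneg (2 * τ))]

end

/-! ### The jump set, its two sides, the signed distance and the unit normal. -/

section
open Metric

variable {d : ℕ}

/-! ### The two sides of the jump set -/

/-- The points near which `u = 1` almost everywhere. -/
def plusSide (u : Space d → ℝ) : Set (Space d) :=
  {x | ∃ r > 0, volume (ball x r ∩ {y | u y = -1}) = 0}

/-- The points near which `u = -1` almost everywhere. -/
def minusSide (u : Space d → ℝ) : Set (Space d) :=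
  {x | ∃ r > 0, volume (ball x r ∩ {y | u y = 1}) = 0}

theorem isOpen_setOf_exists_ball_null (S : Set (Space d)) :
    IsOpen {x | ∃ r > 0, volume (ball x r ∩ S) = 0} := by
  rw [Metric.isOpen_iff]
  rintro x ⟨r, hr, h⟩
  refine ⟨r / 2, by positivity, fun y hy => ⟨r / 2, by positivity, measure_mono_null ?_ h⟩⟩
  refine inter_subset_inter_left _ (ball_subset_ball' ?_)
  rw [mem_ball] at hy
  linarith

theorem isOpen_plusSide (u : Space d → ℝ) : IsOpen (plusSide u) :=
  isOpen_setOf_exists_ball_null _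

theorem isOpen_minusSide (u : Space d → ℝ) : IsOpen (minusSide u) :=
  isOpen_setOf_exists_ball_null _

theorem notMem_jumpSet_iff {u : Space d → ℝ} {x : Space d} :
    x ∉ jumpSet u ↔ x ∈ plusSide u ∨ x ∈ minusSide u := by
  simp only [jumpSet, plusSide, minusSide, mem_ofPred_eq, not_forall, not_and_or, not_lt,
    nonpos_iff_eq_zero, exists_prop]
  constructor
  · rintro ⟨r, hr, h | h⟩
    · exact Or.inr ⟨r, hr, h⟩
    · exact Or.inl ⟨r, hr, h⟩
  · rintro (⟨r, hr, h⟩ | ⟨r, hr, h⟩)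
    · exact ⟨r, hr, Or.inr h⟩
    · exact ⟨r, hr, Or.inl h⟩

theorem compl_jumpSet (u : Space d → ℝ) : (jumpSet u)ᶜ = plusSide u ∪ minusSide u := by
  ext x; exact notMem_jumpSet_iff

theorem isClosed_jumpSet (u : Space d → ℝ) : IsClosed (jumpSet u) := by
  rw [← isOpen_compl_iff, compl_jumpSet]
  exact (isOpen_plusSide u).union (isOpen_minusSide u)

theorem disjoint_sides {u : Space d → ℝ} (hu : ∀ x, u x = 1 ∨ u x = -1) :
    Disjoint (plusSide u) (minusSide u) := by
  rw [Set.disjoint_left]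
  rintro x ⟨r, hr, h⟩ ⟨s, hs, h'⟩
  have h1 : ball x (min r s) ⊆ (ball x r ∩ {y | u y = -1}) ∪ (ball x s ∩ {y | u y = 1}) := by
    intro y hy
    rcases hu y with h | h
    · exact Or.inr ⟨ball_subset_ball (min_le_right _ _) hy, h⟩
    · exact Or.inl ⟨ball_subset_ball (min_le_left _ _) hy, h⟩
  have h2 := measure_mono_null h1 (measure_union_null h h')
  exact (measure_ball_pos volume x (lt_min hr hs)).ne' h2

theorem ae_eq_of_locally {S Q : Set (Space d)}
    (h : ∀ x ∈ S, ∃ r > 0, volume (ball x r ∩ Q) = 0) : ∀ᵐ x, x ∈ S → x ∉ Q := by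
  have h1 : volume (S ∩ Q) = 0 := by
    refine measure_null_of_locally_null _ fun x hx => ?_
    obtain ⟨r, hr, hr0⟩ := h x hx.1
    refine ⟨ball x r ∩ Q, ?_, hr0⟩
    exact inter_mem (mem_nhdsWithin_of_mem_nhds (ball_mem_nhds x hr))
      (mem_of_superset self_mem_nhdsWithin inter_subset_right)
  rw [ae_iff]
  refine measure_mono_null (fun x hx => ?_) h1
  simp only [mem_ofPred_eq, Classical.not_imp, not_not] at hx
  exact hx

theorem ae_plusSide {u : Space d → ℝ} (hu : ∀ x, u x = 1 ∨ u x = -1) :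
    ∀ᵐ x, x ∈ plusSide u → u x = 1 :=
  (ae_eq_of_locally fun _ hx => hx).mono fun x hx h => (hu x).resolve_right (hx h)

theorem ae_minusSide {u : Space d → ℝ} (hu : ∀ x, u x = 1 ∨ u x = -1) :
    ∀ᵐ x, x ∈ minusSide u → u x = -1 :=
  (ae_eq_of_locally fun _ hx => hx).mono fun x hx h => (hu x).resolve_left (hx h)

theorem volume_ball_inter_add {S : Set (Space d)} {v : Space d} (hS : ∀ y, y + v ∈ S ↔ y ∈ S)
    (x : Space d) (r : ℝ) : volume (ball (x + v) r ∩ S) = volume (ball x r ∩ S) := by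
  have h : ball x r ∩ S = (fun y => y + v) ⁻¹' (ball (x + v) r ∩ S) := by
    ext y
    simp only [mem_inter_iff, mem_preimage, mem_ball, dist_add_right, hS]
  rw [h, measure_preimage_add_right]

theorem add_latticePoint_mem_plusSide {u : Space d → ℝ} (hp : IsPeriodic u) (n : Fin d → ℤ)
    (x : Space d) : x + latticePoint n ∈ plusSide u ↔ x ∈ plusSide u := by
  simp only [plusSide, mem_ofPred_eq]
  simp_rw [volume_ball_inter_add (S := {y | u y = -1}) (v := latticePoint n)
    (fun y => by simp [hp n y])]

theorem add_latticePoint_mem_minusSide {u : Space d → ℝ} (hp : IsPeriodic u) (n : Fin d → ℤ)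
    (x : Space d) : x + latticePoint n ∈ minusSide u ↔ x ∈ minusSide u := by
  simp only [minusSide, mem_ofPred_eq]
  simp_rw [volume_ball_inter_add (S := {y | u y = 1}) (v := latticePoint n)
    (fun y => by simp [hp n y])]

theorem add_latticePoint_mem_jumpSet {u : Space d → ℝ} (hp : IsPeriodic u) (n : Fin d → ℤ)
    (x : Space d) : x + latticePoint n ∈ jumpSet u ↔ x ∈ jumpSet u := by
  rw [← not_iff_not, notMem_jumpSet_iff, notMem_jumpSet_iff, add_latticePoint_mem_plusSide hp,
    add_latticePoint_mem_minusSide hp]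

/-- The two sides are open, disjoint, and cover the complement of the jump set. -/
theorem subset_plusSide {u : Space d → ℝ} (hu : ∀ x, u x = 1 ∨ u x = -1) {S : Set (Space d)}
    (hS : IsPreconnected S) (hd : ∀ x ∈ S, x ∉ jumpSet u) {x : Space d} (hx : x ∈ S)
    (hxp : x ∈ plusSide u) : S ⊆ plusSide u :=
  hS.subset_left_of_subset_union (isOpen_plusSide u) (isOpen_minusSide u) (disjoint_sides hu)
    (fun y hy => notMem_jumpSet_iff.1 (hd y hy)) ⟨x, hx, hxp⟩

theorem subset_minusSide {u : Space d → ℝ} (hu : ∀ x, u x = 1 ∨ u x = -1) {S : Set (Space d)}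
    (hS : IsPreconnected S) (hd : ∀ x ∈ S, x ∉ jumpSet u) {x : Space d} (hx : x ∈ S)
    (hxp : x ∈ minusSide u) : S ⊆ minusSide u :=
  hS.subset_right_of_subset_union (isOpen_plusSide u) (isOpen_minusSide u) (disjoint_sides hu)
    (fun y hy => notMem_jumpSet_iff.1 (hd y hy)) ⟨x, hx, hxp⟩

/-! ### The signed distance to the jump set -/

/-- The distance to the jump set. -/
noncomputable def jumpDist (u : Space d → ℝ) (x : Space d) : ℝ := infDist x (jumpSet u)

open Classical in
/-- The sign of the side of the jump set. -/
noncomputable def sideSign (u : Space d → ℝ) (x : Space d) : ℝ := if x ∈ plusSide u then 1 else -1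

/-- The signed distance to the jump set. -/
noncomputable def signedDist (u : Space d → ℝ) (x : Space d) : ℝ := sideSign u x * jumpDist u x

theorem abs_sideSign (u : Space d → ℝ) (x : Space d) : |sideSign u x| = 1 := by
  unfold sideSign; split_ifs <;> simp

theorem sideSign_plus {u : Space d → ℝ} {x : Space d} (hx : x ∈ plusSide u) :
    sideSign u x = 1 := if_pos hx

theorem sideSign_minus {u : Space d → ℝ} (hu : ∀ x, u x = 1 ∨ u x = -1) {x : Space d}
    (hx : x ∈ minusSide u) : sideSign u x = -1 :=
  if_neg fun h => Set.disjoint_left.1 (disjoint_sides hu) h hx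

theorem jumpDist_nonneg (u : Space d → ℝ) (x : Space d) : 0 ≤ jumpDist u x := infDist_nonneg

theorem abs_signedDist (u : Space d → ℝ) (x : Space d) : |signedDist u x| = jumpDist u x := by
  rw [signedDist, abs_mul, abs_sideSign, one_mul, abs_of_nonneg (jumpDist_nonneg u x)]

theorem lipschitzWith_jumpDist (u : Space d → ℝ) : LipschitzWith 1 (jumpDist u) :=
  lipschitz_infDist_pt _

theorem jumpDist_pos {u : Space d → ℝ} (hne : (jumpSet u).Nonempty) {x : Space d} :
    0 < jumpDist u x ↔ x ∉ jumpSet u := by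
  rw [jumpDist, ← (isClosed_jumpSet u).notMem_iff_infDist_pos hne]

theorem jumpDist_eq_zero {u : Space d → ℝ} {x : Space d} (hx : x ∈ jumpSet u) :
    jumpDist u x = 0 := infDist_zero_of_mem hx

theorem isPeriodic_jumpDist {u : Space d → ℝ} (hp : IsPeriodic u) : IsPeriodic (jumpDist u) := by
  intro n x
  have h : jumpSet u = (fun y => y + latticePoint n) '' jumpSet u := by
    ext y
    constructor
    · intro hy
      refine ⟨y - latticePoint n, ?_, by simp⟩
      rw [← add_latticePoint_mem_jumpSet hp n]
      simpa using hy
    · rintro ⟨z, hz, rfl⟩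
      exact (add_latticePoint_mem_jumpSet hp n z).2 hz
  unfold jumpDist
  conv_lhs => rw [h]
  exact infDist_image (Φ := fun y => y + latticePoint n) (isometry_add_right _)

theorem isPeriodic_sideSign {u : Space d → ℝ} (hp : IsPeriodic u) : IsPeriodic (sideSign u) := by
  intro n x
  have h := add_latticePoint_mem_plusSide hp n x
  by_cases hx : x ∈ plusSide u
  · rw [sideSign, sideSign, if_pos hx, if_pos (h.2 hx)]
  · rw [sideSign, sideSign, if_neg hx, if_neg (mt h.1 hx)]

theorem isPeriodic_signedDist {u : Space d → ℝ} (hp : IsPeriodic u) :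
    IsPeriodic (signedDist u) := by
  intro n x
  rw [signedDist, isPeriodic_sideSign hp, isPeriodic_jumpDist hp, signedDist]

/-- The segment between points on opposite sides is connected, so it meets the jump set. This makes
the signed distance 1-Lipschitz across the interface. -/
theorem jumpDist_add_le {u : Space d → ℝ} (hu : ∀ x, u x = 1 ∨ u x = -1) {x y : Space d}
    (hx : x ∈ plusSide u) (hy : y ∈ minusSide u) : jumpDist u x + jumpDist u y ≤ dist x y := by
  obtain ⟨z, hz, hzj⟩ : ∃ z ∈ segment ℝ x y, z ∈ jumpSet u := by
    by_contra! h
    have := subset_plusSide hu (convex_segment (𝕜 := ℝ) x y).isPreconnected h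
      (left_mem_segment ℝ x y) hx (right_mem_segment ℝ x y)
    exact Set.disjoint_left.1 (disjoint_sides hu) this hy
  rw [← dist_add_dist_of_mem_segment hz, dist_comm z y]
  exact add_le_add (infDist_le_dist_of_mem hzj) (infDist_le_dist_of_mem hzj)

theorem lipschitzWith_signedDist {u : Space d → ℝ} (hu : ∀ x, u x = 1 ∨ u x = -1) :
    LipschitzWith 1 (signedDist u) := by
  have key : ∀ x y, signedDist u x - signedDist u y ≤ dist x y := by
    intro x y
    have h0 := jumpDist_nonneg u x
    have h0' := jumpDist_nonneg u y
    have h1 : |jumpDist u x - jumpDist u y| ≤ dist x y := by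
      simpa [Real.dist_eq] using (lipschitzWith_jumpDist u).dist_le_mul x y
    rw [abs_le] at h1
    unfold signedDist
    by_cases hx : x ∈ plusSide u
    · rw [sideSign_plus hx]
      by_cases hy : y ∈ plusSide u
      · rw [sideSign_plus hy]; linarith
      · by_cases hyj : y ∈ jumpSet u
        · rw [jumpDist_eq_zero hyj] at h1 ⊢; linarith
        · have hy' := (notMem_jumpSet_iff.1 hyj).resolve_left hy
          rw [sideSign_minus hu hy']
          linarith [jumpDist_add_le hu hx hy']
    · have hsx : sideSign u x = -1 := if_neg hx
      rw [hsx]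
      rcases (by unfold sideSign; split_ifs <;> simp : sideSign u y = 1 ∨ sideSign u y = -1)
        with h | h <;> rw [h] <;> linarith [dist_nonneg (x := x) (y := y)]
  refine LipschitzWith.of_le_add fun x y => ?_
  linarith [key x y]

theorem exists_nearest {u : Space d → ℝ} (hne : (jumpSet u).Nonempty) (x : Space d) :
    ∃ p ∈ jumpSet u, dist x p = jumpDist u x := by
  obtain ⟨p, hp, h⟩ := (isClosed_jumpSet u).exists_infDist_eq_dist hne x
  exact ⟨p, hp, h.symm⟩

theorem notMem_jumpSet_of_mem_ball {u : Space d → ℝ} {x y : Space d}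
    (hy : y ∈ ball x (jumpDist u x)) : y ∉ jumpSet u := fun h => by
  have := infDist_le_dist_of_mem (x := x) h
  rw [mem_ball, dist_comm] at hy
  exact absurd this (not_le.2 hy)

theorem ball_subset_plusSide {u : Space d → ℝ} (hu : ∀ x, u x = 1 ∨ u x = -1)
    {x : Space d} (hx : x ∈ plusSide u) : ball x (jumpDist u x) ⊆ plusSide u := by
  rcases (jumpDist_nonneg u x).eq_or_lt with h | h
  · rw [← h, ball_zero]; exact empty_subset _
  · exact subset_plusSide hu (convex_ball x _).isPreconnected
      (fun y hy => notMem_jumpSet_of_mem_ball hy) (mem_ball_self h) hx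

theorem ball_subset_minusSide {u : Space d → ℝ} (hu : ∀ x, u x = 1 ∨ u x = -1)
    {x : Space d} (hx : x ∈ minusSide u) : ball x (jumpDist u x) ⊆ minusSide u := by
  rcases (jumpDist_nonneg u x).eq_or_lt with h | h
  · rw [← h, ball_zero]; exact empty_subset _
  · exact subset_minusSide hu (convex_ball x _).isPreconnected
      (fun y hy => notMem_jumpSet_of_mem_ball hy) (mem_ball_self h) hx

/-! ### Defining functions and the unit normal -/

/-- The normalized gradient. -/
noncomputable def unitGrad (f : Space d → ℝ) (x : Space d) : Space d :=
  ‖gradient f x‖⁻¹ • gradient f x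

theorem inner_gradient (f : Space d → ℝ) (x v : Space d) :
    inner ℝ (gradient f x) v = fderiv ℝ f x v := by
  rw [gradient, InnerProductSpace.toDual_symm_apply]

theorem norm_gradient (f : Space d → ℝ) (x : Space d) : ‖gradient f x‖ = ‖fderiv ℝ f x‖ := by
  rw [gradient, LinearIsometryEquiv.norm_map]

theorem gradient_ne_zero {f : Space d → ℝ} {x : Space d} (h : fderiv ℝ f x ≠ 0) :
    gradient f x ≠ 0 := by
  rw [← norm_ne_zero_iff, norm_gradient, norm_ne_zero_iff]; exact h

theorem norm_unitGrad {f : Space d → ℝ} {x : Space d} (h : fderiv ℝ f x ≠ 0) :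
    ‖unitGrad f x‖ = 1 := norm_smul_inv_norm (gradient_ne_zero h)

/-- If `b` had a component `w` orthogonal to `a`, a vector with positive `a`-part and a large
multiple of `-w` would violate the inclusion of half-spaces. Normals are identified this way, by
comparing the directions that enter a given side. -/
theorem normalize_eq_of_halfspace {a b : Space d} (ha : a ≠ 0) (hb : b ≠ 0)
    (h : ∀ v, 0 < inner ℝ a v → 0 ≤ inner ℝ b v) : ‖b‖⁻¹ • b = ‖a‖⁻¹ • a := by
  have ha2 : 0 < ‖a‖ ^ 2 := by positivity
  set c := inner ℝ b a / ‖a‖ ^ 2 with hc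
  set w := b - c • a with hw
  have haw : inner ℝ a w = 0 := by
    rw [hw, inner_sub_right, inner_smul_right, real_inner_self_eq_norm_sq, hc, real_inner_comm]
    field_simp
    ring
  have hbw : inner ℝ b w = ‖w‖ ^ 2 := by
    have : b = w + c • a := by rw [hw]; abel
    rw [this, inner_add_left, inner_smul_left, haw, real_inner_self_eq_norm_sq]
    simp
  have hba : 0 ≤ inner ℝ b a := h a (by rw [real_inner_self_eq_norm_sq]; exact ha2)
  have hw0 : w = 0 := by
    by_contra hne
    have hw2 : 0 < ‖w‖ ^ 2 := by positivity
    -- The coefficients are such that the inner product of this vector with `b` is exactly `-‖w‖²`.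
    have h1 := h (‖w‖ ^ 2 • a - (inner ℝ b a + 1) • w) (by
      rw [inner_sub_right, inner_smul_right, inner_smul_right, haw, real_inner_self_eq_norm_sq]
      simp only [mul_zero, sub_zero]
      positivity)
    rw [inner_sub_right, inner_smul_right, inner_smul_right, hbw] at h1
    nlinarith
  have hbca : b = c • a := by rw [hw, sub_eq_zero] at hw0; exact hw0
  have hc0 : 0 < c := by
    refine lt_of_le_of_ne (div_nonneg hba ha2.le) fun h0 => hb ?_
    rw [hbca, ← h0, zero_smul]
  rw [hbca, norm_smul, Real.norm_of_nonneg hc0.le, smul_smul]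
  congr 1
  field_simp

namespace IsDefiningFunction

variable {u f g : Space d → ℝ} {p : Space d}

theorem differentiableAt (h : IsDefiningFunction u p f) : DifferentiableAt ℝ f p :=
  h.contDiffAt.differentiableAt (by norm_num)

theorem eventually_contDiffAt (h : IsDefiningFunction u p f) :
    ∀ᶠ y in 𝓝 p, ContDiffAt ℝ 2 f y := h.contDiffAt.eventually (by simp)

theorem eventually_side (h : IsDefiningFunction u p f) :
    ∀ᶠ y in 𝓝 p, (0 < f y → y ∈ plusSide u) ∧ (f y < 0 → y ∈ minusSide u) := by
  obtain ⟨r, hr, hs⟩ := h.sign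
  filter_upwards [h.eventually_contDiffAt, ball_mem_nhds p hr] with y hy hyr
  constructor
  · intro hpos
    obtain ⟨s, hs0, hsub⟩ := Metric.mem_nhds_iff.1
      ((hy.continuousAt.eventually (lt_mem_nhds hpos)).and (isOpen_ball.mem_nhds hyr))
    refine ⟨s, hs0, ?_⟩
    refine measure_mono_null (fun z hz => ?_) (ae_iff.1 hs)
    simp only [mem_ofPred_eq, Classical.not_imp]
    refine ⟨(hsub hz.1).2, fun h' => ?_⟩
    have h1 := h'.1 (hsub hz.1).1
    have h2 : u z = -1 := hz.2
    rw [h1] at h2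
    norm_num at h2
  · intro hneg
    obtain ⟨s, hs0, hsub⟩ := Metric.mem_nhds_iff.1
      ((hy.continuousAt.eventually (gt_mem_nhds hneg)).and (isOpen_ball.mem_nhds hyr))
    refine ⟨s, hs0, ?_⟩
    refine measure_mono_null (fun z hz => ?_) (ae_iff.1 hs)
    simp only [mem_ofPred_eq, Classical.not_imp]
    refine ⟨(hsub hz.1).2, fun h' => ?_⟩
    have h1 := h'.2 (hsub hz.1).1
    have h2 : u z = 1 := hz.2
    rw [h1] at h2
    norm_num at h2

theorem eventually_fderiv_ne_zero (h : IsDefiningFunction u p f) :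
    ∀ᶠ y in 𝓝 p, fderiv ℝ f y ≠ 0 :=
  (h.contDiffAt.fderiv_right (m := 1) (by norm_num)).continuousAt.eventually_ne h.fderiv_ne_zero

theorem eventually_eq_zero (h : IsDefiningFunction u p f) :
    ∀ᶠ y in 𝓝 p, y ∈ jumpSet u → f y = 0 := by
  filter_upwards [h.eventually_side] with y hy hyj
  by_contra hne
  rcases lt_or_gt_of_ne hne with h' | h'
  · exact notMem_jumpSet_iff.2 (Or.inr (hy.2 h')) hyj
  · exact notMem_jumpSet_iff.2 (Or.inl (hy.1 h')) hyj

theorem eventually_isDefiningFunction (h : IsDefiningFunction u p f) :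
    ∀ᶠ y in 𝓝 p, y ∈ jumpSet u → IsDefiningFunction u y f := by
  obtain ⟨r, hr, hs⟩ := h.sign
  filter_upwards [h.eventually_contDiffAt, h.eventually_fderiv_ne_zero, h.eventually_eq_zero,
    ball_mem_nhds p hr] with y h1 h2 h3 h4 hy
  refine ⟨h1, h3 hy, h2, r - dist y p, by rw [mem_ball] at h4; linarith, ?_⟩
  filter_upwards [hs] with z hz hzb
  refine hz (ball_subset_ball' ?_ hzb)
  linarith

theorem eventually_pos_of_fderiv_pos (h : IsDefiningFunction u p f) {v : Space d}
    (hv : 0 < fderiv ℝ f p v) : ∀ᶠ t in 𝓝[>] (0 : ℝ), p + t • v ∈ plusSide u := by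
  have hd : HasDerivAt (fun t : ℝ => f (p + t • v)) (fderiv ℝ f p v) 0 := by
    have h1 : HasDerivAt (fun t : ℝ => p + t • v) v 0 := by
      simpa using ((hasDerivAt_id (0 : ℝ)).smul_const v).const_add p
    have h2 : HasFDerivAt f (fderiv ℝ f p) (p + (0 : ℝ) • v) := by
      simpa using h.differentiableAt.hasFDerivAt
    exact h2.comp_hasDerivAt 0 h1
  have hpos : ∀ᶠ t in 𝓝[>] (0 : ℝ), 0 < f (p + t • v) := by
    have h3 := hd.tendsto_slope_zero_right
    filter_upwards [h3.eventually (lt_mem_nhds hv), self_mem_nhdsWithin] with t ht ht0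
    have ht0' : (0 : ℝ) < t := ht0
    simp only [zero_add, zero_smul, add_zero, h.eq_zero, sub_zero, smul_eq_mul] at ht
    exact (mul_pos_iff_of_pos_left (inv_pos.2 ht0')).1 ht
  have hcont : Tendsto (fun t : ℝ => p + t • v) (𝓝[>] 0) (𝓝 p) := by
    refine Tendsto.mono_left ?_ nhdsWithin_le_nhds
    have : Continuous fun t : ℝ => p + t • v := by fun_prop
    simpa using this.tendsto 0
  filter_upwards [hpos, hcont.eventually h.eventually_side] with t h1 h2 using h2.1 h1

theorem eventually_neg_of_fderiv_neg (h : IsDefiningFunction u p f) {v : Space d}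
    (hv : fderiv ℝ f p v < 0) : ∀ᶠ t in 𝓝[>] (0 : ℝ), p + t • v ∈ minusSide u := by
  have hd : HasDerivAt (fun t : ℝ => f (p + t • v)) (fderiv ℝ f p v) 0 := by
    have h1 : HasDerivAt (fun t : ℝ => p + t • v) v 0 := by
      simpa using ((hasDerivAt_id (0 : ℝ)).smul_const v).const_add p
    have h2 : HasFDerivAt f (fderiv ℝ f p) (p + (0 : ℝ) • v) := by
      simpa using h.differentiableAt.hasFDerivAt
    exact h2.comp_hasDerivAt 0 h1
  have hpos : ∀ᶠ t in 𝓝[>] (0 : ℝ), f (p + t • v) < 0 := by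
    have h3 := hd.tendsto_slope_zero_right
    filter_upwards [h3.eventually (gt_mem_nhds hv), self_mem_nhdsWithin] with t ht ht0
    have ht0' : (0 : ℝ) < t := ht0
    simp only [zero_add, zero_smul, add_zero, h.eq_zero, sub_zero, smul_eq_mul] at ht
    exact (pos_iff_neg_of_mul_neg ht).1 (inv_pos.2 ht0')
  have hcont : Tendsto (fun t : ℝ => p + t • v) (𝓝[>] 0) (𝓝 p) := by
    refine Tendsto.mono_left ?_ nhdsWithin_le_nhds
    have : Continuous fun t : ℝ => p + t • v := by fun_prop
    simpa using this.tendsto 0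
  filter_upwards [hpos, hcont.eventually h.eventually_side] with t h1 h2 using h2.2 h1

/-- A direction that enters the plus side cannot have negative derivative, since it would then enter
the minus side. So the sides of `u` alone determine the normalized gradient, whatever the defining
function. -/
theorem unitGrad_eq_of_plus (hu : ∀ x, u x = 1 ∨ u x = -1) (h : IsDefiningFunction u p f)
    {a : Space d} (ha : a ≠ 0)
    (hside : ∀ v, 0 < inner ℝ a v → ∀ᶠ t in 𝓝[>] (0 : ℝ), p + t • v ∈ plusSide u) :
    unitGrad f p = ‖a‖⁻¹ • a := by
  refine normalize_eq_of_halfspace ha (gradient_ne_zero h.fderiv_ne_zero) fun v hv => ?_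
  rw [inner_gradient]
  by_contra! hneg
  obtain ⟨t, h1, h2⟩ := ((hside v hv).and (h.eventually_neg_of_fderiv_neg hneg)).exists
  exact Set.disjoint_left.1 (disjoint_sides hu) h1 h2

theorem unitGrad_eq_of_minus (hu : ∀ x, u x = 1 ∨ u x = -1) (h : IsDefiningFunction u p f)
    {a : Space d} (ha : a ≠ 0)
    (hside : ∀ v, 0 < inner ℝ a v → ∀ᶠ t in 𝓝[>] (0 : ℝ), p + t • v ∈ minusSide u) :
    unitGrad f p = -(‖a‖⁻¹ • a) := by
  rw [← smul_neg, ← norm_neg a]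
  refine normalize_eq_of_halfspace (neg_ne_zero.2 ha) (gradient_ne_zero h.fderiv_ne_zero)
    fun v hv => ?_
  rw [inner_gradient]
  by_contra! hneg
  have h3 : 0 < fderiv ℝ f p (-v) := by rw [map_neg]; linarith
  have h4 : 0 < inner ℝ a (-v) := by
    rw [inner_neg_right]; rw [inner_neg_left] at hv; exact hv
  obtain ⟨t, h1, h2⟩ := ((hside (-v) h4).and (h.eventually_pos_of_fderiv_pos h3)).exists
  exact Set.disjoint_left.1 (disjoint_sides hu) h2 h1

theorem unitGrad_eq (hu : ∀ x, u x = 1 ∨ u x = -1) (hf : IsDefiningFunction u p f)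
    (hg : IsDefiningFunction u p g) : unitGrad f p = unitGrad g p :=
  hf.unitGrad_eq_of_plus hu (gradient_ne_zero hg.fderiv_ne_zero) fun v hv =>
    hg.eventually_pos_of_fderiv_pos (by rwa [inner_gradient] at hv)

end IsDefiningFunction

open Classical in
/-- The unit normal of the jump set, pointing towards `u = 1`. -/
noncomputable def jumpNormal (u : Space d → ℝ) (p : Space d) : Space d :=
  if h : ∃ f, IsDefiningFunction u p f then unitGrad h.choose p else 0

theorem IsDefiningFunction.jumpNormal_eq {u f : Space d → ℝ} {p : Space d}
    (hu : ∀ x, u x = 1 ∨ u x = -1) (hf : IsDefiningFunction u p f) :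
    jumpNormal u p = unitGrad f p := by
  have h : ∃ f, IsDefiningFunction u p f := ⟨f, hf⟩
  rw [jumpNormal, dif_pos h]
  exact h.choose_spec.unitGrad_eq hu hf

theorem norm_jumpNormal {u : Space d → ℝ} (hu : ∀ x, u x = 1 ∨ u x = -1) (hC : HasC2JumpSet u)
    {p : Space d} (hp : p ∈ jumpSet u) : ‖jumpNormal u p‖ = 1 := by
  obtain ⟨f, hf⟩ := hC p hp
  rw [hf.jumpNormal_eq hu, norm_unitGrad hf.fderiv_ne_zero]

theorem jumpNormal_add_latticePoint {u : Space d → ℝ} (hu : ∀ x, u x = 1 ∨ u x = -1)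
    (hC : HasC2JumpSet u)
    (hper : IsPeriodic u) (n : Fin d → ℤ) {p : Space d}
    (hp : p ∈ jumpSet u) : jumpNormal u (p + latticePoint n) = jumpNormal u p := by
  obtain ⟨f, hf⟩ := hC p hp
  obtain ⟨g, hg⟩ := hC _ ((add_latticePoint_mem_jumpSet hper n p).2 hp)
  rw [hf.jumpNormal_eq hu, hg.jumpNormal_eq hu]
  refine (hf.unitGrad_eq_of_plus hu (gradient_ne_zero hg.fderiv_ne_zero) fun v hv => ?_).symm
  rw [inner_gradient] at hv
  filter_upwards [hg.eventually_pos_of_fderiv_pos hv] with t ht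
  rw [add_right_comm] at ht
  exact (add_latticePoint_mem_plusSide hper n _).1 ht

theorem eventually_mem_ball_of_inner_pos {x p v : Space d} (hv : 0 < inner ℝ (x - p) v) :
    ∀ᶠ t in 𝓝[>] (0 : ℝ), p + t • v ∈ ball x (dist x p) := by
  have h1 : ∀ᶠ t in 𝓝[>] (0 : ℝ), t * ‖v‖ ^ 2 < 2 * inner ℝ (x - p) v := by
    refine (Tendsto.mono_left ?_ nhdsWithin_le_nhds).eventually
      (gt_mem_nhds (show (0 : ℝ) < 2 * inner ℝ (x - p) v by linarith))
    have : Continuous fun t : ℝ => t * ‖v‖ ^ 2 := by fun_prop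
    simpa using this.tendsto 0
  filter_upwards [h1, self_mem_nhdsWithin] with t ht ht0
  have ht0' : (0 : ℝ) < t := ht0
  rw [mem_ball, dist_comm, dist_eq_norm, dist_eq_norm, ← sub_sub,
    ← sq_lt_sq₀ (norm_nonneg _) (norm_nonneg _), norm_sub_sq_real, inner_smul_right, norm_smul,
    mul_pow, Real.norm_eq_abs, sq_abs]
  nlinarith

/-- The ball around `x` with radius the distance stays in one side and touches the jump set at `p`.
The directions from `p` into this ball form an open half-space, which fixes the normal. -/
theorem sub_eq_smul_jumpNormal_of_plus {u : Space d → ℝ} (hu : ∀ x, u x = 1 ∨ u x = -1)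
    (hC : HasC2JumpSet u)
    {x p : Space d} (hx : x ∈ plusSide u)
    (hp : p ∈ jumpSet u) (hxp : dist x p = jumpDist u x) :
    x - p = jumpDist u x • jumpNormal u p := by
  obtain ⟨f, hf⟩ := hC p hp
  have hne : x - p ≠ 0 := fun h => by
    rw [sub_eq_zero] at h
    rw [h] at hx
    exact notMem_jumpSet_iff.2 (Or.inl hx) hp
  have := hf.unitGrad_eq_of_plus hu hne fun v hv =>
    (eventually_mem_ball_of_inner_pos hv).mono fun t ht =>
      ball_subset_plusSide hu hx (hxp ▸ ht)
  rw [hf.jumpNormal_eq hu, this, ← hxp, dist_eq_norm, smul_smul,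
    mul_inv_cancel₀ (norm_ne_zero_iff.2 hne), one_smul]

theorem sub_eq_smul_jumpNormal_of_minus {u : Space d → ℝ} (hu : ∀ x, u x = 1 ∨ u x = -1)
    (hC : HasC2JumpSet u)
    {x p : Space d} (hx : x ∈ minusSide u)
    (hp : p ∈ jumpSet u) (hxp : dist x p = jumpDist u x) :
    x - p = jumpDist u x • -jumpNormal u p := by
  obtain ⟨f, hf⟩ := hC p hp
  have hne : x - p ≠ 0 := fun h => by
    rw [sub_eq_zero] at h
    rw [h] at hx
    exact notMem_jumpSet_iff.2 (Or.inr hx) hp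
  have := hf.unitGrad_eq_of_minus hu hne fun v hv =>
    (eventually_mem_ball_of_inner_pos hv).mono fun t ht =>
      ball_subset_minusSide hu hx (hxp ▸ ht)
  rw [hf.jumpNormal_eq hu, this, neg_neg, ← hxp, dist_eq_norm, smul_smul,
    mul_inv_cancel₀ (norm_ne_zero_iff.2 hne), one_smul]

/-- The distance is minimal at `p`, so its derivative there would vanish. But along the gradient of
a defining function the distance to the zero set grows linearly. -/
theorem not_differentiableAt_jumpDist {u : Space d → ℝ} (hC : HasC2JumpSet u)
    {p : Space d} (hp : p ∈ jumpSet u) :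
    ¬DifferentiableAt ℝ (jumpDist u) p := by
  intro hd
  have hmin : IsLocalMin (jumpDist u) p := Eventually.of_forall fun y => by
    rw [jumpDist_eq_zero hp]; exact jumpDist_nonneg u y
  have hD : HasFDerivAt (jumpDist u) (0 : Space d →L[ℝ] ℝ) p := by
    rw [← hmin.fderiv_eq_zero]; exact hd.hasFDerivAt
  obtain ⟨f, hf⟩ := hC p hp
  have hfd := hf.differentiableAt.hasFDerivAt
  set a := gradient f p with ha
  have ha0 : 0 < ‖a‖ := norm_pos_iff.2 (gradient_ne_zero hf.fderiv_ne_zero)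
  have hfa : fderiv ℝ f p a = ‖a‖ ^ 2 := by rw [← inner_gradient, real_inner_self_eq_norm_sq]
  have e1 := hfd.isLittleO.def (show 0 < ‖a‖ / 8 by positivity)
  have e2 := hD.isLittleO.def (show (0 : ℝ) < 1 / 4 by norm_num)
  obtain ⟨r, hr, hball⟩ := Metric.mem_nhds_iff.1 (e1.and (e2.and hf.eventually_eq_zero))
  set t := r / (4 * ‖a‖) with ht
  have ht0 : 0 < t := by positivity
  have hta : t * ‖a‖ = r / 4 := by rw [ht]; field_simp
  have hy : p + t • a ∈ ball p r := by
    rw [mem_ball, dist_eq_norm, add_sub_cancel_left, norm_smul, Real.norm_of_nonneg ht0.le, hta]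
    linarith
  have h2 := (hball hy).2.1
  rw [jumpDist_eq_zero hp, add_sub_cancel_left, norm_smul, Real.norm_of_nonneg ht0.le,
    sub_zero] at h2
  simp only [_root_.zero_apply, sub_zero] at h2
  rw [Real.norm_of_nonneg (jumpDist_nonneg _ _)] at h2
  obtain ⟨q, hq, hqd⟩ := exists_nearest ⟨p, hp⟩ (p + t • a)
  rw [← hqd, dist_comm, dist_eq_norm] at h2
  set w := q - (p + t • a) with hw
  have hqp : q - p = t • a + w := by rw [hw]; abel
  have hqn : ‖q - p‖ ≤ 2 * (t * ‖a‖) := by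
    rw [hqp]
    refine (norm_add_le _ _).trans ?_
    rw [norm_smul, Real.norm_of_nonneg ht0.le]
    nlinarith
  have hqb : q ∈ ball p r := by
    rw [mem_ball, dist_eq_norm]
    linarith
  have h1 := (hball hqb).1
  rw [(hball hqb).2.2 hq, hf.eq_zero, hqp, map_add, map_smul, hfa, smul_eq_mul, sub_self,
    zero_sub, norm_neg, ← hqp, Real.norm_eq_abs] at h1
  have h3 : |fderiv ℝ f p w| ≤ ‖a‖ * (1 / 4 * (t * ‖a‖)) := by
    refine ((fderiv ℝ f p).le_opNorm w).trans ?_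
    rw [← norm_gradient]
    gcongr
  have h4 := (abs_le.1 h3).1
  have h5 := (abs_le.1 h1).2
  have h6 : ‖a‖ / 8 * ‖q - p‖ ≤ ‖a‖ / 8 * (2 * (t * ‖a‖)) := by gcongr
  nlinarith [mul_pos ht0 (mul_pos ha0 ha0)]

/-- By Rademacher the distance is differentiable almost everywhere, and it is nowhere so on the jump
set. -/
theorem volume_jumpSet {u : Space d → ℝ} (hC : HasC2JumpSet u) : volume (jumpSet u) = 0 := by
  have h := (lipschitzWith_jumpDist u).ae_differentiableAt (μ := volume)
  refine measure_mono_null (fun p hp => ?_) (ae_iff.1 h)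
  exact not_differentiableAt_jumpDist hC hp

end

/-! ### Principal curvatures bound the local Lipschitz constant of the normal. -/

section
open Metric

variable {d : ℕ}

/-! ### Curvature bounds and the Lipschitz constant of the normal -/

theorem LinearMap_norm_apply_le_of_eigenvalues {E : Type*} [NormedAddCommGroup E]
    [InnerProductSpace ℝ E] [FiniteDimensional ℝ E] {S : E →ₗ[ℝ] E} (hS : S.IsSymmetric) {K : ℝ}
    (hK : 0 ≤ K) (h : ∀ (v : E) (μ : ℝ), v ≠ 0 → S v = μ • v → |μ| ≤ K) (v : E) :
    ‖S v‖ ≤ K * ‖v‖ := by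
  have hn : Module.finrank ℝ E = Module.finrank ℝ E := rfl
  set b := hS.eigenvectorBasis hn with hb
  rw [← sq_le_sq₀ (norm_nonneg _) (by positivity), mul_pow, ← b.sum_sq_norm_inner_right (S v),
    ← b.sum_sq_norm_inner_right v, Finset.mul_sum]
  refine Finset.sum_le_sum fun i _ => ?_
  have h1 : S (b i) = hS.eigenvalues hn i • b i := hS.apply_eigenvectorBasis hn i
  have h2 : inner ℝ (b i) (S v) = hS.eigenvalues hn i * inner ℝ (b i) v := by
    rw [← hS (b i) v, h1, inner_smul_left]; simp
  have h3 := h (b i) _ (b.orthonormal.ne_zero i) h1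
  rw [h2, norm_mul, mul_pow]
  gcongr
  exact h3

/-- On the tangent space the derivative of the unit normal is the shape operator. It is symmetric
because the second derivative of `f` is, and its eigenvalues are the principal curvatures up to
sign, so its norm is the largest of them. -/
theorem IsDefiningFunction.norm_fderiv_unitGrad_le {u f : Space d → ℝ} {p : Space d}
    (hf : IsDefiningFunction u p f) {K : ℝ} (hK0 : 0 ≤ K)
    (hK : ∀ k, IsPrincipalCurvature u p k → |k| ≤ K) :
    HasStrictFDerivAt (unitGrad f) (fderiv ℝ (unitGrad f) p) p ∧
    ∀ v, fderiv ℝ f p v = 0 → ‖fderiv ℝ (unitGrad f) p v‖ ≤ K * ‖v‖ := by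
  have hne := gradient_ne_zero hf.fderiv_ne_zero
  have hfd : ContDiffAt ℝ 1 (fderiv ℝ f) p := hf.contDiffAt.fderiv_right (by norm_num)
  have hgr : ContDiffAt ℝ 1 (gradient f) p :=
    (InnerProductSpace.toDual ℝ (Space d)).symm.toContinuousLinearEquiv.contDiff.contDiffAt.comp p
      hfd
  have hnm : ContDiffAt ℝ 1 (fun x => ‖gradient f x‖) p := hgr.norm ℝ hne
  have hN : ContDiffAt ℝ 1 (unitGrad f) p := (hnm.inv (norm_ne_zero_iff.2 hne)).smul hgr
  have hNd : DifferentiableAt ℝ (unitGrad f) p := hN.differentiableAt one_ne_zero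
  refine ⟨hN.hasStrictFDerivAt one_ne_zero, fun v hv => ?_⟩
  set N' := fderiv ℝ (unitGrad f) p with hN'
  set n := unitGrad f p with hn
  have hgn : gradient f p = ‖gradient f p‖ • n := by
    rw [hn, unitGrad, smul_smul, mul_inv_cancel₀ (norm_ne_zero_iff.2 hne), one_smul]
  -- A field of constant length has derivative orthogonal to itself, so `N'` maps into the tangent
  -- space.
  have horth : ∀ v, inner ℝ n (N' v) = 0 := by
    intro v
    have h1 : (fun x => inner ℝ (unitGrad f x) (unitGrad f x)) =ᶠ[𝓝 p] fun _ => (1 : ℝ) := by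
      filter_upwards [hf.eventually_fderiv_ne_zero] with y hy
      rw [real_inner_self_eq_norm_sq, norm_unitGrad hy, one_pow]
    have h2 := (hNd.hasFDerivAt.inner ℝ hNd.hasFDerivAt).unique
      ((hasFDerivAt_const (1 : ℝ) p).congr_of_eventuallyEq h1)
    have h3 := DFunLike.congr_fun h2 v
    simp only [ContinuousLinearMap.comp_apply, ContinuousLinearMap.prod_apply,
      fderivInnerCLM_apply, _root_.zero_apply] at h3
    rw [real_inner_comm (unitGrad f p)] at h3
    linarith
  have hker : ∀ w, fderiv ℝ f p w = 0 ↔ inner ℝ n w = 0 := by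
    intro w
    rw [← inner_gradient, hgn, inner_smul_left]
    simp [norm_ne_zero_iff.2 hne]
  -- The product rule for `∇f = ‖∇f‖ n` has a second term, but it is proportional to `n` and
  -- disappears against tangential `w`.
  have hsecond : ∀ v w, fderiv ℝ f p w = 0 →
      fderiv ℝ (fderiv ℝ f) p v w = ‖fderiv ℝ f p‖ * inner ℝ (N' v) w := by
    intro v w hw
    have h1 : (fun x => fderiv ℝ f x w) =ᶠ[𝓝 p]
        fun x => ‖gradient f x‖ * inner ℝ (unitGrad f x) w := by
      filter_upwards [hf.eventually_fderiv_ne_zero] with y hy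
      rw [unitGrad, inner_smul_left, ← inner_gradient]
      simp only [conj_trivial]
      rw [← mul_assoc, mul_inv_cancel₀ (norm_ne_zero_iff.2 (gradient_ne_zero hy)), one_mul]
    have h2 : HasFDerivAt (fun x => fderiv ℝ f x w)
        ((ContinuousLinearMap.apply ℝ ℝ w).comp (fderiv ℝ (fderiv ℝ f) p)) p :=
      (ContinuousLinearMap.apply ℝ ℝ w).hasFDerivAt.comp p
        (hfd.differentiableAt one_ne_zero).hasFDerivAt
    have h3 := ((hnm.differentiableAt one_ne_zero).hasFDerivAt.mul
      (hNd.hasFDerivAt.inner ℝ (hasFDerivAt_const w p)))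
    have h4 := DFunLike.congr_fun (h2.unique (h3.congr_of_eventuallyEq h1)) v
    have h5 : inner ℝ (unitGrad f p) w = 0 := (hker w).1 hw
    simp only [ContinuousLinearMap.comp_apply, ContinuousLinearMap.apply_apply,
      _root_.add_apply, _root_.smul_apply, smul_eq_mul, h5, zero_mul, add_zero,
      ContinuousLinearMap.prod_apply, fderivInnerCLM_apply, _root_.zero_apply, inner_zero_right,
      zero_add] at h4
    rw [h4, norm_gradient]
  let T : Submodule ℝ (Space d) := LinearMap.ker (fderiv ℝ f p).toLinearMap
  have hT : ∀ w, w ∈ T ↔ fderiv ℝ f p w = 0 := fun w => LinearMap.mem_ker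
  have hmaps : ∀ w ∈ T, N'.toLinearMap w ∈ T := fun w _ => (hT _).2 ((hker _).2 (horth w))
  let S : T →ₗ[ℝ] T := N'.toLinearMap.restrict hmaps
  have hSval : ∀ w : T, ((S w : T) : Space d) = N' w := fun w => rfl
  have hnf : 0 < ‖fderiv ℝ f p‖ := norm_pos_iff.2 hf.fderiv_ne_zero
  have hsymm : S.IsSymmetric := by
    intro a b
    rw [Submodule.coe_inner, Submodule.coe_inner, hSval, hSval]
    have h1 := hsecond a b ((hT _).1 b.2)
    have h2 := hsecond b a ((hT _).1 a.2)
    have h3 : fderiv ℝ (fderiv ℝ f) p a b = fderiv ℝ (fderiv ℝ f) p b a :=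
      (hf.contDiffAt.isSymmSndFDerivAt (by simp)) a b
    rw [h1, h2] at h3
    rw [real_inner_comm (N' b)]
    exact mul_left_cancel₀ hnf.ne' h3
  have heig : ∀ (w : T) (μ : ℝ), w ≠ 0 → S w = μ • w → |μ| ≤ K := by
    intro w μ hw hSw
    have h1 : IsPrincipalCurvature u p (-μ) := by
      refine ⟨f, hf, w, fun h => hw (Subtype.ext h), (hT _).1 w.2, fun z hz => ?_⟩
      have h2 : N' w = μ • (w : Space d) := by rw [← hSval, hSw]; rfl
      rw [hsecond _ _ hz, h2, inner_smul_left]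
      simp only [conj_trivial]
      ring
    rw [← abs_neg]
    exact hK _ h1
  exact LinearMap_norm_apply_le_of_eigenvalues hsymm hK0 heig ⟨v, (hT v).2 hv⟩

/-- The defining function vanishes at both points, so by strict differentiability their difference
is almost tangential at `p`, where the curvature bound applies. The gap between `K` and `K'` absorbs
the errors. -/
theorem IsDefiningFunction.exists_lipschitz_jumpNormal {u f : Space d → ℝ} {p : Space d}
    (hu : ∀ x, u x = 1 ∨ u x = -1) (hf : IsDefiningFunction u p f) {K K' : ℝ} (hK0 : 0 ≤ K)
    (hK : ∀ k, IsPrincipalCurvature u p k → |k| ≤ K) (hKK' : K < K') :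
    ∃ r > 0, ∀ y ∈ jumpSet u, ∀ y' ∈ jumpSet u, y ∈ ball p r → y' ∈ ball p r →
      dist (jumpNormal u y) (jumpNormal u y') ≤ K' * dist y y' := by
  obtain ⟨hs, hb⟩ := hf.norm_fderiv_unitGrad_le hK0 hK
  set N' := fderiv ℝ (unitGrad f) p with hN'
  have hfs : HasStrictFDerivAt f (fderiv ℝ f p) p := hf.contDiffAt.hasStrictFDerivAt (by norm_num)
  have hnf : 0 < ‖gradient f p‖ := norm_pos_iff.2 (gradient_ne_zero hf.fderiv_ne_zero)
  -- Chosen so that the error `c` of the normal and the error `c / ‖∇f‖` of tangentiality, amplified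
  -- by `‖N'‖`, add up to `K' - K`.
  set c := (K' - K) / (‖N'‖ / ‖gradient f p‖ + 1) with hc
  have hden : 0 < ‖N'‖ / ‖gradient f p‖ + 1 := by positivity
  have hc0 : 0 < c := div_pos (by linarith) hden
  have e1 := hs.isLittleO.def hc0
  have e2 := hfs.isLittleO.def hc0
  have e3 := hf.eventually_isDefiningFunction
  obtain ⟨r, hr, hball⟩ := Metric.mem_nhds_iff.1 (e1.and e2)
  obtain ⟨r', hr', hball'⟩ := Metric.mem_nhds_iff.1 e3
  refine ⟨min r r', lt_min hr hr', fun y hy y' hy' hyb hyb' => ?_⟩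
  have hdy := hball' (ball_subset_ball (min_le_right _ _) hyb) hy
  have hdy' := hball' (ball_subset_ball (min_le_right _ _) hyb') hy'
  have hmem : (y, y') ∈ ball (p, p) r := by
    rw [← ball_prod_same]
    exact ⟨ball_subset_ball (min_le_left _ _) hyb, ball_subset_ball (min_le_left _ _) hyb'⟩
  obtain ⟨h1, h2⟩ := hball hmem
  simp only [hdy.eq_zero, hdy'.eq_zero, sub_self, zero_sub, norm_neg] at h1 h2
  rw [hdy.jumpNormal_eq hu, hdy'.jumpNormal_eq hu, dist_eq_norm, dist_eq_norm]
  set h := y - y' with hh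
  set n := unitGrad f p with hn
  have hn1 : ‖n‖ = 1 := norm_unitGrad hf.fderiv_ne_zero
  have hgn : gradient f p = ‖gradient f p‖ • n := by
    rw [hn, unitGrad, smul_smul, mul_inv_cancel₀ hnf.ne', one_smul]
  have hDn : ∀ w, fderiv ℝ f p w = ‖gradient f p‖ * inner ℝ n w := by
    intro w
    rw [← inner_gradient]
    conv_lhs => rw [hgn, inner_smul_left]
    simp
  have hin : |inner ℝ n h| ≤ c / ‖gradient f p‖ * ‖h‖ := by
    rw [hDn, norm_mul, norm_norm, Real.norm_eq_abs] at h2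
    rw [div_mul_eq_mul_div, le_div_iff₀ hnf]
    linarith
  set v := h - inner ℝ n h • n with hv
  have hv0 : fderiv ℝ f p v = 0 := by
    rw [hDn, hv, inner_sub_right, inner_smul_right, real_inner_self_eq_norm_sq, hn1]
    simp
  have hvn : ‖v‖ ≤ ‖h‖ := by
    rw [← sq_le_sq₀ (norm_nonneg _) (norm_nonneg _), hv, norm_sub_sq_real, inner_smul_right,
      real_inner_comm, norm_smul, hn1, mul_one, Real.norm_eq_abs, sq_abs]
    nlinarith [sq_nonneg (inner ℝ n h : ℝ)]
  have hN'h : ‖N' h‖ ≤ K * ‖h‖ + ‖N'‖ * (c / ‖gradient f p‖ * ‖h‖) := by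
    have : h = v + inner ℝ n h • n := by rw [hv]; abel
    calc ‖N' h‖ = ‖N' v + N' (inner ℝ n h • n)‖ := by rw [← map_add, ← this]
      _ ≤ ‖N' v‖ + ‖N' (inner ℝ n h • n)‖ := norm_add_le _ _
      _ ≤ K * ‖h‖ + ‖N'‖ * (c / ‖gradient f p‖ * ‖h‖) := by
          refine add_le_add ((hb v hv0).trans (by gcongr)) ((N'.le_opNorm _).trans ?_)
          gcongr
          rw [norm_smul, hn1, mul_one]
          exact hin
  calc ‖unitGrad f y - unitGrad f y'‖ = ‖N' h + (unitGrad f y - unitGrad f y' - N' h)‖ := by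
        congr 1; abel
    _ ≤ ‖N' h‖ + ‖unitGrad f y - unitGrad f y' - N' h‖ := norm_add_le _ _
    _ ≤ K * ‖h‖ + ‖N'‖ * (c / ‖gradient f p‖ * ‖h‖) + c * ‖h‖ := add_le_add hN'h h1
    _ = (K + c * (‖N'‖ / ‖gradient f p‖ + 1)) * ‖h‖ := by ring
    _ = K' * ‖h‖ := by rw [hc, div_mul_cancel₀ _ hden.ne']; ring

/-- A Lebesgue number on the compact closed cell, carried everywhere by periodicity. The radius
depends on `u` without control; it will not enter any final estimate. -/
theorem exists_uniform_lipschitz_jumpNormal {u : Space d → ℝ} (hper : IsPeriodic u)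
    (hu : ∀ x, u x = 1 ∨ u x = -1) (hC : HasC2JumpSet u) {K K' : ℝ} (hK0 : 0 ≤ K)
    (hK : ∀ x ∈ jumpSet u, ∀ k, IsPrincipalCurvature u x k → |k| ≤ K) (hKK' : K < K') :
    ∃ r > 0, ∀ y ∈ jumpSet u, ∀ y' ∈ jumpSet u, dist y y' < r →
      dist (jumpNormal u y) (jumpNormal u y') ≤ K' * dist y y' := by
  have hloc : ∀ p : jumpSet u, ∃ r > 0, ∀ y ∈ jumpSet u, ∀ y' ∈ jumpSet u,
      y ∈ ball (p : Space d) r → y' ∈ ball (p : Space d) r →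
      dist (jumpNormal u y) (jumpNormal u y') ≤ K' * dist y y' := by
    rintro ⟨p, hp⟩
    obtain ⟨f, hf⟩ := hC p hp
    exact hf.exists_lipschitz_jumpNormal hu hK0 (hK p hp) hKK'
  choose r hr hlip using hloc
  obtain ⟨δ, hδ, hleb⟩ := lebesgue_number_lemma_of_metric
    ((isCompact_closedCell d).inter_left (isClosed_jumpSet u))
    (c := fun p : jumpSet u => ball (p : Space d) (r p)) (fun _ => isOpen_ball)
    (fun x hx => mem_iUnion.2 ⟨⟨x, hx.1⟩, mem_ball_self (hr _)⟩)
  refine ⟨δ, hδ, fun y hy y' hy' hdist => ?_⟩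
  obtain ⟨n, hn⟩ := exists_add_latticePoint_mem_unitCell y
  have hyn := (add_latticePoint_mem_jumpSet hper n y).2 hy
  have hyn' := (add_latticePoint_mem_jumpSet hper n y').2 hy'
  obtain ⟨p, hp⟩ := hleb _ ⟨hyn, unitCell_subset_closedCell hn⟩
  have := hlip p _ hyn _ hyn' (hp (mem_ball_self hδ)) (hp (by
    rw [mem_ball, dist_add_right, dist_comm]; exact hdist))
  rwa [jumpNormal_add_latticePoint hu hC hper n hy, jumpNormal_add_latticePoint hu hC hper n hy',
    dist_add_right] at this

end

/-! ### Comparing distant layers with those at the jump set by shifting along normals. -/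

section
open Metric

variable {d : ℕ}

/-! ### Volumes of layers around the jump set -/

/-- The inverse of `T` is `L`-Lipschitz on pieces of the image of diameter below `r`, and Lipschitz
maps raise `d`-dimensional Hausdorff measure by at most `L ^ d`. Summing over a countable partition
gives the global bound. -/
theorem volume_le_of_expansion {A : Set (Space d)} {T : Space d → Space d} {L : NNReal} {r : ℝ}
    (hr : 0 < r) (hA : MeasurableSet A) (hT : Measurable T)
    (hexp : ∀ x ∈ A, ∀ x' ∈ A, dist (T x) (T x') < r → dist x x' ≤ L * dist (T x) (T x')) :
    InjOn T A ∧ MeasurableSet (T '' A) ∧ volume A ≤ (L : ENNReal) ^ d * volume (T '' A) := by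
  have hinj : InjOn T A := fun x hx x' hx' h => by
    have := hexp x hx x' hx' (by rw [h, dist_self]; exact hr)
    rw [h, dist_self, mul_zero] at this
    exact dist_le_zero.1 this
  have hTA : MeasurableSet (T '' A) := hA.image_of_measurable_injOn hT hinj
  refine ⟨hinj, hTA, ?_⟩
  have hpiece : ∀ B : Set (Space d), (∀ y ∈ B, ∀ y' ∈ B, dist y y' < r) →
      volume (A ∩ T ⁻¹' B) ≤ (L : ENNReal) ^ d * volume (T '' A ∩ B) := by
    intro B hB
    have hsub : A ∩ T ⁻¹' B ⊆ Function.invFunOn T A '' (T '' A ∩ B) := by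
      rintro x ⟨hx, hxB⟩
      exact ⟨T x, ⟨mem_image_of_mem T hx, hxB⟩, hinj.leftInvOn_invFunOn hx⟩
    have hlip : LipschitzOnWith L (Function.invFunOn T A) (T '' A ∩ B) := by
      refine LipschitzOnWith.of_dist_le_mul ?_
      rintro _ ⟨⟨x, hx, rfl⟩, hxB⟩ _ ⟨⟨x', hx', rfl⟩, hxB'⟩
      rw [hinj.leftInvOn_invFunOn hx, hinj.leftInvOn_invFunOn hx']
      exact hexp x hx x' hx' (hB _ hxB _ hxB')
    have h1 := hlip.hausdorffMeasure_image_le (d := (d : ℝ)) (Nat.cast_nonneg d)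
    rw [ENNReal.rpow_natCast] at h1
    -- Hausdorff measure in the full dimension is a Haar measure, so volume is a multiple of it and
    -- the constant `L ^ d` survives the change of measure.
    have hfin : Module.finrank ℝ (Space d) = d := finrank_euclideanSpace_fin
    have hhaar : (Measure.hausdorffMeasure (d : ℝ) : Measure (Space d)).IsAddHaarMeasure := by
      have := MeasureTheory.isAddHaarMeasure_hausdorffMeasure (E := Space d)
      rwa [hfin] at this
    have hvol := Measure.isAddLeftInvariant_eq_smul (volume : Measure (Space d))
      (Measure.hausdorffMeasure (d : ℝ))
    set c := (volume : Measure (Space d)).addHaarScalarFactor (Measure.hausdorffMeasure (d : ℝ))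
    rw [hvol]
    simp only [Measure.smul_apply]
    calc c • Measure.hausdorffMeasure (d : ℝ) (A ∩ T ⁻¹' B)
        ≤ c • ((L : ENNReal) ^ d * Measure.hausdorffMeasure (d : ℝ) (T '' A ∩ B)) := by
          gcongr
          exact (measure_mono hsub).trans h1
      _ = _ := by rw [mul_smul_comm]
  obtain ⟨x, hx⟩ := TopologicalSpace.exists_dense_seq (Space d)
  let B : ℕ → Set (Space d) := disjointed fun n => ball (x n) (r / 2)
  have hBm : ∀ n, MeasurableSet (B n) := MeasurableSet.disjointed fun n => measurableSet_ball
  have hBu : ⋃ n, B n = univ := by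
    rw [iUnion_disjointed]
    refine eq_univ_of_forall fun y => ?_
    obtain ⟨n, hn⟩ := hx.exists_dist_lt y (half_pos hr)
    exact mem_iUnion.2 ⟨n, hn⟩
  have hBd : ∀ n, ∀ y ∈ B n, ∀ y' ∈ B n, dist y y' < r := fun n y hy y' hy' => by
    have h1 := mem_ball.1 (disjointed_subset _ n hy)
    have h2 := mem_ball.1 (disjointed_subset _ n hy')
    have := dist_triangle_right y y' (x n)
    linarith
  have hdis : Pairwise (Function.onFun Disjoint B) := disjoint_disjointed _
  calc volume A = volume (⋃ n, A ∩ T ⁻¹' B n) := by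
        rw [← inter_iUnion, ← preimage_iUnion, hBu, preimage_univ, inter_univ]
    _ ≤ ∑' n, volume (A ∩ T ⁻¹' B n) := measure_iUnion_le _
    _ ≤ ∑' n, (L : ENNReal) ^ d * volume (T '' A ∩ B n) :=
        ENNReal.tsum_le_tsum fun n => hpiece _ (hBd n)
    _ = (L : ENNReal) ^ d * volume (T '' A) := by
        rw [ENNReal.tsum_mul_left, ← measure_iUnion (fun i j hij => (hdis hij).mono
          inter_subset_right inter_subset_right) (fun n => hTA.inter (hBm n)), ← inter_iUnion, hBu,
          inter_univ]

/-- The gradient has length at most one, and the distance falls at unit rate towards the nearest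
point; this is the equality case of Cauchy-Schwarz. -/
theorem gradient_jumpDist {u : Space d → ℝ} {x p : Space d} (hp : p ∈ jumpSet u)
    (hxp : dist x p = jumpDist u x) (hpos : 0 < jumpDist u x)
    (hd : DifferentiableAt ℝ (jumpDist u) x) :
    gradient (jumpDist u) x = (jumpDist u x)⁻¹ • (x - p) := by
  set D := jumpDist u x with hD
  set e := D⁻¹ • (x - p) with he
  have hnorm : ‖x - p‖ = D := by rw [← dist_eq_norm, hxp]
  have he1 : ‖e‖ = 1 := by
    rw [he, norm_smul, hnorm, norm_inv, Real.norm_of_nonneg hpos.le, inv_mul_cancel₀ hpos.ne']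
  have hxe : x - p = D • e := by rw [he, smul_smul, mul_inv_cancel₀ hpos.ne', one_smul]
  have hg1 : ‖gradient (jumpDist u) x‖ ≤ 1 := by
    rw [norm_gradient]
    exact_mod_cast norm_fderiv_le_of_lipschitz ℝ (lipschitzWith_jumpDist u)
  have hder : HasDerivAt (fun t : ℝ => jumpDist u (x + t • -e)) (fderiv ℝ (jumpDist u) x (-e)) 0 := by
    have h1 : HasDerivAt (fun t : ℝ => x + t • -e) (-e) 0 := by
      simpa using ((hasDerivAt_id (0 : ℝ)).smul_const (-e)).const_add x
    have h2 : HasFDerivAt (jumpDist u) (fderiv ℝ (jumpDist u) x) (x + (0 : ℝ) • -e) := by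
      simpa using hd.hasFDerivAt
    exact h2.comp_hasDerivAt 0 h1
  have hslope := hder.tendsto_slope_zero_right
  have hle : fderiv ℝ (jumpDist u) x (-e) ≤ -1 := by
    refine le_of_tendsto hslope ?_
    have hlt : ∀ᶠ t in 𝓝[>] (0 : ℝ), t < D := nhdsWithin_le_nhds (gt_mem_nhds hpos)
    filter_upwards [hlt, self_mem_nhdsWithin] with t ht ht0
    have ht0' : (0 : ℝ) < t := ht0
    have h1 : jumpDist u (x + t • -e) ≤ D - t := by
      refine (infDist_le_dist_of_mem hp).trans (le_of_eq ?_)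
      have : x + t • -e - p = (D - t) • e := by
        rw [sub_smul, ← hxe, smul_neg]; abel
      rw [dist_eq_norm, this, norm_smul, he1, mul_one, Real.norm_of_nonneg (by linarith)]
    simp only [zero_add, zero_smul, add_zero, smul_eq_mul]
    rw [← hD, inv_mul_le_iff₀ ht0']
    linarith
  have hin : 1 ≤ inner ℝ (gradient (jumpDist u) x) e := by
    rw [inner_gradient]
    rw [map_neg] at hle
    linarith
  have hsq : ‖gradient (jumpDist u) x - e‖ ^ 2 ≤ 0 := by
    rw [norm_sub_sq_real, he1]
    nlinarith [norm_nonneg (gradient (jumpDist u) x)]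
  have h0 : ‖gradient (jumpDist u) x - e‖ = 0 := by
    nlinarith [norm_nonneg (gradient (jumpDist u) x - e)]
  exact sub_eq_zero.1 (norm_eq_zero.1 h0)

/-- One side of the jump set, with unit normal `m` pointing into it, which is `K`-Lipschitz at
scales below `r`. -/
structure IsRegularSide (u : Space d → ℝ) (P : Set (Space d)) (m : Space d → Space d)
    (K r : ℝ) : Prop where
  isOpen : IsOpen P
  periodic : ∀ n x, x + latticePoint n ∈ P ↔ x ∈ P
  jumpDist_pos : ∀ x ∈ P, 0 < jumpDist u x
  ball_subset : ∀ x ∈ P, ball x (jumpDist u x) ⊆ P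
  sub_eq : ∀ x ∈ P, ∀ p ∈ jumpSet u, dist x p = jumpDist u x → x - p = jumpDist u x • m p
  norm_eq : ∀ p ∈ jumpSet u, ‖m p‖ = 1
  lipschitz : ∀ y ∈ jumpSet u, ∀ y' ∈ jumpSet u, dist y y' < r → dist (m y) (m y') ≤ K * dist y y'

/-- The shift by `s` towards the jump set along the normals. -/
noncomputable def normalShift (u : Space d → ℝ) (s : ℝ) (x : Space d) : Space d :=
  x - s • gradient (jumpDist u) x

theorem measurable_normalShift (u : Space d → ℝ) (s : ℝ) : Measurable (normalShift u s) := by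
  refine measurable_id.sub (Measurable.const_smul ?_ s)
  exact (InnerProductSpace.toDual ℝ (Space d)).symm.continuous.measurable.comp
    (measurable_fderiv ℝ (jumpDist u))

theorem normalShift_add_latticePoint {u : Space d → ℝ} (hper : IsPeriodic u) (s : ℝ)
    (n : Fin d → ℤ) (x : Space d) :
    normalShift u s (x + latticePoint n) = normalShift u s x + latticePoint n := by
  simp only [normalShift, gradient, (isPeriodic_jumpDist hper).periodic_fderiv n x]
  abel

namespace IsRegularSide

variable {u : Space d → ℝ} {P : Set (Space d)} {m : Space d → Space d} {K r₁ : ℝ}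

theorem normalShift_eq (hP : IsRegularSide u P m K r₁) {s : ℝ} (hs : 0 ≤ s) {x p : Space d}
    (hx : x ∈ P) (hd : DifferentiableAt ℝ (jumpDist u) x) (hsx : s < jumpDist u x)
    (hp : p ∈ jumpSet u) (hxp : dist x p = jumpDist u x) :
    x = normalShift u s x + s • m p ∧ normalShift u s x = p + (jumpDist u x - s) • m p ∧
      jumpDist u (normalShift u s x) = jumpDist u x - s ∧ normalShift u s x ∈ P := by
  have hpos := hP.jumpDist_pos x hx
  have hm := hP.norm_eq p hp
  have hsub := hP.sub_eq x hx p hp hxp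
  have hT : normalShift u s x = x - s • m p := by
    rw [normalShift, gradient_jumpDist hp hxp hpos hd, hsub, inv_smul_smul₀ hpos.ne']
  have h2 : normalShift u s x = p + (jumpDist u x - s) • m p := by
    rw [hT, sub_smul, ← hsub]; abel
  have hdx : dist (normalShift u s x) x = s := by
    rw [hT, dist_eq_norm, sub_sub_cancel_left, norm_neg, norm_smul, hm, mul_one,
      Real.norm_of_nonneg hs]
  refine ⟨by rw [hT]; abel, h2, le_antisymm ?_ ?_, hP.ball_subset x hx (by
    rw [mem_ball, hdx]; exact hsx)⟩
  · refine (infDist_le_dist_of_mem hp).trans (le_of_eq ?_)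
    rw [h2, dist_eq_norm, add_sub_cancel_left, norm_smul, hm, mul_one,
      Real.norm_of_nonneg (by linarith)]
  · have := (lipschitzWith_jumpDist u).dist_le_mul x (normalShift u s x)
    rw [Real.dist_eq, dist_comm, hdx] at this
    simp only [NNReal.coe_one, one_mul] at this
    linarith [(abs_le.1 this).2]

theorem dist_le_of_normalShift (hne : (jumpSet u).Nonempty) (hP : IsRegularSide u P m K r₁)
    (hK : 0 ≤ K) {s r r₀ : ℝ} (hs : 0 ≤ s) (hr₀ : r₀ + 2 * r ≤ r₁) (hrK : r * K ≤ 1 / 2)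
    {x x' : Space d} (hx : x ∈ P) (hx' : x' ∈ P)
    (hd : DifferentiableAt ℝ (jumpDist u) x) (hd' : DifferentiableAt ℝ (jumpDist u) x')
    (hsx : jumpDist u x ∈ Ioc s (s + r)) (hsx' : jumpDist u x' ∈ Ioc s (s + r))
    (hdist : dist (normalShift u s x) (normalShift u s x') < r₀) :
    dist x x' ≤ (1 + 4 * s * K) * dist (normalShift u s x) (normalShift u s x') := by
  obtain ⟨p, hp, hxp⟩ := exists_nearest hne x
  obtain ⟨p', hp', hxp'⟩ := exists_nearest hne x'
  obtain ⟨h1, h2, h3, -⟩ := hP.normalShift_eq hs hx hd hsx.1 hp hxp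
  obtain ⟨h1', h2', h3', -⟩ := hP.normalShift_eq hs hx' hd' hsx'.1 hp' hxp'
  set y := normalShift u s x
  set y' := normalShift u s x'
  set t := jumpDist u x - s
  set t' := jumpDist u x' - s
  have ht : 0 < t ∧ t ≤ r := ⟨by linarith [hsx.1], by linarith [hsx.2]⟩
  have ht' : 0 < t' ∧ t' ≤ r := ⟨by linarith [hsx'.1], by linarith [hsx'.2]⟩
  have htt : |t - t'| ≤ dist y y' := by
    have := (lipschitzWith_jumpDist u).dist_le_mul y y'
    rw [h3, h3', Real.dist_eq] at this
    simpa using this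
  have hpy : dist p y = t := by
    rw [h2, dist_self_add_right, norm_smul, hP.norm_eq p hp, mul_one, Real.norm_of_nonneg ht.1.le]
  have hpy' : dist y' p' = t' := by
    rw [h2', dist_self_add_left, norm_smul, hP.norm_eq p' hp', mul_one,
      Real.norm_of_nonneg ht'.1.le]
  have hpp : dist p p' < r₁ := by
    have := dist_triangle4 p y y' p'
    linarith [ht.2, ht'.2]
  have hlip := hP.lipschitz p hp p' hp' hpp
  have hpp2 : dist p p' ≤ 2 * dist y y' + 1 / 2 * dist p p' := by
    have e : p - p' = (y - y') - (t • (m p - m p') + (t - t') • m p') := by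
      rw [h2, h2']; module
    calc dist p p' = ‖(y - y') - (t • (m p - m p') + (t - t') • m p')‖ := by
          rw [dist_eq_norm, e]
      _ ≤ ‖y - y'‖ + (‖t • (m p - m p')‖ + ‖(t - t') • m p'‖) :=
          (norm_sub_le _ _).trans (by gcongr; exact norm_add_le _ _)
      _ ≤ dist y y' + (r * (K * dist p p') + dist y y') := by
          rw [dist_eq_norm (m p)] at hlip
          rw [norm_smul, norm_smul, hP.norm_eq p' hp', mul_one, Real.norm_of_nonneg ht.1.le,
            Real.norm_eq_abs, dist_eq_norm y]
          rw [dist_eq_norm y] at htt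
          exact add_le_add le_rfl (add_le_add (mul_le_mul ht.2 hlip (norm_nonneg _)
            (ht.1.le.trans ht.2)) htt)
      _ ≤ _ := by nlinarith [dist_nonneg (x := p) (y := p')]
  have hfin : dist x x' ≤ dist y y' + s * (K * dist p p') := by
    conv_lhs => rw [h1, h1']
    have e : y + s • m p - (y' + s • m p') = (y - y') + s • (m p - m p') := by
      rw [smul_sub]; abel
    rw [dist_eq_norm, e]
    refine (norm_add_le _ _).trans ?_
    rw [norm_smul, Real.norm_of_nonneg hs, ← dist_eq_norm, ← dist_eq_norm]
    gcongr
  have h4 : dist p p' ≤ 4 * dist y y' := by linarith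
  have h5 : s * (K * dist p p') ≤ s * (K * (4 * dist y y')) := by gcongr
  linarith

theorem volume_layer_le (hper : IsPeriodic u) (hne : (jumpSet u).Nonempty)
    (hP : IsRegularSide u P m K r₁) (hK : 0 ≤ K) {s r : ℝ} (hs : 0 ≤ s) (hr : 2 * r < r₁)
    (hrK : r * K ≤ 1 / 2) :
    volume ({x | x ∈ P ∧ jumpDist u x ∈ Ioc s (s + r)} ∩ unitCell d) ≤
      ENNReal.ofReal (1 + 4 * s * K) ^ d *
        volume ({x | x ∈ P ∧ jumpDist u x ∈ Ioc 0 r} ∩ unitCell d) := by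
  have hDm : Measurable (jumpDist u) := (lipschitzWith_jumpDist u).continuous.measurable
  have hDp := isPeriodic_jumpDist hper
  set A : Set (Space d) := {x | x ∈ P ∧ jumpDist u x ∈ Ioc s (s + r)} ∩ unitCell d ∩
    {x | DifferentiableAt ℝ (jumpDist u) x} with hA
  have hAm : MeasurableSet A :=
    ((hP.isOpen.measurableSet.inter (hDm measurableSet_Ioc)).inter measurableSet_unitCell).inter
      (measurableSet_of_differentiableAt ℝ _)
  have hvol : volume ({x | x ∈ P ∧ jumpDist u x ∈ Ioc s (s + r)} ∩ unitCell d) = volume A := by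
    refine measure_congr ?_
    filter_upwards [(lipschitzWith_jumpDist u).ae_differentiableAt (μ := volume)] with x hx
    exact propext ⟨fun h => ⟨h, hx⟩, fun h => h.1⟩
  have hK4 : 0 ≤ 1 + 4 * s * K := by positivity
  have hexp : ∀ n, ∀ x ∈ A, ∀ x' ∈ A,
      dist (normalShift u s (x + latticePoint n)) (normalShift u s x') < r₁ - 2 * r →
      dist (x + latticePoint n) x' ≤ (1 + 4 * s * K) *
        dist (normalShift u s (x + latticePoint n)) (normalShift u s x') := by
    intro n x hx x' hx' hd
    refine hP.dist_le_of_normalShift hne hK hs (r₀ := r₁ - 2 * r) (r := r) (by linarith) hrK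
      ((hP.periodic n x).2 hx.1.1.1) hx'.1.1.1 ?_ hx'.2 ?_ hx'.1.1.2 hd
    · have h1 : DifferentiableAt ℝ (fun y => jumpDist u (y + latticePoint n)) x := by
        have e : (fun y => jumpDist u (y + latticePoint n)) = jumpDist u := funext (hDp n)
        rw [e]; exact hx.2
      exact (differentiableAt_comp_add_right _).1 h1
    · rw [hDp n x]; exact hx.1.1.2
  have h0 : (latticePoint 0 : Space d) = 0 := by ext i; simp [latticePoint]
  obtain ⟨hinj, hTm, hle⟩ := volume_le_of_expansion (A := A) (T := normalShift u s)
    (L := Real.toNNReal (1 + 4 * s * K)) (r := r₁ - 2 * r) (by linarith) hAm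
    (measurable_normalShift u s) (fun x hx x' hx' hd => by
      have := hexp 0 x hx x' hx' (by rwa [h0, add_zero])
      rw [h0, add_zero] at this
      rwa [Real.coe_toNNReal _ hK4])
  rw [hvol]
  refine hle.trans ?_
  rw [ENNReal.ofReal]
  refine mul_le_mul' le_rfl (measure_le_of_disjoint_translates hTm ?_ ?_ ?_)
  · rintro _ ⟨x, hx, rfl⟩
    obtain ⟨p, hp, hxp⟩ := exists_nearest hne x
    obtain ⟨-, -, h3, h4⟩ := hP.normalShift_eq hs hx.1.1.1 hx.2 hx.1.1.2.1 hp hxp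
    refine ⟨h4, ?_⟩
    rw [h3]
    exact ⟨by linarith [hx.1.1.2.1], by linarith [hx.1.1.2.2]⟩
  · intro n x
    simp only [mem_ofPred_eq, hP.periodic n x, hDp n x]
  · rintro n hn _ ⟨x, hx, rfl⟩ ⟨x', hx', hxx'⟩
    have h1 := hexp n x hx x' hx' (by
      rw [normalShift_add_latticePoint hper, hxx', dist_self]; linarith)
    rw [normalShift_add_latticePoint hper, hxx', dist_self, mul_zero] at h1
    have h2 : x + latticePoint n = x' := dist_le_zero.1 h1
    apply hn
    ext i
    have h3 := hx.1.2 i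
    have h4 := hx'.1.2 i
    rw [← h2, PiLp.add_apply, latticePoint_apply] at h4
    have h5 : (n i : ℝ) < 1 := by linarith [h3.1, h4.2]
    have h6 : (-1 : ℝ) < n i := by linarith [h3.2, h4.1]
    have h7 : n i = 0 := by
      have : n i < 1 := by exact_mod_cast h5
      have : -1 < n i := by exact_mod_cast h6
      omega
    simp [latticePoint_apply, h7]

end IsRegularSide

theorem isRegularSide_plus {u : Space d → ℝ} (hper : IsPeriodic u)
    (hu : ∀ x, u x = 1 ∨ u x = -1) (hC : HasC2JumpSet u) (hne : (jumpSet u).Nonempty) {K r : ℝ}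
    (hlip : ∀ y ∈ jumpSet u, ∀ y' ∈ jumpSet u, dist y y' < r →
      dist (jumpNormal u y) (jumpNormal u y') ≤ K * dist y y') :
    IsRegularSide u (plusSide u) (jumpNormal u) K r where
  isOpen := isOpen_plusSide u
  periodic := add_latticePoint_mem_plusSide hper
  jumpDist_pos _ hx := (jumpDist_pos hne).2 (notMem_jumpSet_iff.2 (Or.inl hx))
  ball_subset _ hx := ball_subset_plusSide hu hx
  sub_eq _ hx _ hp hxp := sub_eq_smul_jumpNormal_of_plus hu hC hx hp hxp
  norm_eq _ hp := norm_jumpNormal hu hC hp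
  lipschitz := hlip

theorem isRegularSide_minus {u : Space d → ℝ} (hper : IsPeriodic u)
    (hu : ∀ x, u x = 1 ∨ u x = -1) (hC : HasC2JumpSet u) (hne : (jumpSet u).Nonempty) {K r : ℝ}
    (hlip : ∀ y ∈ jumpSet u, ∀ y' ∈ jumpSet u, dist y y' < r →
      dist (jumpNormal u y) (jumpNormal u y') ≤ K * dist y y') :
    IsRegularSide u (minusSide u) (fun p => -jumpNormal u p) K r where
  isOpen := isOpen_minusSide u
  periodic := add_latticePoint_mem_minusSide hper
  jumpDist_pos _ hx := (jumpDist_pos hne).2 (notMem_jumpSet_iff.2 (Or.inr hx))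
  ball_subset _ hx := ball_subset_minusSide hu hx
  sub_eq _ hx _ hp hxp := sub_eq_smul_jumpNormal_of_minus hu hC hx hp hxp
  norm_eq _ hp := by rw [norm_neg]; exact norm_jumpNormal hu hC hp
  lipschitz y hy y' hy' h := by rw [dist_neg_neg]; exact hlip y hy y' hy' h

theorem volume_jumpDist_layer_le {u : Space d → ℝ} (hper : IsPeriodic u)
    (hu : ∀ x, u x = 1 ∨ u x = -1) (hC : HasC2JumpSet u) (hne : (jumpSet u).Nonempty) {K r₁ : ℝ}
    (hlip : ∀ y ∈ jumpSet u, ∀ y' ∈ jumpSet u, dist y y' < r₁ →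
      dist (jumpNormal u y) (jumpNormal u y') ≤ K * dist y y') (hK : 0 ≤ K) {s r : ℝ}
    (hs : 0 ≤ s) (hr : 2 * r < r₁) (hrK : r * K ≤ 1 / 2) :
    volume (jumpDist u ⁻¹' Ioc s (s + r) ∩ unitCell d) ≤
      ENNReal.ofReal (1 + 4 * s * K) ^ d * volume (jumpDist u ⁻¹' Ioc 0 r ∩ unitCell d) := by
  have hDm : Measurable (jumpDist u) := (lipschitzWith_jumpDist u).continuous.measurable
  have h1 := (isRegularSide_plus hper hu hC hne hlip).volume_layer_le hper hne hK hs hr hrK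
  have h2 := (isRegularSide_minus hper hu hC hne hlip).volume_layer_le hper hne hK hs hr hrK
  have hsub : jumpDist u ⁻¹' Ioc s (s + r) ∩ unitCell d ⊆
      ({x | x ∈ plusSide u ∧ jumpDist u x ∈ Ioc s (s + r)} ∩ unitCell d) ∪
      ({x | x ∈ minusSide u ∧ jumpDist u x ∈ Ioc s (s + r)} ∩ unitCell d) := by
    rintro x ⟨hx, hxc⟩
    rcases notMem_jumpSet_iff.1 ((jumpDist_pos hne).1 (hs.trans_lt hx.1)) with h | h
    · exact Or.inl ⟨⟨h, hx⟩, hxc⟩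
    · exact Or.inr ⟨⟨h, hx⟩, hxc⟩
  have hdisj : Disjoint ({x | x ∈ plusSide u ∧ jumpDist u x ∈ Ioc 0 r} ∩ unitCell d)
      ({x | x ∈ minusSide u ∧ jumpDist u x ∈ Ioc 0 r} ∩ unitCell d) :=
    (disjoint_sides hu).mono (fun x hx => hx.1.1) (fun x hx => hx.1.1)
  have hm : MeasurableSet ({x | x ∈ minusSide u ∧ jumpDist u x ∈ Ioc 0 r} ∩ unitCell d) :=
    ((isOpen_minusSide u).measurableSet.inter (hDm measurableSet_Ioc)).inter measurableSet_unitCell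
  refine (measure_mono hsub).trans ((measure_union_le _ _).trans ((add_le_add h1 h2).trans ?_))
  rw [← mul_add, ← measure_union hdisj hm]
  gcongr
  rintro x (⟨⟨-, h⟩, hc⟩ | ⟨⟨-, h⟩, hc⟩) <;> exact ⟨h, hc⟩

theorem volume_jumpDist_Ioc_le {u : Space d → ℝ} (hper : IsPeriodic u)
    (hu : ∀ x, u x = 1 ∨ u x = -1) (hC : HasC2JumpSet u) (hne : (jumpSet u).Nonempty)
    {K r₁ r₂ A b₀ : ℝ} (hr₁ : 0 < r₁) (hr₂ : 0 < r₂)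
    (hlip : ∀ y ∈ jumpSet u, ∀ y' ∈ jumpSet u, dist y y' < r₁ →
      dist (jumpNormal u y) (jumpNormal u y') ≤ K * dist y y') (hK : 0 ≤ K)
    (hcontent : ∀ r, 0 < r → r < r₂ →
      volume (jumpDist u ⁻¹' Ioc 0 r ∩ unitCell d) ≤ ENNReal.ofReal (A * r)) {a b : ℝ}
    (ha : 0 ≤ a) (hab : a ≤ b) (hb : b ≤ b₀) :
    volume (jumpDist u ⁻¹' Ioc a b ∩ unitCell d) ≤
      ENNReal.ofReal ((1 + 4 * b₀ * K) ^ d * A * (b - a)) := by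
  rcases hab.eq_or_lt with rfl | hab'
  · simp
  have hba : 0 < b - a := sub_pos.2 hab'
  obtain ⟨N, hN⟩ := exists_nat_gt (max ((b - a) * 2 / r₁) (max ((b - a) / r₂) ((b - a) * 2 * K)))
  have hN1 : (b - a) * 2 / r₁ < N := (le_max_left _ _).trans_lt hN
  have hN2 : (b - a) / r₂ < N := ((le_max_left _ _).trans (le_max_right _ _)).trans_lt hN
  have hN3 : (b - a) * 2 * K < N := ((le_max_right _ _).trans (le_max_right _ _)).trans_lt hN
  have hN0 : (0 : ℝ) < N := lt_of_le_of_lt (by positivity) hN1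
  set r := (b - a) / N with hr
  have hr0 : 0 < r := div_pos hba hN0
  have hNr : N * r = b - a := by rw [hr]; field_simp
  have hr1 : 2 * r < r₁ := by
    rw [div_lt_iff₀ hr₁] at hN1
    rw [hr, ← mul_div_assoc, div_lt_iff₀ hN0]
    linarith
  have hr2 : r < r₂ := by
    rw [div_lt_iff₀ hr₂] at hN2
    rw [hr, div_lt_iff₀ hN0]
    linarith
  have hr3 : r * K ≤ 1 / 2 := by
    rw [hr, div_mul_eq_mul_div, div_le_iff₀ hN0]
    linarith
  have hb0 : 0 ≤ b₀ := ha.trans (hab.trans hb)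
  have hlayer : ∀ k : ℕ, k < N → volume (jumpDist u ⁻¹' Ioc (a + k * r) (a + k * r + r) ∩
      unitCell d) ≤ ENNReal.ofReal ((1 + 4 * b₀ * K) ^ d * (A * r)) := by
    intro k hk
    have hkr : (k : ℝ) * r ≤ b - a := by
      rw [← hNr]; gcongr
    refine (volume_jumpDist_layer_le hper hu hC hne hlip hK (by positivity) hr1 hr3).trans ?_
    rw [ENNReal.ofReal_mul (by positivity), ENNReal.ofReal_pow (by positivity)]
    gcongr
    · linarith
    · exact hcontent r hr0 hr2
  have hsub : jumpDist u ⁻¹' Ioc a b ∩ unitCell d ⊆ ⋃ k ∈ Finset.range N,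
      (jumpDist u ⁻¹' Ioc (a + k * r) (a + k * r + r) ∩ unitCell d) := by
    rintro x ⟨hx, hxc⟩
    have hx1 : a < jumpDist u x := hx.1
    have hx2 : jumpDist u x ≤ b := hx.2
    have hq : 0 < (jumpDist u x - a) / r := div_pos (by linarith) hr0
    obtain ⟨k, hk⟩ : ∃ k : ℕ, ⌈(jumpDist u x - a) / r⌉₊ = k + 1 :=
      Nat.exists_eq_succ_of_ne_zero (Nat.ceil_pos.2 hq).ne'
    have h1 : (jumpDist u x - a) / r ≤ k + 1 := by
      have := Nat.le_ceil ((jumpDist u x - a) / r)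
      rw [hk] at this
      exact_mod_cast this
    have h2 : (k : ℝ) < (jumpDist u x - a) / r := Nat.lt_ceil.1 (by omega)
    rw [div_le_iff₀ hr0] at h1
    rw [lt_div_iff₀ hr0] at h2
    have hkN : k < N := by
      have h3 : (k : ℝ) * r < N * r := by linarith
      exact_mod_cast lt_of_mul_lt_mul_right h3 hr0.le
    simp only [mem_iUnion, Finset.mem_range]
    exact ⟨k, hkN, ⟨by linarith, by linarith⟩, hxc⟩
  refine (measure_mono hsub).trans ((measure_biUnion_finset_le _ _).trans
    ((Finset.sum_le_sum fun k hk => hlayer k (Finset.mem_range.1 hk)).trans (le_of_eq ?_)))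
  rw [Finset.sum_const, Finset.card_range, nsmul_eq_mul, ← ENNReal.ofReal_natCast,
    ← ENNReal.ofReal_mul (Nat.cast_nonneg N), ← hNr]
  ring_nf

end

section
open Metric

variable {d : ℕ}

/-! ### Minkowski content of the jump set -/

theorem exists_mollification {g g' : Space d → Space d} (hgm : AEStronglyMeasurable g volume)
    (hg1 : ∀ x, ‖g x‖ ≤ 1) (hgg' : g =ᵐ[volume] g') (hg' : IsPeriodic g') {τ : ℝ} (hτ : 0 < τ) :
    ∃ φ : Space d → Space d, ContDiff ℝ 1 φ ∧ IsPeriodic φ ∧ (∀ x, ‖φ x‖ ≤ 1) ∧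
      ∀ x z ε, 0 ≤ ε → (∀ y ∈ ball x τ, dist (g y) z ≤ ε) → dist (φ x) z ≤ ε := by
  let f : ContDiffBump (0 : Space d) := ⟨τ / 2, τ, by linarith, by linarith⟩
  set φ : Space d → Space d :=
    convolution (f.normed volume) g (ContinuousLinearMap.lsmul ℝ ℝ) volume with hφ
  have hloc : LocallyIntegrable g volume :=
    (memLp_top_of_bound hgm 1 (Eventually.of_forall hg1)).locallyIntegrable le_top
  have hdist : ∀ x z ε, 0 ≤ ε → (∀ y ∈ ball x τ, dist (g y) z ≤ ε) → dist (φ x) z ≤ ε :=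
    fun x z ε hε h => dist_convolution_le hε (f.support_normed_eq).subset f.nonneg_normed
      f.integral_normed hgm h
  refine ⟨φ, ?_, ?_, ?_, hdist⟩
  · exact f.hasCompactSupport_normed.contDiff_convolution_left _ (f.contDiff_normed (n := 1)) hloc
  · intro n x
    have h : φ = convolution (f.normed volume) g' (ContinuousLinearMap.lsmul ℝ ℝ) volume :=
      convolution_congr _ (ae_eq_refl _) hgg'
    rw [h]
    simp only [convolution_def, add_sub_right_comm, hg' n]
  · intro x
    have := hdist x 0 1 zero_le_one (fun y _ => by rw [dist_zero_right]; exact hg1 y)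
    rwa [dist_zero_right] at this

theorem signedDist_eventuallyEq {u : Space d → ℝ} (hu : ∀ x, u x = 1 ∨ u x = -1)
    (hne : (jumpSet u).Nonempty) {x : Space d} (hx : x ∉ jumpSet u) :
    signedDist u =ᶠ[𝓝 x] fun y => sideSign u x * jumpDist u y := by
  filter_upwards [ball_mem_nhds x ((jumpDist_pos hne).2 hx)] with y hy
  rcases notMem_jumpSet_iff.1 hx with h | h
  · rw [signedDist, sideSign_plus h, sideSign_plus (ball_subset_plusSide hu h hy)]
  · rw [signedDist, sideSign_minus hu h, sideSign_minus hu (ball_subset_minusSide hu h hy)]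

theorem gradient_signedDist {u : Space d → ℝ} (hu : ∀ x, u x = 1 ∨ u x = -1)
    (hC : HasC2JumpSet u) (hne : (jumpSet u).Nonempty) {x p : Space d} (hx : x ∉ jumpSet u)
    (hd : DifferentiableAt ℝ (jumpDist u) x) (hp : p ∈ jumpSet u) (hxp : dist x p = jumpDist u x) :
    gradient (signedDist u) x = jumpNormal u p := by
  have hpos := (jumpDist_pos hne).2 hx
  have h1 : gradient (signedDist u) x = sideSign u x • gradient (jumpDist u) x := by
    rw [gradient, (signedDist_eventuallyEq hu hne hx).fderiv_eq, fderiv_const_mul hd, map_smulₛₗ]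
    rfl
  rw [h1, gradient_jumpDist hp hxp hpos hd]
  rcases notMem_jumpSet_iff.1 hx with h | h
  · rw [sideSign_plus h, one_smul, sub_eq_smul_jumpNormal_of_plus hu hC h hp hxp,
      inv_smul_smul₀ hpos.ne']
  · rw [sideSign_minus hu h, sub_eq_smul_jumpNormal_of_minus hu hC h hp hxp,
      inv_smul_smul₀ hpos.ne', neg_smul, one_smul, neg_neg]

theorem fderiv_eq_zero_of_abs_eq_one {f : Space d → ℝ} (hf : ∀ y, |f y| ≤ 1) {x : Space d}
    (hx : |f x| = 1) : fderiv ℝ f x = 0 := by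
  rcases (abs_eq zero_le_one).1 hx with h | h
  · exact IsLocalMax.fderiv_eq_zero (Eventually.of_forall fun y => h ▸ (abs_le.1 (hf y)).2)
  · exact IsLocalMin.fderiv_eq_zero (Eventually.of_forall fun y => h ▸ (abs_le.1 (hf y)).1)

theorem fderiv_component {φ : Space d → Space d} {x : Space d} (h : DifferentiableAt ℝ φ x)
    (i : Fin d) (v : Space d) : fderiv ℝ (fun y => φ y i) x v = (fderiv ℝ φ x v) i := by
  have h1 := ((EuclideanSpace.proj (𝕜 := ℝ) i).hasFDerivAt (x := φ x)).comp x h.hasFDerivAt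
  have h2 : HasFDerivAt (fun y => φ y i) ((EuclideanSpace.proj i).comp (fderiv ℝ φ x)) x := h1
  rw [h2.fderiv]
  rfl

theorem continuous_divergence {φ : Space d → Space d} (hφ : ContDiff ℝ 1 φ) :
    Continuous (divergence φ) := by
  refine continuous_finsetSum _ fun i _ => ?_
  exact (EuclideanSpace.proj (𝕜 := ℝ) i).continuous.comp
    ((ContDiff.continuous_fderiv hφ one_ne_zero).clm_apply continuous_const)

theorem isPeriodic_divergence {φ : Space d → Space d} (hφ : IsPeriodic φ) :
    IsPeriodic (divergence φ) := fun n x => by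
  simp only [divergence, hφ.periodic_fderiv n x]

theorem sum_apply_single (L : Space d →L[ℝ] ℝ) (w : Space d) :
    ∑ i, L (EuclideanSpace.single i 1) * w i = L w := by
  conv_rhs => rw [← (EuclideanSpace.basisFun (Fin d) ℝ).sum_repr w, map_sum]
  refine Finset.sum_congr rfl fun i _ => ?_
  rw [map_smul, EuclideanSpace.basisFun_repr, EuclideanSpace.basisFun_apply, smul_eq_mul, mul_comm]

theorem IsPeriodic.isBoundedBy_of_continuous {f : Space d → ℝ} (hf : IsPeriodic f)
    (hc : Continuous f) : ∃ C, IsBoundedBy f C := by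
  obtain ⟨C, -, hC⟩ := hf.exists_bound hc
  exact ⟨C, hc.aestronglyMeasurable, hC⟩

theorem isBoundedBy_fderiv {f : Space d → ℝ} {C : NNReal} (hL : LipschitzWith C f) (v : Space d) :
    IsBoundedBy (fun x => fderiv ℝ f x v) (C * ‖v‖) where
  meas := (measurable_fderiv_apply_const ℝ f v).aestronglyMeasurable
  bound x := ((fderiv ℝ f x).le_opNorm v).trans (by
    gcongr; exact norm_fderiv_le_of_lipschitz ℝ hL)

theorem IsPeriodic.integral_mul_divergence {f : Space d → ℝ} (hf : IsPeriodic f) {C : NNReal}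
    (hL : LipschitzWith C f) {φ : Space d → Space d} (hφ : IsPeriodic φ) (hs : ContDiff ℝ 1 φ) :
    ∫ x in unitCell d, f x * divergence φ x = -∫ x in unitCell d, fderiv ℝ f x (φ x) := by
  obtain ⟨A, hA⟩ := hf.isBoundedBy_of_continuous hL.continuous
  have hcomp : ∀ i, ContDiff ℝ 1 fun x => φ x i := fun i =>
    (EuclideanSpace.proj (𝕜 := ℝ) i).contDiff.comp hs
  have hcp : ∀ i, IsPeriodic fun x => φ x i := fun i => hφ.comp fun w => w i
  have e1 : ∀ x, f x * divergence φ x =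
      ∑ i, f x * fderiv ℝ (fun y => φ y i) x (EuclideanSpace.single i 1) := fun x => by
    rw [divergence, Finset.mul_sum]
    refine Finset.sum_congr rfl fun i _ => ?_
    rw [fderiv_component (hs.differentiable one_ne_zero x)]
  have e2 : ∀ x, fderiv ℝ f x (φ x) = ∑ i, fderiv ℝ f x (EuclideanSpace.single i 1) * φ x i :=
    fun x => (sum_apply_single _ _).symm
  simp_rw [e1, e2]
  rw [integral_finsetSum, integral_finsetSum, ← Finset.sum_neg_distrib]
  · exact Finset.sum_congr rfl fun i _ => hf.integral_mul_fderiv hL (hcp i) (hcomp i) _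
  · intro i _
    obtain ⟨B, hB⟩ := (hcp i).isBoundedBy_of_continuous (hcomp i).continuous
    exact ((isBoundedBy_fderiv hL _).mul hB).integrable
  · intro i _
    obtain ⟨B, hB⟩ := ((hcp i).periodic_fderiv.comp fun L => L (EuclideanSpace.single i 1)
      ).isBoundedBy_of_continuous
        ((ContDiff.continuous_fderiv (hcomp i) one_ne_zero).clm_apply continuous_const)
    exact (hA.mul hB).integrable

theorem volume_layer_mul_le_totalVariation {u : Space d → ℝ} (hBV : IsBVSign u)
    (hC : HasC2JumpSet u) (hne : (jumpSet u).Nonempty) {φ : Space d → Space d}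
    (hφs : ContDiff ℝ 1 φ) (hφp : IsPeriodic φ) (hφ1 : ∀ x, ‖φ x‖ ≤ 1) {C₁ θ r : ℝ}
    (hC₁ : ∀ x, |divergence φ x| ≤ C₁) (hr : 0 < r)
    (hθ : ∀ᵐ x, 0 < jumpDist u x → jumpDist u x < r → θ ≤ fderiv ℝ (signedDist u) x (φ x)) :
    (r⁻¹ * θ - 2 * C₁) * volume.real (jumpDist u ⁻¹' Ioo 0 r ∩ unitCell d) ≤ totalVariation u := by
  have hu := hBV.values
  set ψ : Space d → ℝ := fun x => clamp (r⁻¹ * signedDist u x) with hψ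
  have hψ1 : ∀ x, |ψ x| ≤ 1 := fun x => abs_clamp_le _
  have hψp : IsPeriodic ψ := (isPeriodic_signedDist hBV.periodic).comp fun s => clamp (r⁻¹ * s)
  obtain ⟨C, hψL⟩ : ∃ C, LipschitzWith C ψ := by
    have h1 : LipschitzWith (Real.toNNReal r⁻¹) fun s : ℝ => r⁻¹ * s := by
      refine LipschitzWith.of_dist_le_mul fun s t => ?_
      rw [Real.dist_eq, Real.dist_eq, ← mul_sub, abs_mul, abs_of_pos (inv_pos.2 hr),
        Real.coe_toNNReal _ (inv_pos.2 hr).le]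
    exact ⟨_, lipschitzWith_clamp.comp (h1.comp (lipschitzWith_signedDist hu))⟩
  have hsgn : ∀ x, |r⁻¹ * signedDist u x| = r⁻¹ * jumpDist u x := fun x => by
    rw [abs_mul, abs_of_pos (inv_pos.2 hr), abs_signedDist]
  have hfar : ∀ x, r ≤ jumpDist u x → ψ x = sideSign u x := by
    intro x hx
    have h1 : 1 ≤ r⁻¹ * jumpDist u x := by rwa [← div_eq_inv_mul, one_le_div hr]
    simp only [hψ, signedDist]
    rcases (abs_eq zero_le_one).1 (abs_sideSign u x) with h | h
    · rw [h, one_mul, clamp_of_one_le h1]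
    · rw [h, neg_one_mul, mul_neg, clamp_neg, clamp_of_one_le h1]
  have hψ_far : ∀ x, r ≤ jumpDist u x → fderiv ℝ ψ x = 0 := fun x hx =>
    fderiv_eq_zero_of_abs_eq_one hψ1 (by rw [hfar x hx, abs_sideSign])
  have hψ_near : ∀ x, jumpDist u x < r → DifferentiableAt ℝ (signedDist u) x →
      fderiv ℝ ψ x = r⁻¹ • fderiv ℝ (signedDist u) x := by
    intro x hx hd
    have h1 : ψ =ᶠ[𝓝 x] fun y => r⁻¹ * signedDist u y := by
      filter_upwards [(lipschitzWith_jumpDist u).continuous.continuousAt.eventually_lt_const hx]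
        with y hy
      refine clamp_of_abs_le ?_
      rw [hsgn, ← div_eq_inv_mul, div_le_one hr]
      exact hy.le
    rw [h1.fderiv_eq, fderiv_const_mul hd]
  set S := jumpDist u ⁻¹' Ioo 0 r with hS
  have hSm : MeasurableSet S := (lipschitzWith_jumpDist u).continuous.measurable measurableSet_Ioo
  have hum : IsBoundedBy u 1 := ⟨hBV.aemeasurable.restrict.aestronglyMeasurable, fun x => by
    rcases hu x with h | h <;> simp [h]⟩
  have hψb : IsBoundedBy ψ 1 := ⟨hψL.continuous.aestronglyMeasurable, hψ1⟩
  have hdb : IsBoundedBy (divergence φ) C₁ :=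
    ⟨(continuous_divergence hφs).aestronglyMeasurable, hC₁⟩
  have hDψ : IsBoundedBy (fun x => fderiv ℝ ψ x (φ x)) (C * 1) := by
    refine ⟨?_, fun x => ((fderiv ℝ ψ x).le_opNorm (φ x)).trans ?_⟩
    · have : Measurable fun x => fderiv ℝ ψ x (φ x) := by
        have h := (continuous_fst.clm_apply continuous_snd : Continuous fun q :
          (Space d →L[ℝ] ℝ) × Space d => q.1 q.2)
        exact h.measurable.comp ((measurable_fderiv ℝ ψ).prodMk hφs.continuous.measurable)
      exact this.aestronglyMeasurable
    · exact mul_le_mul (norm_fderiv_le_of_lipschitz ℝ hψL) (hφ1 x) (norm_nonneg _) C.2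
  have hTV : -∫ x in unitCell d, u x * divergence φ x ≤ totalVariation u := by
    refine le_csSup hBV.bounded ⟨fun x => -φ x, hφs.neg, hφp.comp fun w => -w,
      fun x => by rw [norm_neg]; exact hφ1 x, ?_⟩
    rw [← integral_neg]
    congr 1 with x
    have h : divergence (fun x => -φ x) x = -divergence φ x := by
      have h' : fderiv ℝ (fun x => -φ x) x = -fderiv ℝ φ x := fderiv_neg
      simp [divergence, h', Finset.sum_neg_distrib]
    rw [h]; ring
  have hsplit : -∫ x in unitCell d, u x * divergence φ x =
      ∫ x in unitCell d, (fderiv ℝ ψ x (φ x) - (u x - ψ x) * divergence φ x) := by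
    rw [integral_sub hDψ.integrable ((hum.sub hψb).mul hdb).integrable]
    have h1 := hψp.integral_mul_divergence hψL hφp hφs
    have h2 : ∫ x in unitCell d, (u x - ψ x) * divergence φ x =
        (∫ x in unitCell d, u x * divergence φ x) - ∫ x in unitCell d, ψ x * divergence φ x := by
      rw [← integral_sub (hum.mul hdb).integrable (hψb.mul hdb).integrable]
      congr 1 with x; ring
    rw [h2]; linarith
  have hind : ∫ x in unitCell d, S.indicator (fun _ => r⁻¹ * θ - 2 * C₁) x =
      (r⁻¹ * θ - 2 * C₁) * volume.real (S ∩ unitCell d) := by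
    rw [integral_indicator hSm, setIntegral_const, Measure.real, Measure.restrict_apply hSm,
      smul_eq_mul, mul_comm]
    rfl
  rw [← hind]
  refine le_trans ?_ (hsplit ▸ hTV)
  have hindb : Integrable (S.indicator fun _ => r⁻¹ * θ - 2 * C₁) (cellMeasure d) :=
    (integrable_const _).indicator hSm
  refine integral_mono_ae hindb (hDψ.sub ((hum.sub hψb).mul hdb)).integrable ?_
  have hΓ : ∀ᵐ x : Space d, x ∉ jumpSet u := measure_eq_zero_iff_ae_notMem.1 (volume_jumpSet hC)
  refine ae_restrict_of_ae ?_
  filter_upwards [hΓ, hθ, ae_plusSide hu, ae_minusSide hu,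
    (lipschitzWith_signedDist hu).ae_differentiableAt (μ := volume)] with x hx hxθ hxp hxm hxd
  have hpos := (jumpDist_pos hne).2 hx
  have hus : u x = sideSign u x := by
    rcases notMem_jumpSet_iff.1 hx with h | h
    · rw [hxp h, sideSign_plus h]
    · rw [hxm h, sideSign_minus hu h]
  by_cases hxr : jumpDist u x < r
  · rw [indicator_of_mem (show x ∈ S from ⟨hpos, hxr⟩), hψ_near x hxr hxd]
    have h1 := hxθ hpos hxr
    have h2 : r⁻¹ * θ ≤ r⁻¹ * fderiv ℝ (signedDist u) x (φ x) := by gcongr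
    have h3 : (u x - ψ x) * divergence φ x ≤ 2 * C₁ := by
      refine (le_abs_self _).trans ?_
      rw [abs_mul]
      refine mul_le_mul ?_ (hC₁ x) (abs_nonneg _) zero_le_two
      have := abs_sub (u x) (ψ x)
      linarith [hum.bound x, hψ1 x]
    rw [_root_.smul_apply, smul_eq_mul]
    linarith
  · rw [indicator_of_notMem (fun h => hxr h.2), hψ_far x (not_lt.1 hxr), hfar x (not_lt.1 hxr),
      hus]
    simp

theorem exists_volume_jumpDist_le {u : Space d → ℝ} (hBV : IsBVSign u) (hC : HasC2JumpSet u)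
    (hne : (jumpSet u).Nonempty) {K r₁ : ℝ} (hr₁ : 0 < r₁) (hK : 0 ≤ K)
    (hlip : ∀ y ∈ jumpSet u, ∀ y' ∈ jumpSet u, dist y y' < r₁ →
      dist (jumpNormal u y) (jumpNormal u y') ≤ K * dist y y') {η : ℝ} (hη : 0 < η) :
    ∃ r₂ > 0, ∀ r, 0 < r → r < r₂ →
      volume (jumpDist u ⁻¹' Ioc 0 r ∩ unitCell d) ≤
        ENNReal.ofReal ((1 + η) * totalVariation u * r) := by
  have hu := hBV.values
  have hΓ : ∀ᵐ x : Space d, x ∉ jumpSet u := measure_eq_zero_iff_ae_notMem.1 (volume_jumpSet hC)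
  choose π hπ hπd using exists_nearest (u := u) hne
  obtain ⟨τ, hτ0, hτ1, hτ2⟩ : ∃ τ > 0, 4 * τ < r₁ ∧ K * (4 * τ) ≤ 1 / 2 * (η / (1 + η)) := by
    have hc : 0 < η / (1 + η) := by positivity
    refine ⟨min (r₁ / 8) (η / (1 + η) / (8 * (K + 1))), by positivity, ?_, ?_⟩
    · have := min_le_left (r₁ / 8) (η / (1 + η) / (8 * (K + 1)))
      linarith
    · calc K * (4 * min (r₁ / 8) (η / (1 + η) / (8 * (K + 1))))
          ≤ (K + 1) * (4 * (η / (1 + η) / (8 * (K + 1)))) := by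
            gcongr
            · linarith
            · exact min_le_right _ _
        _ = _ := by field_simp; norm_num
  have hae : (fun x => jumpNormal u (π x)) =ᵐ[volume] gradient (signedDist u) := by
    filter_upwards [hΓ, (lipschitzWith_jumpDist u).ae_differentiableAt (μ := volume)] with x hx hxd
    exact (gradient_signedDist hu hC hne hx hxd (hπ x) (hπd x)).symm
  have hgm : Measurable (gradient (signedDist u)) :=
    (InnerProductSpace.toDual ℝ (Space d)).symm.continuous.measurable.comp
      (measurable_fderiv ℝ (signedDist u))
  obtain ⟨φ, hφs, hφp, hφ1, hφd⟩ := exists_mollification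
    (hgm.aestronglyMeasurable.congr hae.symm) (fun x => (norm_jumpNormal hu hC (hπ x)).le) hae
    (fun n x => by
      simp only [gradient, (isPeriodic_signedDist hBV.periodic).periodic_fderiv n x]) hτ0
  obtain ⟨C₁, hC₁0, hC₁⟩ := (isPeriodic_divergence hφp).exists_bound (continuous_divergence hφs)
  have hθ : ∀ᵐ x, 0 < jumpDist u x → jumpDist u x < τ →
      1 - K * (4 * τ) ≤ fderiv ℝ (signedDist u) x (φ x) := by
    filter_upwards [hae] with x hx _ hxτ
    have h1 : dist (φ x) (jumpNormal u (π x)) ≤ K * (4 * τ) := by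
      refine hφd x _ _ (by positivity) fun y hy => ?_
      have hyx : dist y x < τ := hy
      have hDy : jumpDist u y ≤ 2 * τ := by
        have := (lipschitzWith_jumpDist u).dist_le_mul y x
        rw [Real.dist_eq, NNReal.coe_one, one_mul] at this
        linarith [(abs_le.1 this).2]
      have h2 : dist (π y) (π x) ≤ 4 * τ := by
        have := dist_triangle4 (π y) y x (π x)
        rw [dist_comm (π y) y, hπd, hπd] at this
        linarith
      exact (hlip _ (hπ y) _ (hπ x) (h2.trans_lt hτ1)).trans (by gcongr)
    rw [← inner_gradient, ← hx]
    have hn : ‖jumpNormal u (π x)‖ = 1 := norm_jumpNormal hu hC (hπ x)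
    have h2 : inner ℝ (jumpNormal u (π x)) (φ x) =
        1 + inner ℝ (jumpNormal u (π x)) (φ x - jumpNormal u (π x)) := by
      rw [inner_sub_right, real_inner_self_eq_norm_sq, hn]; ring
    have h3 := abs_real_inner_le_norm (jumpNormal u (π x)) (φ x - jumpNormal u (π x))
    rw [hn, one_mul, ← dist_eq_norm] at h3
    rw [h2]
    linarith [(abs_le.1 h3).1]
  have hTV0 : 0 ≤ totalVariation u := le_csSup hBV.bounded ⟨fun _ => 0, contDiff_const,
    fun _ _ => rfl, fun x => by simp, by simp [divergence]⟩
  have hc : 0 < η / (1 + η) := by positivity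
  refine ⟨min τ (η / (1 + η) / (4 * (C₁ + 1))), by positivity, ?_⟩
  have hopen : ∀ r, 0 < r → r < min τ (η / (1 + η) / (4 * (C₁ + 1))) →
      volume (jumpDist u ⁻¹' Ioo 0 r ∩ unitCell d) ≤
        ENNReal.ofReal ((1 + η) * totalVariation u * r) := by
    intro r hr0 hr
    have h1 := volume_layer_mul_le_totalVariation hBV hC hne hφs hφp hφ1 hC₁ hr0
      (θ := 1 - K * (4 * τ)) (by
        filter_upwards [hθ] with x hx h1 h2
        exact hx h1 (h2.trans (hr.trans_le (min_le_left _ _))))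
    have hrC : 2 * C₁ * r ≤ 1 / 2 * (η / (1 + η)) := by
      calc 2 * C₁ * r ≤ 2 * (C₁ + 1) * (η / (1 + η) / (4 * (C₁ + 1))) := by
            gcongr
            · linarith
            · exact hr.le.trans (min_le_right _ _)
        _ = _ := by field_simp; norm_num
    have hfin : volume (jumpDist u ⁻¹' Ioo 0 r ∩ unitCell d) ≠ ⊤ :=
      measure_ne_top_of_subset inter_subset_right (by rw [volume_unitCell]; exact ENNReal.one_ne_top)
    rw [← ENNReal.ofReal_toReal hfin]
    refine ENNReal.ofReal_le_ofReal ?_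
    set V := volume.real (jumpDist u ⁻¹' Ioo 0 r ∩ unitCell d) with hV
    change V ≤ _
    have hV0 : 0 ≤ V := measureReal_nonneg
    have hc1 : 1 - η / (1 + η) = (1 + η)⁻¹ := by field_simp; ring
    have h2 : (1 + η)⁻¹ ≤ r * (r⁻¹ * (1 - K * (4 * τ)) - 2 * C₁) := by
      rw [mul_sub, mul_inv_cancel_left₀ hr0.ne', ← hc1]
      linarith
    have h3 : (1 + η)⁻¹ * V ≤ r * totalVariation u :=
      calc (1 + η)⁻¹ * V ≤ r * (r⁻¹ * (1 - K * (4 * τ)) - 2 * C₁) * V := by gcongr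
        _ ≤ r * totalVariation u := by rw [mul_assoc]; gcongr
    rw [inv_mul_le_iff₀ (by positivity)] at h3
    linarith
  intro r hr0 hr
  have hcont : Tendsto (fun s => ENNReal.ofReal ((1 + η) * totalVariation u * s)) (𝓝[>] r)
      (𝓝 (ENNReal.ofReal ((1 + η) * totalVariation u * r))) :=
    ((ENNReal.continuous_ofReal.comp (continuous_const.mul continuous_id)).tendsto r).mono_left
      nhdsWithin_le_nhds
  refine ge_of_tendsto hcont ?_
  filter_upwards [self_mem_nhdsWithin, nhdsWithin_le_nhds (gt_mem_nhds hr)] with s hs1 hs2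
  refine le_trans (measure_mono ?_) (hopen s (hr0.trans hs1) hs2)
  exact inter_subset_inter_left _ (preimage_mono fun t ht => ⟨ht.1, ht.2.trans_lt hs1⟩)

end

section
open Metric

variable {d : ℕ}

/-! ### The recovery profile around the jump set -/

theorem measure_le_smul_volume {m : Measure ℝ} {c : NNReal}
    (h : ∀ a b, m (Ioc a b) ≤ ENNReal.ofReal (c * (b - a))) : m ≤ c • (volume : Measure ℝ) := by
  rw [Real.volume_eq_stieltjes_id, ← StieltjesFunction.measure_smul]
  refine Measure.le_iff.2 fun S hS => ?_
  rw [StieltjesFunction.measure_def]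
  change m.toOuterMeasure S ≤ (c • StieltjesFunction.id : StieltjesFunction ℝ).outer S
  refine OuterMeasure.le_ofFunction.2 (fun T => ?_) S
  rw [StieltjesFunction.length, if_neg (not_isEmpty_of_nonempty ℝ)]
  refine le_iInf fun a => le_iInf fun b => le_iInf fun hT => ?_
  have hbot : (botSet : Set ℝ) = ∅ := by
    ext x
    simp [botSet]
  rw [hbot, sdiff_empty] at hT
  refine (measure_mono hT).trans ((h a b).trans (le_of_eq ?_))
  rw [mul_sub]
  rfl

theorem integral_comp_jumpDist_le {u : Space d → ℝ} {Λ b : ℝ} (hΛ : 0 ≤ Λ) (hb : 0 ≤ b)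
    (hvol : ∀ s t, 0 ≤ s → s ≤ t → t ≤ b →
      volume (jumpDist u ⁻¹' Ioc s t ∩ unitCell d) ≤ ENNReal.ofReal (Λ * (t - s)))
    {e : ℝ → ℝ} (he : Continuous e) (he0 : ∀ t, 0 ≤ e t) :
    ∫ x in unitCell d, (Ioc 0 b).indicator e (jumpDist u x) ≤ Λ * ∫ t in (0 : ℝ)..b, e t := by
  have hDm : Measurable (jumpDist u) := (lipschitzWith_jumpDist u).continuous.measurable
  set m := (cellMeasure d).map (jumpDist u) with hm
  have hle : m.restrict (Ioc 0 b) ≤ Real.toNNReal Λ • (volume : Measure ℝ) := by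
    refine measure_le_smul_volume fun s t => ?_
    rw [Measure.restrict_apply measurableSet_Ioc, Ioc_inter_Ioc,
      Measure.map_apply hDm measurableSet_Ioc,
      Measure.restrict_apply (hDm measurableSet_Ioc), Real.coe_toNNReal _ hΛ]
    rcases le_total (max s 0) (min t b) with h | h
    · refine (hvol _ _ (le_max_right _ _) h (min_le_right _ _)).trans ?_
      gcongr
      · exact min_le_left _ _
      · exact le_max_left _ _
    · rw [Ioc_eq_empty (not_lt.2 h), preimage_empty, empty_inter, measure_empty]
      exact zero_le
  have hle' : m.restrict (Ioc 0 b) ≤ Real.toNNReal Λ • (volume.restrict (Ioc 0 b) : Measure ℝ) := by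
    have := Measure.restrict_mono (le_refl (Ioc 0 b)) hle
    rwa [Measure.restrict_restrict measurableSet_Ioc, inter_self, Measure.restrict_smul] at this
  have hint : IntegrableOn e (Ioc 0 b) volume :=
    (he.integrableOn_Icc).mono_set Ioc_subset_Icc_self
  calc ∫ x in unitCell d, (Ioc 0 b).indicator e (jumpDist u x)
      = ∫ t, (Ioc 0 b).indicator e t ∂m := by
        rw [hm, integral_map hDm.aemeasurable]
        exact (he.measurable.indicator measurableSet_Ioc).aestronglyMeasurable
    _ = ∫ t, e t ∂(m.restrict (Ioc 0 b)) := integral_indicator measurableSet_Ioc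
    _ ≤ ∫ t, e t ∂(Real.toNNReal Λ • (volume.restrict (Ioc 0 b) : Measure ℝ)) :=
        integral_mono_measure hle' (Eventually.of_forall he0)
          (Integrable.smul_measure_nnreal hint)
    _ = Λ * ∫ t in (0 : ℝ)..b, e t := by
        rw [integral_smul_nnreal_measure, intervalIntegral.integral_of_le hb, NNReal.smul_def,
          Real.coe_toNNReal _ hΛ, smul_eq_mul]

theorem IsProfile.abs_eq_one {W U : ℝ → ℝ} {τ M : ℝ} (hU : IsProfile W U τ M) {y : ℝ}
    (hy : M ≤ |y|) : |U y| = 1 := by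
  rcases le_abs.1 hy with h | h
  · rw [hU.eq_one y h, abs_one]
  · rw [← abs_neg, ← hU.odd, hU.eq_one _ h, abs_one]

theorem totalVariation_nonneg {u : Space d → ℝ} (hBV : IsBVSign u) : 0 ≤ totalVariation u :=
  le_csSup hBV.bounded ⟨fun _ => 0, contDiff_const, fun _ _ => rfl, fun x => by simp,
    by simp [divergence]⟩

theorem IsDoubleWell.apply_of_abs_eq_one {W : ℝ → ℝ} (hW : IsDoubleWell d W) {s : ℝ}
    (hs : |s| = 1) : W s = 0 :=
  (hW.eq_zero_iff s).2 ((abs_eq zero_le_one).1 hs)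

/-- The Modica-Mortola energy of a profile composed with the signed distance. -/
theorem integral_energy_profile_le {W U : ℝ → ℝ} {τ M : ℝ} (hW : IsDoubleWell d W) (hτ : 0 < τ)
    (hU : IsProfile W U τ M) {L : NNReal} (hUL : LipschitzWith L U) {u : Space d → ℝ}
    (hu : ∀ x, u x = 1 ∨ u x = -1) (hC : HasC2JumpSet u) (hne : (jumpSet u).Nonempty) {ε Λ : ℝ}
    (hε : 0 < ε) (hΛ : 0 ≤ Λ)
    (hvol : ∀ s t, 0 ≤ s → s ≤ t → t ≤ M * ε →
      volume (jumpDist u ⁻¹' Ioc s t ∩ unitCell d) ≤ ENNReal.ofReal (Λ * (t - s))) :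
    ∫ x in unitCell d, (ε ^ 2 / 2 * ‖gradient (fun y => U (ε⁻¹ * signedDist u y)) x‖ ^ 2 +
        W (U (ε⁻¹ * signedDist u x))) ≤
      Λ * ε * ∫ y in (0 : ℝ)..M, 2 * (W (U y) + τ) := by
  have hM := hU.pos
  set e : ℝ → ℝ := fun t => 2 * (W (U (ε⁻¹ * t)) + τ) with he
  have hec : Continuous e := by
    have := hW.continuous.comp (hUL.continuous.comp (continuous_const.mul continuous_id (M := ℝ)
      (f := fun _ => ε⁻¹)))
    exact continuous_const.mul (this.add continuous_const)
  have he0 : ∀ t, 0 ≤ e t := fun t => by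
    have := hW.nonneg (U (ε⁻¹ * t))
    simp only [he]; positivity
  have hei : ∫ t in (0 : ℝ)..(M * ε), e t = ε * ∫ y in (0 : ℝ)..M, 2 * (W (U y) + τ) := by
    have := intervalIntegral.integral_comp_mul_left (a := 0) (b := M * ε)
      (fun y => 2 * (W (U y) + τ)) (inv_ne_zero hε.ne')
    rw [mul_zero, inv_inv, mul_comm M ε, inv_mul_cancel_left₀ hε.ne', smul_eq_mul] at this
    rw [mul_comm M ε, this]
  rw [mul_assoc, ← hei]
  refine le_trans ?_ (integral_comp_jumpDist_le hΛ (by positivity) hvol hec he0)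
  have hDm : Measurable (jumpDist u) := (lipschitzWith_jumpDist u).continuous.measurable
  have hint : Integrable (fun x => (Ioc 0 (M * ε)).indicator e (jumpDist u x)) (cellMeasure d) := by
    obtain ⟨B, hB⟩ := (isCompact_Icc (a := (0 : ℝ)) (b := M * ε)).exists_bound_of_continuousOn
      hec.continuousOn
    refine Integrable.of_bound (C := max B 0)
      ((hec.measurable.indicator measurableSet_Ioc).comp hDm).aestronglyMeasurable
      (Eventually.of_forall fun x => ?_)
    by_cases h : jumpDist u x ∈ Ioc 0 (M * ε)
    · rw [indicator_of_mem h]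
      exact (hB _ (Ioc_subset_Icc_self h)).trans (le_max_left _ _)
    · rw [indicator_of_notMem h, norm_zero]
      exact le_max_right _ _
  refine integral_mono_of_nonneg (Eventually.of_forall fun x => ?_) hint ?_
  · have := hW.nonneg (U (ε⁻¹ * signedDist u x))
    simp only [Pi.zero_apply]; positivity
  have hΓ : ∀ᵐ x : Space d, x ∉ jumpSet u := measure_eq_zero_iff_ae_notMem.1 (volume_jumpSet hC)
  refine ae_restrict_of_ae ?_
  filter_upwards [hΓ, (lipschitzWith_signedDist hu).ae_differentiableAt (μ := volume)] with x hx hxd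
  have hpos := (jumpDist_pos hne).2 hx
  have habs : |ε⁻¹ * signedDist u x| = ε⁻¹ * jumpDist u x := by
    rw [abs_mul, abs_of_pos (inv_pos.2 hε), abs_signedDist]
  by_cases hxM : jumpDist u x < M * ε
  · rw [indicator_of_mem (show jumpDist u x ∈ Ioc 0 (M * ε) from ⟨hpos, hxM.le⟩)]
    have hy : |ε⁻¹ * signedDist u x| < M := by
      rw [habs, inv_mul_lt_iff₀ hε, mul_comm]; exact hxM
    have hWU : W (U (ε⁻¹ * signedDist u x)) = W (U (ε⁻¹ * jumpDist u x)) := by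
      rw [signedDist]
      rcases (abs_eq zero_le_one).1 (abs_sideSign u x) with h | h
      · rw [h, one_mul]
      · rw [h, neg_one_mul, mul_neg, hU.odd, hW.even]
    have hder : HasFDerivAt (fun y => U (ε⁻¹ * signedDist u y))
        (Real.sqrt (2 * (W (U (ε⁻¹ * signedDist u x)) + τ)) •
          (ε⁻¹ • fderiv ℝ (signedDist u) x)) x :=
      (hU.hasDerivAt _ hy).comp_hasFDerivAt x (hxd.hasFDerivAt.const_mul ε⁻¹)
    have hρ1 : ‖fderiv ℝ (signedDist u) x‖ ≤ 1 := by
      exact_mod_cast norm_fderiv_le_of_lipschitz ℝ (lipschitzWith_signedDist hu)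
    have hw := hW.nonneg (U (ε⁻¹ * jumpDist u x))
    rw [norm_gradient, hder.fderiv, norm_smul, norm_smul, hWU, mul_pow, mul_pow, Real.norm_eq_abs,
      sq_abs, Real.sq_sqrt (by positivity), Real.norm_eq_abs, sq_abs]
    have h1 : ε ^ 2 / 2 * (2 * (W (U (ε⁻¹ * jumpDist u x)) + τ) *
        (ε⁻¹ ^ 2 * ‖fderiv ℝ (signedDist u) x‖ ^ 2)) =
        (W (U (ε⁻¹ * jumpDist u x)) + τ) * ‖fderiv ℝ (signedDist u) x‖ ^ 2 := by
      field_simp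
    rw [h1]
    have h2 : ‖fderiv ℝ (signedDist u) x‖ ^ 2 ≤ 1 := pow_le_one₀ (norm_nonneg _) hρ1
    simp only [he]
    nlinarith
  · have h1 : |U (ε⁻¹ * signedDist u x)| = 1 := hU.abs_eq_one (by
      rw [habs, ← div_eq_inv_mul, le_div_iff₀ hε]; exact not_lt.1 hxM)
    rw [norm_gradient, fderiv_eq_zero_of_abs_eq_one (f := fun y => U (ε⁻¹ * signedDist u y))
      (fun y => hU.abs_le_one _) h1, hW.apply_of_abs_eq_one h1, norm_zero]
    simpa using indicator_nonneg (fun t _ => he0 t) (jumpDist u x)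

/-- A Lipschitz approximation `v` of a `±1`-valued function `u`, equal to `u` off the set `L`. -/
structure IsRecovery (u v : Space d → ℝ) (L : Set (Space d)) : Prop where
  periodic : IsPeriodic v
  lipschitz : ∃ C, LipschitzWith C v
  abs_le_one : ∀ x, |v x| ≤ 1
  measurableSet : MeasurableSet L
  abs_eq_one : ∀ x, x ∉ L → |v x| = 1
  ae_eq : ∀ᵐ x, x ∉ L → v x = u x

theorem exists_recovery {W : ℝ → ℝ} (hW : IsDoubleWell d W) :
    ∃ A : ℝ, 0 < A ∧ ∀ τ : ℝ, 0 < τ → τ ≤ 1 → ∀ α : ℝ, α < 1 →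
      ∃ ε₀ : ℝ, 0 < ε₀ ∧ ∀ ε : ℝ, 0 < ε → ε ≤ ε₀ → ∀ u : Space d → ℝ, IsBVSign u →
        HasC2JumpSet u →
        (∀ x ∈ jumpSet u, ∀ k : ℝ, IsPrincipalCurvature u x k → |k| ≤ ε ^ (-α)) →
        ∃ (v : Space d → ℝ) (L : Set (Space d)), IsRecovery u v L ∧
          volume.real (L ∩ unitCell d) ≤ A * τ ^ (-(1 : ℝ) / 4) * (ε * totalVariation u) ∧
          ∫ x in unitCell d, (ε ^ 2 / 2 * ‖gradient v x‖ ^ 2 + W (v x)) ≤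
            (1 + 15 * Real.sqrt τ) * (ε / 2 * totalVariation u) := by
  obtain ⟨C, hC0, hprof⟩ := exists_profile hW
  refine ⟨4 * C, by positivity, fun τ hτ hτ1 α hα => ?_⟩
  obtain ⟨U, M, hU, ⟨LU, hUL⟩, hMC, hUint⟩ := hprof τ hτ hτ1
  have hM := hU.pos
  set η := Real.sqrt τ with hη
  have hη0 : 0 < η := Real.sqrt_pos.2 hτ
  have hη1 : η ≤ 1 := Real.sqrt_le_one.2 hτ1
  have hlim : Tendsto (fun ε : ℝ => (1 + 8 * M * ε ^ (1 - α)) ^ d) (𝓝[>] 0) (𝓝 1) := by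
    have h1 : Tendsto (fun ε : ℝ => ε ^ (1 - α)) (𝓝[>] 0) (𝓝 0) := by
      have := (Real.continuousAt_rpow_const 0 (1 - α) (Or.inr (by linarith))).tendsto
      rw [Real.zero_rpow (by linarith)] at this
      exact this.mono_left nhdsWithin_le_nhds
    simpa using ((h1.const_mul (8 * M)).const_add 1).pow d
  have hev := hlim.eventually_le_const (show (1 : ℝ) < 1 + η by linarith)
  obtain ⟨ε₁, hε₁, hε₁'⟩ := mem_nhdsGT_iff_exists_Ioc_subset.1 hev
  refine ⟨ε₁, hε₁, fun ε hε hεε u hBV hC2 hcurv => ?_⟩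
  have hsmall : (1 + 8 * M * ε ^ (1 - α)) ^ d ≤ 1 + η := hε₁' ⟨hε, hεε⟩
  have hu := hBV.values
  have hTV := totalVariation_nonneg hBV
  rcases (jumpSet u).eq_empty_or_nonempty with hempty | hne
  · have hconst : ∃ s : ℝ, |s| = 1 ∧ ∀ᵐ x, s = u x := by
      have hno : ∀ x ∈ (univ : Set (Space d)), x ∉ jumpSet u := fun x _ => by simp [hempty]
      rcases notMem_jumpSet_iff.1 (hno 0 trivial) with h | h
      · have := subset_plusSide hu isPreconnected_univ hno trivial h
        refine ⟨1, abs_one, ?_⟩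
        filter_upwards [ae_plusSide hu] with x hx
        exact (hx (this trivial)).symm
      · have := subset_minusSide hu isPreconnected_univ hno trivial h
        refine ⟨-1, by simp, ?_⟩
        filter_upwards [ae_minusSide hu] with x hx
        exact (hx (this trivial)).symm
    obtain ⟨s, hs, hsu⟩ := hconst
    refine ⟨fun _ => s, ∅, ⟨fun _ _ => rfl, ⟨0, LipschitzWith.const s⟩, fun _ => hs.le,
      MeasurableSet.empty, fun _ _ => hs, hsu.mono fun x hx _ => hx⟩, ?_, ?_⟩
    · rw [empty_inter, measureReal_empty]; positivity
    · have hz : ∀ x : Space d, ε ^ 2 / 2 * ‖gradient (fun _ : Space d => s) x‖ ^ 2 + W s = 0 := by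
        intro x
        rw [norm_gradient, hW.apply_of_abs_eq_one hs]
        simp
      simp only [hz, integral_zero]
      positivity
  have hK0 : 0 < ε ^ (-α) := Real.rpow_pos_of_pos hε _
  obtain ⟨r₁, hr₁, hlip⟩ := exists_uniform_lipschitz_jumpNormal hBV.periodic hu hC2 hK0.le hcurv
    (show ε ^ (-α) < 2 * ε ^ (-α) by linarith)
  obtain ⟨r₂, hr₂, hcontent⟩ := exists_volume_jumpDist_le hBV hC2 hne hr₁ (by positivity) hlip hη0
  set Λ := (1 + η) * ((1 + η) * totalVariation u) with hΛ
  have hΛ0 : 0 ≤ Λ := by positivity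
  have hvol : ∀ s t, 0 ≤ s → s ≤ t → t ≤ M * ε →
      volume (jumpDist u ⁻¹' Ioc s t ∩ unitCell d) ≤ ENNReal.ofReal (Λ * (t - s)) := by
    intro s t hs hst ht
    refine (volume_jumpDist_Ioc_le hBV.periodic hu hC2 hne hr₁ hr₂ hlip (by positivity) hcontent
      hs hst ht).trans (ENNReal.ofReal_le_ofReal ?_)
    have hexp : 1 + 4 * (M * ε) * (2 * ε ^ (-α)) = 1 + 8 * M * ε ^ (1 - α) := by
      rw [sub_eq_add_neg, Real.rpow_add hε, Real.rpow_one]; ring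
    rw [hexp, hΛ]
    have : 0 ≤ t - s := sub_nonneg.2 hst
    gcongr
  have hDm : Measurable (jumpDist u) := (lipschitzWith_jumpDist u).continuous.measurable
  have habs : ∀ x, |ε⁻¹ * signedDist u x| = ε⁻¹ * jumpDist u x := fun x => by
    rw [abs_mul, abs_of_pos (inv_pos.2 hε), abs_signedDist]
  have hfarM : ∀ x, x ∉ jumpDist u ⁻¹' Iic (M * ε) → M ≤ ε⁻¹ * jumpDist u x := fun x hx => by
    rw [← div_eq_inv_mul, le_div_iff₀ hε]
    exact (not_le.1 hx).le
  have hΓ : ∀ᵐ x : Space d, x ∉ jumpSet u := measure_eq_zero_iff_ae_notMem.1 (volume_jumpSet hC2)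
  refine ⟨fun x => U (ε⁻¹ * signedDist u x), jumpDist u ⁻¹' Iic (M * ε), ⟨?_, ?_,
    fun x => hU.abs_le_one _, hDm measurableSet_Iic, ?_, ?_⟩, ?_, ?_⟩
  · exact (isPeriodic_signedDist hBV.periodic).comp fun s => U (ε⁻¹ * s)
  · have h1 : LipschitzWith (Real.toNNReal ε⁻¹) fun s : ℝ => ε⁻¹ * s := by
      refine LipschitzWith.of_dist_le_mul fun s t => ?_
      rw [Real.dist_eq, Real.dist_eq, ← mul_sub, abs_mul, abs_of_pos (inv_pos.2 hε),
        Real.coe_toNNReal _ (inv_pos.2 hε).le]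
    exact ⟨_, hUL.comp (h1.comp (lipschitzWith_signedDist hu))⟩
  · intro x hx
    exact hU.abs_eq_one (by rw [habs]; exact hfarM x hx)
  · filter_upwards [hΓ, ae_plusSide hu, ae_minusSide hu] with x hx hxp hxm hxL
    have h := hfarM x hxL
    rw [signedDist]
    rcases notMem_jumpSet_iff.1 hx with h' | h'
    · rw [sideSign_plus h', one_mul, hU.eq_one _ h, hxp h']
    · rw [sideSign_minus hu h', neg_one_mul, mul_neg, hU.odd, hU.eq_one _ h, hxm h']
  · have hle : volume (jumpDist u ⁻¹' Iic (M * ε) ∩ unitCell d) ≤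
        ENNReal.ofReal (Λ * (M * ε)) := by
      have h0 := hvol 0 (M * ε) le_rfl (by positivity) le_rfl
      rw [sub_zero] at h0
      refine le_trans (measure_mono_ae ?_) h0
      filter_upwards [hΓ] with x hx h
      exact ⟨⟨(jumpDist_pos hne).2 hx, h.1⟩, h.2⟩
    have hreal : volume.real (jumpDist u ⁻¹' Iic (M * ε) ∩ unitCell d) ≤ Λ * (M * ε) :=
      ENNReal.toReal_le_of_le_ofReal (by positivity) hle
    refine hreal.trans ?_
    have hη4 : (1 + η) * (1 + η) ≤ 4 := by nlinarith
    have hΛ4 : Λ ≤ 4 * totalVariation u := by rw [hΛ, ← mul_assoc]; gcongr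
    calc Λ * (M * ε) ≤ 4 * totalVariation u * (C * τ ^ (-(1 : ℝ) / 4) * ε) := by gcongr
      _ = _ := by ring
  · refine (integral_energy_profile_le hW hτ hU hUL hu hC2 hne hε hΛ0 hvol).trans ?_
    have hs2 : Real.sqrt (2 * τ) ≤ 3 / 2 * η := by
      rw [Real.sqrt_mul zero_le_two]
      gcongr
      rw [Real.sqrt_le_left (by norm_num)]
      norm_num
    calc Λ * ε * ∫ y in (0 : ℝ)..M, 2 * (W (U y) + τ)
        ≤ Λ * ε * (1 / 2 + 3 / 2 * η) := by gcongr; exact hUint.trans (by linarith)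
      _ = ((1 + η) ^ 2 * (1 + 3 * η)) * (ε / 2 * totalVariation u) := by rw [hΛ]; ring
      _ ≤ _ := by
          gcongr
          nlinarith [mul_nonneg hη0.le (sub_nonneg.2 hη1), mul_nonneg (mul_nonneg hη0.le hη0.le)
            (sub_nonneg.2 hη1)]

end

section
variable {d : ℕ}

/-! ### The competitor -/

theorem gradient_component (v : Space d → ℝ) (x : Space d) (i : Fin d) :
    gradient v x i = fderiv ℝ v x (EuclideanSpace.single i 1) := by
  rw [← inner_gradient, EuclideanSpace.inner_single_right]
  simp

theorem IsBoundedBy.memLp {f : Space d → ℝ} {C : ℝ} (hf : IsBoundedBy f C) (p : ENNReal) :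
    MemLp f p (cellMeasure d) :=
  MemLp.of_bound hf.meas C (ae_of_all _ hf.bound)

theorem IsDoubleWell.isBoundedBy_comp {W : ℝ → ℝ} (hW : IsDoubleWell d W) {f : Space d → ℝ}
    {C : ℝ} (hf : IsBoundedBy f C) : ∃ C', IsBoundedBy (fun x => W (f x)) C' := by
  obtain ⟨B, hB⟩ := (isCompact_Icc (a := -C) (b := C)).exists_bound_of_continuousOn
    hW.continuous.continuousOn
  exact ⟨B, hW.continuous.comp_aestronglyMeasurable hf.meas,
    fun x => hB _ (abs_le.1 (hf.bound x))⟩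

theorem IsDoubleWell.exists_apply_sub_le {W : ℝ → ℝ} (hW : IsDoubleWell d W) :
    ∃ B, 0 < B ∧ ∀ s w θ, |s| ≤ 1 → |w| ≤ θ → screening W ^ 2 * θ ≤ 1 →
      W (s - screening W ^ 2 * w) ≤ W s + screening W ^ 2 / 2 * w ^ 2 + B * θ * (w ^ 2 + 1) ∧
      (|s| = 1 → W (s - screening W ^ 2 * w) ≤
        W s + screening W ^ 2 / 2 * w ^ 2 + B * θ * w ^ 2) := by
  obtain ⟨A, hA, hAW⟩ := hW.exists_taylor
  obtain ⟨B, hB, hBW⟩ := hW.exists_lipschitz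
  have hκ := hW.screening_pos
  set κ := screening W
  refine ⟨A * κ ^ 6 + B * κ ^ 2, by positivity, fun s w θ hs hw hθ => ?_⟩
  have hθ0 : 0 ≤ θ := (abs_nonneg _).trans hw
  have hh : |κ ^ 2 * w| = κ ^ 2 * |w| := by rw [abs_mul, abs_of_pos (by positivity)]
  have hh1 : |κ ^ 2 * w| ≤ 1 := by
    rw [hh]
    exact (by gcongr : κ ^ 2 * |w| ≤ κ ^ 2 * θ).trans hθ
  constructor
  · have h1 := hBW s (-(κ ^ 2 * w)) hs (by rwa [abs_neg])
    rw [abs_neg, hh, ← sub_eq_add_neg] at h1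
    have h2 : B * (κ ^ 2 * |w|) ≤ B * (κ ^ 2 * θ) := by gcongr
    have h3 : 0 ≤ κ ^ 2 / 2 * w ^ 2 := by positivity
    have h4 : 0 ≤ A * κ ^ 6 * θ * (w ^ 2 + 1) + B * κ ^ 2 * θ * w ^ 2 := by positivity
    linarith
  · intro hs1
    have hkey : ∀ h : ℝ, |h| = κ ^ 2 * |w| → W (1 + h) ≤
        κ ^ 2 / 2 * w ^ 2 + (A * κ ^ 6 + B * κ ^ 2) * θ * w ^ 2 := by
      intro h hhw
      have h1 := (abs_le.1 (hAW h (by rw [hhw, ← hh]; exact hh1))).2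
      have h2 : h ^ 2 = κ ^ 4 * w ^ 2 := by
        rw [← sq_abs, hhw, mul_pow, sq_abs]; ring
      have h3 : |h| ^ 3 ≤ κ ^ 6 * (θ * w ^ 2) := by
        rw [hhw]
        calc (κ ^ 2 * |w|) ^ 3 = κ ^ 6 * (|w| * |w| ^ 2) := by ring
          _ ≤ κ ^ 6 * (θ * w ^ 2) := by rw [sq_abs]; gcongr
      have h4 : h ^ 2 / (2 * κ ^ 2) = κ ^ 2 / 2 * w ^ 2 := by rw [h2]; field_simp
      have h5 : 0 ≤ B * κ ^ 2 * θ * w ^ 2 := by positivity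
      have h6 : A * |h| ^ 3 ≤ A * (κ ^ 6 * (θ * w ^ 2)) := by gcongr
      rw [h4] at h1
      linarith
    rw [hW.apply_of_abs_eq_one hs1, zero_add]
    rcases (abs_eq zero_le_one).1 hs1 with rfl | rfl
    · rw [sub_eq_add_neg]
      exact hkey _ (by rw [abs_neg, hh])
    · rw [show -1 - κ ^ 2 * w = -(1 + κ ^ 2 * w) by ring, hW.even]
      exact hkey _ hh

theorem exists_competitor {W : ℝ → ℝ} (hW : IsDoubleWell d W) :
    ∃ B : ℝ, 0 < B ∧ ∀ (u₀ v : Space d → ℝ) (L : Set (Space d)), IsRecovery u₀ v L →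
      ∀ ε ubar θ : ℝ,
      (∀ x, |potential (greenScreened (screening W)) (fun y => v y - ubar) x| ≤ θ) →
      screening W ^ 2 * θ ≤ 1 →
      ∃ (u : Space d → ℝ) (Du : Space d → Space d), IsH1 u Du ∧
        IntegrableOn (fun x => W (u x)) (unitCell d) ∧ ∫ x in unitCell d, u x = ubar ∧
        diffuseEnergy W ε ubar u Du ≤
          (∫ x in unitCell d, (ε ^ 2 / 2 * ‖gradient v x‖ ^ 2 + W (v x))) +
          longRangeEnergy (greenScreened (screening W)) (fun x => v x - ubar) +
          B * θ * ((∫ x in unitCell d,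
            potential (greenScreened (screening W)) (fun y => v y - ubar) x ^ 2) +
            volume.real (L ∩ unitCell d)) := by
  obtain ⟨B, hB, hBW⟩ := hW.exists_apply_sub_le
  refine ⟨B, hB, fun u₀ v L hv ε ubar θ hθ hθ1 => ?_⟩
  have hκ := hW.screening_pos
  set κ := screening W
  obtain ⟨C, hL⟩ := hv.lipschitz
  have hvb : IsBoundedBy v 1 := ⟨hL.continuous.aestronglyMeasurable, hv.abs_le_one⟩
  set g : Space d → ℝ := fun x => v x - ubar with hg
  have hgb : IsBoundedBy g (1 + |ubar|) := hvb.sub (isBoundedBy_const ubar)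
  have hgp : IsPeriodic g := hv.periodic.comp fun s => s - ubar
  have hgL : LipschitzWith C g := LipschitzWith.of_dist_le_mul fun x y => by
    simpa [hg, Real.dist_eq] using hL.dist_le_mul x y
  have hfd : ∀ x, fderiv ℝ g x = fderiv ℝ v x := fun x => fderiv_sub_const _
  set w := potential (greenScreened κ) g with hw
  have hwb := isBoundedBy_potential hκ hgb
  rw [← hw] at hwb
  let D : Fin d → Space d → ℝ := fun i x => fderiv ℝ v x (EuclideanSpace.single i 1)
  have hDb : ∀ i, IsBoundedBy (D i) _ := fun i => isBoundedBy_fderiv hL _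
  have hDG := fun i => (hDb i).sub ((isBoundedBy_potential hκ (hDb i)).const_mul (κ ^ 2))
  have hub : IsBoundedBy (fun x => v x - κ ^ 2 * w x) _ := hvb.sub (hwb.const_mul (κ ^ 2))
  let Du : Space d → Space d := fun x =>
    WithLp.toLp 2 fun i => D i x - κ ^ 2 * potential (greenScreened κ) (D i) x
  have hWu := hW.isBoundedBy_comp hub
  have hWv := hW.isBoundedBy_comp hvb
  obtain ⟨_, hWu⟩ := hWu
  obtain ⟨_, hWv⟩ := hWv
  have hDuL : MemLp Du 2 (cellMeasure d) := memLp_piLp_iff.2 fun i => (hDG i).memLp 2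
  refine ⟨fun x => v x - κ ^ 2 * w x, Du, ⟨?_, ?_, hub.memLp 2, hDuL, ?_⟩, hWu.integrable, ?_, ?_⟩
  · intro n x
    simp only [hv.periodic n x, hw, isPeriodic_potential_screened κ g n x]
  · intro n x
    simp only [Du, D, hv.periodic.periodic_fderiv n x,
      isPeriodic_potential_screened κ _ n x]
  · intro φ hφ hφp i
    have h1 := hv.periodic.isWeakPartial hL i φ hφ hφp
    have hgw : IsWeakPartial i g (D i) := by
      have := hgp.isWeakPartial hgL i
      simp only [hfd] at this
      exact this
    have h2 := hgw.potential hκ hgb (hDb i) φ hφ hφp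
    obtain ⟨_, hφb⟩ := hφp.isBoundedBy_of_continuous hφ.continuous
    obtain ⟨_, hφ'b⟩ := (hφp.periodic_fderiv.comp fun T => T (EuclideanSpace.single i 1)
      ).isBoundedBy_of_continuous
        ((hφ.continuous_fderiv (by simp)).clm_apply continuous_const)
    have e1 : ∀ x, (v x - κ ^ 2 * w x) * fderiv ℝ φ x (EuclideanSpace.single i 1) =
        v x * fderiv ℝ φ x (EuclideanSpace.single i 1) -
          κ ^ 2 * (w x * fderiv ℝ φ x (EuclideanSpace.single i 1)) := fun x => by ring
    have e2 : ∀ x, Du x i * φ x =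
        D i x * φ x - κ ^ 2 * (potential (greenScreened κ) (D i) x * φ x) := fun x => by
      simp only [Du]; ring
    simp only [e1, e2]
    rw [integral_sub (hvb.mul hφ'b).integrable ((hwb.mul hφ'b).const_mul _).integrable,
      integral_sub ((hDb i).mul hφb).integrable
        (((isBoundedBy_potential hκ (hDb i)).mul hφb).const_mul _).integrable,
      integral_const_mul, integral_const_mul, h1, h2]
    ring
  · rw [integral_sub hvb.integrable (hwb.const_mul _).integrable, integral_const_mul,
      integral_potential_screened hκ hgb, hg,
      integral_sub hvb.integrable (isBoundedBy_const ubar).integrable]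
    simp
  have hlong : longRangeEnergy greenNeutral (fun x => v x - κ ^ 2 * w x - ubar) =
      longRangeEnergy (greenScreened κ) g - κ ^ 2 / 2 * ∫ x in unitCell d, w x ^ 2 := by
    rw [hw, ← longRangeEnergy_neutral_sub_potential hκ hgb]
    congr 1
    ext x
    simp only [hg]; ring
  have hsq : ∀ {f : Space d → ℝ} {C : ℝ}, IsBoundedBy f C →
      Integrable (fun x => f x ^ 2) (cellMeasure d) := fun hf => by
    simpa only [sq] using (hf.mul hf).integrable
  have hnormDu : ∀ x, ‖Du x‖ ^ 2 =
      ∑ i, (D i x - κ ^ 2 * potential (greenScreened κ) (D i) x) ^ 2 := fun x => by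
    rw [EuclideanSpace.real_norm_sq_eq]
  have hnormv : ∀ x, ‖gradient v x‖ ^ 2 = ∑ i, D i x ^ 2 := fun x => by
    rw [EuclideanSpace.real_norm_sq_eq]
    simp only [gradient_component, D]
  have hiDu : Integrable (fun x => ‖Du x‖ ^ 2) (cellMeasure d) := by
    simp only [hnormDu]
    exact integrable_finsetSum _ fun i _ => hsq (hDG i)
  have hiv : Integrable (fun x => ‖gradient v x‖ ^ 2) (cellMeasure d) := by
    simp only [hnormv]
    exact integrable_finsetSum _ fun i _ => hsq (hDb i)
  have hgrad : ∫ x in unitCell d, ‖Du x‖ ^ 2 ≤ ∫ x in unitCell d, ‖gradient v x‖ ^ 2 := by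
    simp only [hnormDu, hnormv]
    rw [integral_finsetSum _ fun i _ => hsq (hDG i), integral_finsetSum _ fun i _ => hsq (hDb i)]
    exact Finset.sum_le_sum fun i _ => integral_sub_potential_sq_le hκ (hDb i)
  have hind : Integrable (L.indicator fun _ => (1 : ℝ)) (cellMeasure d) :=
    (integrable_const _).indicator hv.measurableSet
  have hindv : ∫ x in unitCell d, L.indicator (fun _ => (1 : ℝ)) x =
      volume.real (L ∩ unitCell d) := by
    rw [integral_indicator hv.measurableSet, setIntegral_const, Measure.real,
      Measure.restrict_apply hv.measurableSet, smul_eq_mul, mul_one]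
    rfl
  have hpot : ∫ x in unitCell d, W (v x - κ ^ 2 * w x) ≤
      (∫ x in unitCell d, W (v x)) + κ ^ 2 / 2 * (∫ x in unitCell d, w x ^ 2) +
        B * θ * ((∫ x in unitCell d, w x ^ 2) + volume.real (L ∩ unitCell d)) := by
    have hθ0 : 0 ≤ θ := (abs_nonneg _).trans (hθ 0)
    have hi₁ : Integrable (fun x => W (v x) + κ ^ 2 / 2 * w x ^ 2) (cellMeasure d) :=
      hWv.integrable.add ((hsq hwb).const_mul _)
    have hi₂ : Integrable (fun x => w x ^ 2 + L.indicator (fun _ => (1 : ℝ)) x) (cellMeasure d) :=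
      (hsq hwb).add hind
    calc ∫ x in unitCell d, W (v x - κ ^ 2 * w x)
        ≤ ∫ x in unitCell d, (W (v x) + κ ^ 2 / 2 * w x ^ 2 +
            B * θ * (w x ^ 2 + L.indicator (fun _ => (1 : ℝ)) x)) := by
          refine integral_mono hWu.integrable (hi₁.add (hi₂.const_mul _)) fun x => ?_
          obtain ⟨h1, h2⟩ := hBW (v x) (w x) θ (hv.abs_le_one x) (hθ x) hθ1
          by_cases hx : x ∈ L
          · simpa only [indicator_of_mem hx] using h1
          · simpa only [indicator_of_notMem hx, add_zero] using h2 (hv.abs_eq_one x hx)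
      _ = _ := by
          rw [integral_add hi₁ (hi₂.const_mul _), integral_add hWv.integrable ((hsq hwb).const_mul _), integral_const_mul,
            integral_const_mul, integral_add (hsq hwb) hind, hindv]
  unfold diffuseEnergy
  rw [hlong, integral_add (hiDu.const_mul _) hWu.integrable,
    integral_add (hiv.const_mul _) hWv.integrable, integral_const_mul, integral_const_mul]
  have hg2 : ε ^ 2 / 2 * ∫ x in unitCell d, ‖Du x‖ ^ 2 ≤
      ε ^ 2 / 2 * ∫ x in unitCell d, ‖gradient v x‖ ^ 2 := by gcongr
  linarith

theorem longRangeEnergy_add_le {κ : ℝ} (hκ : 0 < κ) {f h : Space d → ℝ} {C C' a b : ℝ}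
    (hf : IsBoundedBy f C) (hh : IsBoundedBy h C')
    (ha : ∀ x, |potential (greenScreened κ) f x| ≤ a)
    (hb : ∀ x, |potential (greenScreened κ) h x| ≤ b) :
    longRangeEnergy (greenScreened κ) (fun x => f x + h x) ≤
      longRangeEnergy (greenScreened κ) f + (a + b) * ∫ x in unitCell d, |h x| := by
  have hb0 : 0 ≤ b := (abs_nonneg _).trans (hb 0)
  have hF := isBoundedBy_potential hκ hf
  have hH := isBoundedBy_potential hκ hh
  have hcross : ∀ {p : Space d → ℝ} {c : ℝ} {C : ℝ}, IsBoundedBy p C → (∀ x, |p x| ≤ c) →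
      ∫ x in unitCell d, h x * p x ≤ c * ∫ x in unitCell d, |h x| := by
    intro p c C hp hc
    rw [← integral_const_mul]
    refine integral_mono (hh.mul hp).integrable (hh.integrable.abs.const_mul _) fun x => ?_
    refine (le_abs_self _).trans ?_
    rw [abs_mul, mul_comm]
    exact mul_le_mul_of_nonneg_right (hc x) (abs_nonneg _)
  have h1 := hcross hF ha
  have h2 := hcross hH hb
  have h0 : 0 ≤ b * ∫ x in unitCell d, |h x| :=
    mul_nonneg hb0 (integral_nonneg fun _ => abs_nonneg _)
  rw [longRangeEnergy_eq, longRangeEnergy_eq]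
  have e : ∀ x, (f x + h x) * potential (greenScreened κ) (fun y => f y + h y) x =
      (f x * potential (greenScreened κ) f x + f x * potential (greenScreened κ) h x) +
        (h x * potential (greenScreened κ) f x + h x * potential (greenScreened κ) h x) :=
    fun x => by rw [potential_screened_add hκ hf hh]; ring
  simp only [e]
  rw [integral_add ((hf.mul hF).add (hf.mul hH)).integrable
      ((hh.mul hF).add (hh.mul hH)).integrable,
    integral_add (hf.mul hF).integrable (hf.mul hH).integrable,
    integral_add (hh.mul hF).integrable (hh.mul hH).integrable,
    integral_mul_potential_comm hκ hf hh]
  linarith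

theorem IsRecovery.integral_abs_sub_le {u v : Space d → ℝ} {L : Set (Space d)}
    (h : IsRecovery u v L) (hu : ∀ x, u x = 1 ∨ u x = -1) :
    ∫ x in unitCell d, |v x - u x| ≤ 2 * volume.real (L ∩ unitCell d) := by
  have hind : Integrable (L.indicator fun _ => (2 : ℝ)) (cellMeasure d) :=
    (integrable_const _).indicator h.measurableSet
  have hindv : ∫ x in unitCell d, L.indicator (fun _ => (2 : ℝ)) x =
      2 * volume.real (L ∩ unitCell d) := by
    rw [integral_indicator h.measurableSet, setIntegral_const, Measure.real,
      Measure.restrict_apply h.measurableSet, smul_eq_mul, mul_comm]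
    rfl
  rw [← hindv]
  refine integral_mono_of_nonneg (Eventually.of_forall fun _ => abs_nonneg _) hind
    (ae_restrict_of_ae ?_)
  filter_upwards [h.ae_eq] with x hx
  by_cases hxL : x ∈ L
  · rw [indicator_of_mem hxL]
    have h1 := abs_sub (v x) (u x)
    have h2 : |u x| = 1 := by rcases hu x with h | h <;> simp [h]
    linarith [h.abs_le_one x]
  · rw [indicator_of_notMem hxL, hx hxL, sub_self, abs_zero]

theorem exists_abs_potential_le_of_recovery (d : ℕ) {κ A : ℝ} (hκ : 0 < κ) (hA : 0 < A) :
    ∃ c : ℝ, 0 < c ∧ ∀ s : ℝ, 0 < s → s ≤ 1 → ∀ (h : Space d → ℝ) (E : ℝ), IsBoundedBy h 2 →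
      ∫ x in unitCell d, |h x| ≤ A / s * E → E ≤ s ^ (2 * (d + 3)) →
      ∀ x, |potential (greenScreened κ) h x| ≤ c * s ^ 4 := by
  obtain ⟨P, hP, hpot⟩ := abs_potential_le d
  refine ⟨2 + P * A / κ ^ 2, by positivity, fun s hs hs1 h E hhb hm hE x => ?_⟩
  refine (hpot κ hκ h 2 hhb (s ^ 4) (by positivity) (pow_le_one₀ hs.le hs1) x).trans ?_
  have hroot : (s ^ 4) ^ (-(d : ℝ) / 2) * s ^ (2 * (d + 3)) = s ^ 6 := by
    rw [← Real.rpow_natCast s 4, ← Real.rpow_mul hs.le, ← Real.rpow_natCast, ← Real.rpow_add hs,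
      ← Real.rpow_natCast]
    congr 1
    push_cast
    ring
  have h1 : P / κ ^ 2 * (s ^ 4) ^ (-(d : ℝ) / 2) * ∫ y in unitCell d, |h y| ≤
      P * A / κ ^ 2 * s ^ 4 :=
    calc P / κ ^ 2 * (s ^ 4) ^ (-(d : ℝ) / 2) * ∫ y in unitCell d, |h y|
        ≤ P / κ ^ 2 * (s ^ 4) ^ (-(d : ℝ) / 2) * (A / s * s ^ (2 * (d + 3))) := by
          gcongr
          exact hm.trans (by gcongr)
      _ = P * A / κ ^ 2 / s * ((s ^ 4) ^ (-(d : ℝ) / 2) * s ^ (2 * (d + 3))) := by ring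
      _ = P * A / κ ^ 2 * s ^ 4 * s := by rw [hroot]; field_simp
      _ ≤ P * A / κ ^ 2 * s ^ 4 := mul_le_of_le_one_right (by positivity) hs1
  linarith

/-- The bookkeeping of the error terms. -/
theorem add_errors_le {A B b c s E e ℓ ℓ' v q V : ℝ} (hB : 0 < B) (hc : 0 < c) (hb : 0 < b)
    (hs : 0 < s) (hs1 : s ≤ 1) (he : 0 ≤ e) (hℓ : 0 ≤ ℓ) (hE : E = e + ℓ)
    (hsa : (24 * A * c + B * c * (b + 12 * A)) * s ≤ 1 / 2)
    (hv : v ≤ (1 + 15 * (s ^ 2 / 36)) * e) (hℓ' : ℓ' ≤ ℓ + 24 * A * c * s ^ 3 * E)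
    (hq : q ≤ b * E) (hV : V ≤ 12 * A / s * E) :
    v + ℓ' + B * (c * s ^ 4) * (q + V) ≤ (1 + s ^ 2) * E := by
  have hE0 : 0 ≤ E := by linarith
  have herr : B * (c * s ^ 4) * (q + V) ≤ B * c * (b + 12 * A) * s ^ 3 * E :=
    calc _ ≤ B * (c * s ^ 4) * (b * E + 12 * A / s * E) := by gcongr
      _ = B * c * (b * s + 12 * A) * s ^ 3 * E := by field_simp
      _ ≤ B * c * (b * 1 + 12 * A) * s ^ 3 * E := by gcongr
      _ = _ := by rw [mul_one]
  have hsum : 24 * A * c * s ^ 3 * E + B * c * (b + 12 * A) * s ^ 3 * E ≤ 1 / 2 * (s ^ 2 * E) :=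
    calc _ = (24 * A * c + B * c * (b + 12 * A)) * s * (s ^ 2 * E) := by ring
      _ ≤ _ := by gcongr
  have h1 : s ^ 2 * e ≤ s ^ 2 * E := by gcongr; linarith
  have h2 : 0 ≤ s ^ 2 * E := by positivity
  linarith

theorem exists_competitor_of_recovery {W : ℝ → ℝ} (hW : IsDoubleWell d W) {A : ℝ} (hA : 0 < A) :
    ∃ s₀ : ℝ, 0 < s₀ ∧ s₀ ≤ 1 ∧ ∀ s : ℝ, 0 < s → s ≤ s₀ → ∀ (ε ubar : ℝ)
      (u₀ v : Space d → ℝ) (L : Set (Space d)), 0 < ε → IsBVSign u₀ → IsRecovery u₀ v L →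
      volume.real (L ∩ unitCell d) ≤ A * (6 / s) * (ε * totalVariation u₀) →
      ∫ x in unitCell d, (ε ^ 2 / 2 * ‖gradient v x‖ ^ 2 + W (v x)) ≤
        (1 + 15 * (s ^ 2 / 36)) * (ε / 2 * totalVariation u₀) →
      (∀ x, |potential (greenScreened (screening W)) (fun y => u₀ y - ubar) x| ≤ s ^ 4) →
      sharpEnergy (screening W) ε ubar u₀ ≤ s ^ (2 * (d + 3)) →
      ∃ (u : Space d → ℝ) (Du : Space d → Space d), IsH1 u Du ∧
        IntegrableOn (fun x => W (u x)) (unitCell d) ∧ ∫ x in unitCell d, u x = ubar ∧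
        diffuseEnergy W ε ubar u Du ≤ (1 + s ^ 2) * sharpEnergy (screening W) ε ubar u₀ := by
  obtain ⟨B, hB, hcomp⟩ := exists_competitor hW
  have hκ := hW.screening_pos
  set κ := screening W
  obtain ⟨c', hc', hpot⟩ := exists_abs_potential_le_of_recovery d hκ
    (show 0 < 24 * A by positivity)
  set c := 1 + c' with hc
  set b := 2 / κ ^ 2 * (1 + 24 * A * c) with hb
  set a := 24 * A * c + B * c * (b + 12 * A) with ha
  have hc0 : 0 < c := by positivity
  have hb0 : 0 < b := by positivity
  have ha0 : 0 < a := by positivity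
  have hκc : 0 < κ ^ 2 * c := by positivity
  refine ⟨1 / (1 + κ ^ 2 * c + 2 * a), by positivity,
    (div_le_one (by positivity)).2 (by linarith),
    fun s hs hss ε ubar u₀ v L hε hBV hv hvol hloc hpot₀ hE => ?_⟩
  have hs' : s * (1 + κ ^ 2 * c + 2 * a) ≤ 1 := by
    rwa [le_div_iff₀ (by positivity)] at hss
  have hsc : 0 < s * (κ ^ 2 * c) := mul_pos hs hκc
  have hsa' : 0 < s * a := mul_pos hs ha0
  have hs1 : s ≤ 1 := by linarith
  have hsκ : κ ^ 2 * c * s ≤ 1 := by linarith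
  have hsa : a * s ≤ 1 / 2 := by linarith
  set E := sharpEnergy κ ε ubar u₀ with hEdef
  set g₀ : Space d → ℝ := fun x => u₀ x - ubar with hg₀
  set h : Space d → ℝ := fun x => v x - u₀ x with hh
  have hu₀b : IsBoundedBy u₀ 1 := ⟨hBV.aemeasurable.restrict.aestronglyMeasurable, fun x => by
    rcases hBV.values x with h | h <;> simp [h]⟩
  have hvb : IsBoundedBy v 1 :=
    ⟨hv.lipschitz.choose_spec.continuous.aestronglyMeasurable, hv.abs_le_one⟩
  have hg₀b : IsBoundedBy g₀ (1 + |ubar|) := hu₀b.sub (isBoundedBy_const ubar)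
  have hhb : IsBoundedBy h 2 := by
    have := hvb.sub hu₀b
    norm_num at this
    exact this
  have hgb : IsBoundedBy (fun x => g₀ x + h x) _ := hg₀b.add hhb
  have hg : (fun x => v x - ubar) = fun x => g₀ x + h x := by
    ext x; simp only [hg₀, hh]; ring
  set e := ε / 2 * totalVariation u₀ with he
  have he0 : 0 ≤ e := by have := totalVariation_nonneg hBV; positivity
  have hLR0 : 0 ≤ longRangeEnergy (greenScreened κ) g₀ := by
    rw [longRangeEnergy_eq]
    have := integral_mul_potential_self_nonneg hκ hg₀b
    positivity
  have hEe : E = e + longRangeEnergy (greenScreened κ) g₀ := rfl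
  have hE0 : 0 ≤ E := by linarith
  have hvolE : volume.real (L ∩ unitCell d) ≤ 12 * A / s * E :=
    calc volume.real (L ∩ unitCell d) ≤ A * (6 / s) * (ε * totalVariation u₀) := hvol
      _ = 12 * A / s * e := by rw [he]; ring
      _ ≤ 12 * A / s * E := by gcongr; linarith
  have hm : ∫ x in unitCell d, |h x| ≤ 24 * A / s * E := by
    refine (hv.integral_abs_sub_le hBV.values).trans ?_
    calc 2 * volume.real (L ∩ unitCell d) ≤ 2 * (12 * A / s * E) := by gcongr
      _ = _ := by ring
  have hpoth := hpot s hs hs1 h E hhb hm hE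
  have hpotg : ∀ x, |potential (greenScreened κ) (fun y => g₀ y + h y) x| ≤ c * s ^ 4 := by
    intro x
    rw [potential_screened_add hκ hg₀b hhb]
    refine (abs_add_le _ _).trans ((add_le_add (hpot₀ x) (hpoth x)).trans (le_of_eq ?_))
    rw [hc]; ring
  have hs43 : s ^ 4 ≤ s := pow_le_of_le_one hs.le hs1 (by norm_num)
  have hθ1 : κ ^ 2 * (c * s ^ 4) ≤ 1 :=
    calc κ ^ 2 * (c * s ^ 4) ≤ κ ^ 2 * (c * s) := by gcongr
      _ = κ ^ 2 * c * s := by ring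
      _ ≤ 1 := hsκ
  obtain ⟨u, Du, hu, hWu, hmean, hen⟩ := hcomp u₀ v L hv ε ubar (c * s ^ 4)
    (by rw [hg]; exact hpotg) hθ1
  refine ⟨u, Du, hu, hWu, hmean, hen.trans ?_⟩
  rw [hg]
  have hLR : longRangeEnergy (greenScreened κ) (fun x => g₀ x + h x) ≤
      longRangeEnergy (greenScreened κ) g₀ + 24 * A * c * s ^ 3 * E := by
    refine (longRangeEnergy_add_le hκ hg₀b hhb hpot₀ hpoth).trans ?_
    have : (s ^ 4 + c' * s ^ 4) * ∫ x in unitCell d, |h x| ≤ 24 * A * c * s ^ 3 * E :=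
      calc (s ^ 4 + c' * s ^ 4) * ∫ x in unitCell d, |h x|
          = c * s ^ 4 * ∫ x in unitCell d, |h x| := by rw [hc]; ring
        _ ≤ c * s ^ 4 * (24 * A / s * E) := by gcongr
        _ = _ := by field_simp
    linarith
  have hs3 : s ^ 3 ≤ 1 := pow_le_one₀ hs.le hs1
  have hsq : ∫ x in unitCell d, potential (greenScreened κ) (fun y => g₀ y + h y) x ^ 2 ≤
      b * E := by
    have h1 := integral_potential_sq_le hκ hgb
    have h2 := longRangeEnergy_eq (greenScreened κ) (fun x => g₀ x + h x)
    have h3 : 24 * A * c * s ^ 3 * E ≤ 24 * A * c * 1 * E := by gcongr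
    have h4 : κ ^ 2 * ∫ x in unitCell d, potential (greenScreened κ) (fun y => g₀ y + h y) x ^ 2 ≤
        2 * (1 + 24 * A * c) * E := by linarith
    rw [← le_div_iff₀' (by positivity)] at h4
    refine h4.trans (le_of_eq ?_)
    rw [hb]; ring
  exact add_errors_le hB hc0 hb0 hs hs1 he0 hLR0 hEe hsa hloc hLR hsq hvolE

end

end OhtaKawasaki

theorem propositionp (d : ℕ) (hd : 1 ≤ d) (W : ℝ → ℝ) (hW : IsDoubleWell d W) :
    ∃ δ₀ : ℝ, 0 < δ₀ ∧ ∀ δ : ℝ, 0 < δ → δ ≤ δ₀ →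
      ∀ α : ℝ, 0 ≤ α → α < 1 →
        ∃ ε₀ : ℝ, 0 < ε₀ ∧ ∀ ε : ℝ, 0 < ε → ε ≤ ε₀ →
          ∀ (ubar : ℝ) (u₀ : Space d → ℝ),
            IsBVSign u₀ →
            HasC2JumpSet u₀ →
            (∀ x ∈ jumpSet u₀, ∀ k : ℝ, IsPrincipalCurvature u₀ x k → |k| ≤ ε ^ (-α)) →
            IsSeparated u₀ (ε ^ α) →
            (∀ x, |potential (greenScreened (screening W)) (fun y => u₀ y - ubar) x| ≤ δ) →
            sharpEnergy (screening W) ε ubar u₀ ≤ δ ^ (((d : ℝ) + 3) / 2) →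
            ∃ (u : Space d → ℝ) (Du : Space d → Space d),
              IsH1 u Du ∧
              IntegrableOn (fun x => W (u x)) (unitCell d) ∧
              ∫ x in unitCell d, u x = ubar ∧
              diffuseEnergy W ε ubar u Du ≤
                (1 + δ ^ ((1 : ℝ) / 2)) * sharpEnergy (screening W) ε ubar u₀ := by
  obtain ⟨A, hA, hrec⟩ := exists_recovery hW
  obtain ⟨s₀, hs₀, hs₀1, hcomp⟩ := exists_competitor_of_recovery hW hA
  refine ⟨s₀ ^ 4, by positivity, fun δ hδ hδs α _ hα => ?_⟩
  obtain ⟨s, hs, rfl⟩ : ∃ s : ℝ, 0 < s ∧ s ^ 4 = δ :=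
    ⟨δ ^ ((1 : ℝ) / 4), by positivity, by
      rw [← Real.rpow_natCast, ← Real.rpow_mul hδ.le]; norm_num⟩
  have hss : s ≤ s₀ := le_of_pow_le_pow_left₀ (by norm_num) hs₀.le hδs
  have hpow : ∀ t : ℝ, (s ^ 4) ^ t = s ^ (4 * t) := fun t => by
    rw [Real.rpow_mul hs.le, ← Real.rpow_natCast s 4]; norm_num
  have hτ : ((s / 6) ^ 4) ^ (-(1 : ℝ) / 4) = 6 / s := by
    rw [← Real.rpow_natCast, ← Real.rpow_mul (by positivity)]
    norm_num
    rw [Real.rpow_neg_one, inv_div]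
  have hsqτ : Real.sqrt ((s / 6) ^ 4) = s ^ 2 / 36 := by
    rw [show (s / 6) ^ 4 = (s ^ 2 / 36) ^ 2 by ring, Real.sqrt_sq (by positivity)]
  have hroot : (s ^ 4) ^ ((1 : ℝ) / 2) = s ^ 2 := by
    rw [hpow, ← Real.rpow_natCast]; norm_num
  have hexp : (s ^ 4) ^ (((d : ℝ) + 3) / 2) = s ^ (2 * (d + 3)) := by
    rw [hpow, ← Real.rpow_natCast]
    congr 1
    push_cast
    ring
  obtain ⟨ε₀, hε₀, hε₀'⟩ := hrec ((s / 6) ^ 4) (by positivity)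
    (pow_le_one₀ (by positivity) (by linarith)) α hα
  refine ⟨ε₀, hε₀, fun ε hε hεε ubar u₀ hBV hC2 hcurv _ hpot₀ hE => ?_⟩
  obtain ⟨v, L, hv, hvol, hloc⟩ := hε₀' ε hε hεε u₀ hBV hC2 hcurv
  rw [hτ] at hvol
  rw [hsqτ] at hloc
  rw [hexp] at hE
  rw [hroot]
  exact hcomp s hs hss ε ubar u₀ v L hε hBV hv hvol hloc hpot₀ hE
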